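/- Let $Y$ be a simply connected finite simplicial complex equipped with a metric bilipschitz to a linear one (a path metric for which every simplex carries a Euclidean metric, these metrics agreeing on common faces). Let $\Lambda Y$ be the space of Lipschitz maps $S^1=\mathbb{R}/\mathbb{Z}\to Y$ with the topology of uniform convergence, and for $y_0\in Y$ let $\Omega Y=\Omega_{y_0}Y\subset\Lambda Y$ be the subspace of loops based at $y_0$. Let $\operatorname{len}$ denote the length of a loop. For $A=\Omega Y$ or $A=\Lambda Y$, a field $k$ and $n\ge 0$, let $PH_n(A,\operatorname{len})$ be the persistence module $t\mapsto H_n(\{\gamma\in A:\operatorname{len}\gamma\le t\};k)$, $t\in\mathbb{R}$ (singular homology, with the maps induced by inclusions). Its bars are the points of its persistence diagram: writing $M_t$ for the module at time $t$, it has a finite bar with birth time $p$ and death time $q$, $p<q$, if for all $a<p<b\le c<q<d$ some element of $M_b$ becomes zero in $M_d$ while its image in $M_c$ does not come from $M_a$; it has an infinite bar with birth time $p$ if for all $a<p<b$ there is an element of $M_b$ whose image in $M_c$ does not come from $M_a$, for any $c\ge b$. Then there is a constant $C=C(Y)$ such that for every base point, every field $k$ and every $m\ge 1$: (i) every infinite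 bar in $PH_m(\Omega Y,\operatorname{len})$ or $PH_m(\Lambda Y,\operatorname{len})$ has birth time at most $Cm+C$; (ii) every finite bar in $PH_{m-1}(\Omega Y,\operatorname{len})$ or $PH_{m-1}(\Lambda Y,\operatorname{len})$ has length at most $Cm+C$. -/

import Mathlib

open CategoryTheory

universe u v

noncomputable section

/-! ### Linear metrics on finite simplicial complexes -/

/-- A simplexwise Euclidean (linear) structure on a simplicial complex `K`: every simplex `s`
carries the Euclidean metric pulled back along a linear isomorphism `lin s`, and these metrics
agree on common faces. -/
structure LinearStructure {N : ℕ}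
    (K : Geometry.SimplicialComplex ℝ (EuclideanSpace ℝ (Fin N))) where
  /-- the linear chart used to measure inside the simplex `s` -/
  lin : Finset (EuclideanSpace ℝ (Fin N)) →
    (EuclideanSpace ℝ (Fin N) ≃ₗ[ℝ] EuclideanSpace ℝ (Fin N))
  compat : ∀ s ∈ K.faces, ∀ t ∈ K.faces, t ⊆ s →
    ∀ x ∈ convexHull ℝ (t : Set (EuclideanSpace ℝ (Fin N))),
    ∀ y ∈ convexHull ℝ (t : Set (EuclideanSpace ℝ (Fin N))),
      ‖lin s (y - x)‖ = ‖lin t (y - x)‖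

namespace LinearStructure

variable {N : ℕ} {K : Geometry.SimplicialComplex ℝ (EuclideanSpace ℝ (Fin N))}

/-- `g.PolyPath x y l`: there is a polygonal path in `|K|` from `x` to `y`, each of whose straight
pieces lies in a simplex of `K`, of total length `l` (measured simplex by simplex with `g`). -/
inductive PolyPath (g : LinearStructure K) :
    EuclideanSpace ℝ (Fin N) → EuclideanSpace ℝ (Fin N) → ℝ → Prop
  | refl (x : EuclideanSpace ℝ (Fin N)) (hx : x ∈ K.space) : PolyPath g x x 0
  | step (x y z : EuclideanSpace ℝ (Fin N)) (l : ℝ) (s : Finset (EuclideanSpace ℝ (Fin N)))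
      (h : PolyPath g x y l) (hs : s ∈ K.faces)
      (hy : y ∈ convexHull ℝ (s : Set (EuclideanSpace ℝ (Fin N))))
      (hz : z ∈ convexHull ℝ (s : Set (EuclideanSpace ℝ (Fin N)))) :
      PolyPath g x z (l + ‖g.lin s (z - y)‖)

/-- The linear metric: the path metric on `|K|` induced by the Euclidean metrics of the
simplices. -/
def pathDist (g : LinearStructure K) (x y : EuclideanSpace ℝ (Fin N)) : ℝ :=
  sInf {l : ℝ | g.PolyPath x y l}

end LinearStructure

/-- `Y` is a finite simplicial complex (it comes with a triangulation `h` by a finite complex `K`)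
whose metric is bilipschitz to a linear metric on that complex. -/
def IsFiniteComplexBilipschitzToLinear (Y : Type u) [MetricSpace Y] : Prop :=
  ∃ (N : ℕ) (K : Geometry.SimplicialComplex ℝ (EuclideanSpace ℝ (Fin N)))
    (g : LinearStructure K) (h : Y ≃ K.space) (κ : ℝ),
    K.faces.Finite ∧ 0 < κ ∧ ∀ x y : Y,
      g.pathDist (h x) (h y) ≤ κ * dist x y ∧ dist x y ≤ κ * g.pathDist (h x) (h y)

/-! ### Loop spaces and the length functional -/

/-- The length of a loop, parametrized by the circle `ℝ / ℤ`: the supremum of the lengths of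
inscribed polygons. It is finite when the loop is Lipschitz. -/
def loopLength {Y : Type u} [MetricSpace Y] (f : C(UnitAddCircle, Y)) : ℝ :=
  (eVariationOn (fun t : ℝ => f (t : UnitAddCircle)) (Set.Icc 0 1)).toReal

/-- The free loop space `ΛY`: Lipschitz maps from the circle to `Y`, with the topology of uniform
convergence. -/
def FreeLoops (Y : Type u) [MetricSpace Y] : Type u :=
  {f : C(UnitAddCircle, Y) // ∃ L : NNReal, LipschitzWith L f}

instance (Y : Type u) [MetricSpace Y] : TopologicalSpace (FreeLoops Y) :=
  inferInstanceAs
    (TopologicalSpace {f : C(UnitAddCircle, Y) // ∃ L : NNReal, LipschitzWith L f})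

/-- The based loop space `ΩY` at the point `y₀`. -/
def BasedLoops (Y : Type u) [MetricSpace Y] (y₀ : Y) : Type u :=
  {f : C(UnitAddCircle, Y) // (∃ L : NNReal, LipschitzWith L f) ∧ f 0 = y₀}

instance (Y : Type u) [MetricSpace Y] (y₀ : Y) : TopologicalSpace (BasedLoops Y y₀) :=
  inferInstanceAs
    (TopologicalSpace {f : C(UnitAddCircle, Y) // (∃ L : NNReal, LipschitzWith L f) ∧ f 0 = y₀})

/-- Length as a function on `ΛY`. -/
def FreeLoops.len {Y : Type u} [MetricSpace Y] (f : FreeLoops Y) : ℝ := loopLength f.1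

/-- Length as a function on `ΩY`. -/
def BasedLoops.len {Y : Type u} [MetricSpace Y] {y₀ : Y} (f : BasedLoops Y y₀) : ℝ :=
  loopLength f.1

/-! ### Persistence modules and persistent homology -/

/-- A persistence module over `k`: a functor from `(ℝ, ≤)` to `k`-modules. -/
abbrev PersistenceModule (k : Type v) [Field k] := ℝ ⥤ ModuleCat.{max u v} k

namespace PersistenceModule

variable {k : Type v} [Field k]

/-- The structure map `M_s → M_t`, for `s ≤ t`. -/
def trans (M : PersistenceModule.{u, v} k) {s t : ℝ} (h : s ≤ t) : M.obj s →ₗ[k] M.obj t :=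
  (M.map (homOfLE h)).hom

/-- `M` has a finite bar with birth time `p` and death time `q`, that is, `(p, q)` is a point of
the persistence diagram of `M`: in every rectangle `(a, b] × (c, d]` around `(p, q)` a bar is
counted, which means that some class already present at time `b` is zero at time `d`, while at
time `c` it is not the image of a class present at time `a`. (The number of bars counted by the
rectangle is the dimension of
`(im (M_b → M_c) ∩ ker (M_c → M_d)) / (im (M_a → M_c) ∩ ker (M_c → M_d))`.)
For direct sums of interval modules that are finite near `(p, q)` this says that an interval with
endpoints `p` and `q` occurs; the definition needs no decomposition of `M`. -/
def HasFiniteBar (M : PersistenceModule.{u, v} k) (p q : ℝ) : Prop :=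
  p < q ∧ ∀ (a b c d : ℝ) (hab : a < b) (hbc : b ≤ c) (hcd : c < d),
    a < p → p < b → c < q → q < d →
      ∃ x : M.obj b, M.trans (hbc.trans hcd.le) x = 0 ∧
        M.trans hbc x ∉ LinearMap.range (M.trans (hab.le.trans hbc))

/-- `M` has an infinite bar with birth time `p`: whenever `a < p < b`, some class present at time
`b` lives forever and at no later time becomes the image of a class present at time `a`. -/
def HasInfiniteBar (M : PersistenceModule.{u, v} k) (p : ℝ) : Prop :=
  ∀ (a b : ℝ) (hab : a < b), a < p → p < b →
    ∃ x : M.obj b, ∀ (c : ℝ) (hbc : b ≤ c),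
      M.trans hbc x ∉ LinearMap.range (M.trans (hab.le.trans hbc))

end PersistenceModule

/-- The filtration of a space `A` by the sublevel sets `{x | f x ≤ t}`. -/
def sublevelFunctor {A : Type u} [TopologicalSpace A] (f : A → ℝ) : ℝ ⥤ TopCat.{u} where
  obj t := TopCat.of {x : A // f x ≤ t}
  map {s t} h := TopCat.ofHom
    { toFun := fun x => ⟨x.1, x.2.trans (leOfHom h)⟩
      continuous_toFun := by fun_prop }

/-- `PH_n(A, f; k)`: the singular homology, with coefficients in the field `k`, of the sublevel
sets of `f`. -/
def persistentHomology (k : Type v) [Field k] (n : ℕ) {A : Type u} [TopologicalSpace A]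
    (f : A → ℝ) : PersistenceModule.{u, v} k :=
  sublevelFunctor f ⋙
    (AlgebraicTopology.singularHomologyFunctor.{u} (ModuleCat.{max u v} k) n).obj
      (ModuleCat.of k (ULift.{max u v} k))

end

/-!
# Linear bounds for bars in the homology of loop spaces

Bounds for bars follow from deformations of singular simplices. Suppose that the singular
`n`-simplices of a loop space can be deformed, compatibly with all simplicial operators, so that the
lengths of the loops grow by at most `c` on the way and are at most `c` in the end. Then every class
of degree `n` at level `b` becomes, at level `b + c`, the image of a class at level `c`, and this
image vanishes if the class dies at any later level, provided that the simplices of dimension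
`n + 1` can be deformed as well. Thus infinite bars are born before `c`, and finite bars are no
longer than `c`. A class involves finitely many simplices, so it is enough to have a sequence of
deformations such that every simplex can be treated by almost all of them
(`SimplexSweep.Compresses.infiniteBar_le`, `SimplexSweep.Compresses.finiteBar_le`).

To find such deformations, replace `Y` by the complex `X` in barycentric coordinates, of which it is
a Lipschitz image (`IsFiniteComplexBilipschitzToLinear.exists_realization`). Since `X` is simply
connected, its identity is homotopic to a map which sends the whole 1-skeleton to a point. A
Lipschitz approximation of the homotopy, which moves points within their carriers only, is a
Lipschitz homotopy `S` from a map which preserves carriers to a map which is constant on the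
1-skeleton
(`exists_lipschitz_contraction_of_skeleton`).

Let `q (l, t)` be a family of loops in `X` with parameter `l` in a simplex. At time `u`, move `l` to
a point of the grid of mesh `1 / M`, in phase with `u`, round `u` down to a multiple of `1 / M`, and
choose a vertex of `X` near the resulting point of the family. The averages of this vertex over
windows of width `1 / M` form a loop, the moving average. It depends continuously on `l`, it is
natural in the simplex, and for large `M` it lies in the carriers of the points `q (l, t)`, so that
there is a straight homotopy from `q (l, ·)` to its image under `S (0, ·)`. During one period the
grid point jumps at most `2 (n + 1)` times. A window which meets no jump involves two sampled
vertices only, so there the moving average runs in an edge, where `S (1, ·)` is constant. Each jump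
affects three windows at most, and the moving average is Lipschitz with constant `2 M`. Hence the
image of the moving average under `S (1, ·)` has length at most a constant times `n + 1`, whatever
the loops and `M` are (`eVariationOn_comp_smoothLoop_le`).

The intermediate stages of the homotopy from `q (l, ·)` to this short loop may be long, so it is not
used as it stands. Instead a detour is inserted into the loop: along the track of the base point to
the short loop, along a part of the short loop, and back along a track of the homotopy to the
original loop, which is followed to its end (`detourTime`, `detourHeight`). The tracks have bounded
length since the homotopy is Lipschitz, and the original loop contributes its own length at most,
and nothing at all once the detour sweeps over all of it (`eVariationOn_detour`). The base point
stays where it is, so free and based loops are treated alike.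
-/

noncomputable section

/-! ### Lifting homology classes to subcomplexes -/

section ChainLifting

open CategoryTheory.Limits Simplicial

variable {k : Type v} [Field k]

lemma ChainComplex.exists_cycles_of_d_eq_zero (K : ChainComplex (ModuleCat.{max u v} k) ℕ)
    {n : ℕ} (z : K.X n) (hz : ∀ j, K.d n j z = 0) : ∃ c : K.cycles n, K.iCycles n c = z := by
  let S := K.sc n
  have h0 : S.g z = 0 := hz _
  refine ⟨S.moduleCatCyclesIso.inv ⟨z, h0⟩, ?_⟩
  exact ConcreteCategory.congr_hom S.moduleCatCyclesIso_inv_iCycles ⟨z, h0⟩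

lemma ChainComplex.exists_boundary_of_homologyπ_eq_zero
    (K : ChainComplex (ModuleCat.{max u v} k) ℕ) {n : ℕ} (c : K.cycles n)
    (hc : K.homologyπ n c = 0) : ∃ w : K.X (n + 1), K.toCycles (n + 1) n w = c := by
  have hex : (ShortComplex.mk (K.toCycles (n + 1) n) (K.homologyπ n) (by simp)).Exact :=
    ShortComplex.exact_of_g_is_cokernel _ (K.homologyIsCokernel (n + 1) n (by simp))
  exact (ShortComplex.moduleCat_exact_iff _).1 hex c hc

lemma ChainComplex.homologyπ_surjective (K : ChainComplex (ModuleCat.{max u v} k) ℕ) (n : ℕ) :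
    Function.Surjective (K.homologyπ n) :=
  (ModuleCat.epi_iff_surjective _).1 inferInstance

lemma ChainComplex.iCycles_injective (K : ChainComplex (ModuleCat.{max u v} k) ℕ) (n : ℕ) :
    Function.Injective (K.iCycles n) :=
  (ModuleCat.mono_iff_injective _).1 inferInstance

variable (R : ModuleCat.{max u v} k)

/-- A chain involves finitely many simplices, so it lifts along any simplicial map which has all
of those in its image. -/
lemma SSet.exists_finite_support (S : SSet.{u}) {n : ℕ} (z : (S.chainComplex R).X n) :
    ∃ T : Set (S _⦋n⦌), T.Finite ∧ ∀ (Q : SSet.{u}) (i : Q ⟶ S),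
      (∀ x ∈ T, ∃ y, i.app _ y = x) → ∃ z', (SSet.chainComplexMap i R).f n z' = z := by
  let W : Submodule k ((S.chainComplex R).X n) :=
    ⨆ x : S _⦋n⦌, LinearMap.range (S.ιChainComplex (R := R) x).hom
  have hW : W = ⊤ := by
    have h : ModuleCat.ofHom W.mkQ = 0 := by
      apply SSet.chainComplex_hom_ext
      intro x
      ext r
      simp only [ModuleCat.hom_comp, LinearMap.comp_apply, ModuleCat.hom_ofHom, comp_zero,
        ModuleCat.hom_zero, LinearMap.zero_apply]
      rw [Submodule.mkQ_apply, Submodule.Quotient.mk_eq_zero]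
      exact Submodule.mem_iSup_of_mem x ⟨r, rfl⟩
    rw [eq_top_iff]
    intro y _
    have := ConcreteCategory.congr_hom h y
    exact (Submodule.Quotient.mk_eq_zero W).1 this
  have hz : z ∈ W := hW ▸ Submodule.mem_top
  induction hz using Submodule.iSup_induction' with
  | mem x z hz =>
    obtain ⟨r, rfl⟩ := hz
    refine ⟨{x}, Set.finite_singleton _, fun Q i hT => ?_⟩
    obtain ⟨y, hy⟩ := hT x rfl
    refine ⟨Q.ιChainComplex (R := R) y r, ?_⟩
    have := ConcreteCategory.congr_hom (SSet.ι_chainComplexMap_f Q S i R y) r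
    rw [hy] at this
    exact this
  | zero => exact ⟨∅, Set.finite_empty, fun Q i _ => ⟨0, map_zero _⟩⟩
  | add x y _ _ hx hy =>
    obtain ⟨T, hT, h⟩ := hx
    obtain ⟨T', hT', h'⟩ := hy
    refine ⟨T ∪ T', hT.union hT', fun Q i hi => ?_⟩
    obtain ⟨a, ha⟩ := h Q i (fun x hx => hi x (Or.inl hx))
    obtain ⟨b, hb⟩ := h' Q i (fun x hx => hi x (Or.inr hx))
    exact ⟨a + b, by rw [map_add, ha, hb]⟩

lemma SSet.chainComplexMap_injective {Q S : SSet.{u}} (i : Q ⟶ S)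
    (hi : ∀ n, Function.Injective (i.app n)) (n : ℕ) :
    Function.Injective ((SSet.chainComplexMap i R).f n) := by
  rcases isEmpty_or_nonempty (Q _⦋n⦌) with he | he
  · intro a b _
    have : (𝟙 ((Q.chainComplex R).X n)) = 0 :=
      SSet.chainComplex_hom_ext fun x => (he.false x).elim
    have h := fun a => ConcreteCategory.congr_hom this a
    rw [show a = 0 from h a, show b = 0 from h b]
  · obtain ⟨g, hg⟩ := (hi (.op ⦋n⦌)).hasLeftInverse
    let p : (S.chainComplex R).X n ⟶ (Q.chainComplex R).X n :=
      (S.isColimitChainComplexXCofan R n).desc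
        (Cofan.mk _ fun x => Q.ιChainComplex (R := R) (g x))
    have hp : (SSet.chainComplexMap i R).f n ≫ p = 𝟙 _ := by
      apply SSet.chainComplex_hom_ext
      intro x
      rw [SSet.ι_chainComplexMap_f_assoc]
      have := (S.isColimitChainComplexXCofan R n).fac
        (Cofan.mk _ fun x => Q.ιChainComplex (R := R) (g x)) ⟨i.app _ x⟩
      refine this.trans ?_
      simp only [Category.comp_id]
      exact congrArg (fun y => Q.ιChainComplex (R := R) y) (hg x)
    intro a b hab
    have h := fun a => ConcreteCategory.congr_hom hp a
    rw [← show p _ = a from h a, ← show p _ = b from h b]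
    exact congrArg _ hab

lemma SSet.iCycles_cyclesMap {A B : SSet.{u}} (p : A ⟶ B) {n : ℕ}
    (a : (A.chainComplex R).cycles n) :
    (B.chainComplex R).iCycles n (HomologicalComplex.cyclesMap (SSet.chainComplexMap p R) n a) =
      (SSet.chainComplexMap p R).f n ((A.chainComplex R).iCycles n a) :=
  ConcreteCategory.congr_hom (HomologicalComplex.cyclesMap_i (SSet.chainComplexMap p R) n) a

lemma SSet.homologyMap_homologyπ {A B : SSet.{u}} (p : A ⟶ B) {n : ℕ}
    (a : (A.chainComplex R).cycles n) :
    SSet.homologyMap p R n ((A.chainComplex R).homologyπ n a) =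
      (B.chainComplex R).homologyπ n
        (HomologicalComplex.cyclesMap (SSet.chainComplexMap p R) n a) :=
  ConcreteCategory.congr_hom
    (HomologicalComplex.homologyπ_naturality (SSet.chainComplexMap p R) n) a

/-- A cycle whose underlying chain comes from a sub-simplicial set comes from a cycle there, since
the map of chains is injective. -/
lemma SSet.exists_cycles_lift {Q S : SSet.{u}} (i : Q ⟶ S)
    (hi : ∀ n, Function.Injective (i.app n)) {n : ℕ} (c : (S.chainComplex R).cycles n)
    (z' : (Q.chainComplex R).X n)
    (hz' : (SSet.chainComplexMap i R).f n z' = (S.chainComplex R).iCycles n c) :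
    ∃ c' : (Q.chainComplex R).cycles n, (Q.chainComplex R).iCycles n c' = z' ∧
      HomologicalComplex.cyclesMap (SSet.chainComplexMap i R) n c' = c := by
  obtain ⟨c', hc'⟩ := ChainComplex.exists_cycles_of_d_eq_zero (Q.chainComplex R) z' (fun j => by
    apply SSet.chainComplexMap_injective R i hi j
    have h1 := ConcreteCategory.congr_hom ((SSet.chainComplexMap i R).comm n j) z'
    have h2 := ConcreteCategory.congr_hom ((S.chainComplex R).iCycles_d n j) c
    rw [map_zero]
    refine h1.symm.trans ?_
    rw [ModuleCat.comp_apply, hz']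
    exact h2)
  refine ⟨c', hc', ?_⟩
  apply ChainComplex.iCycles_injective
  rw [SSet.iCycles_cyclesMap, hc', hz']

/-- Every homology class of `S` comes from any sub-simplicial set which contains a certain finite
set of simplices. -/
lemma SSet.exists_homology_lift (S : SSet.{u}) {n : ℕ}
    (x : (S.homology R n : ModuleCat.{max u v} k)) :
    ∃ T : Set (S _⦋n⦌), T.Finite ∧ ∀ (Q : SSet.{u}) (i : Q ⟶ S),
      (∀ n, Function.Injective (i.app n)) → (∀ x ∈ T, ∃ y, i.app _ y = x) →
      ∃ x', SSet.homologyMap i R n x' = x := by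
  obtain ⟨c, rfl⟩ := ChainComplex.homologyπ_surjective _ n x
  obtain ⟨T, hT, h⟩ := SSet.exists_finite_support R S ((S.chainComplex R).iCycles n c)
  refine ⟨T, hT, fun Q i hi hx => ?_⟩
  obtain ⟨z', hz'⟩ := h Q i hx
  obtain ⟨c', -, hc'⟩ := SSet.exists_cycles_lift R i hi c z' hz'
  exact ⟨(Q.chainComplex R).homologyπ n c', by rw [SSet.homologyMap_homologyπ, hc']⟩

/-- A class of `S` which dies in `S'` comes from a class which dies already in `Q'`, for all pairs
`Q ⟶ Q'` of sub-simplicial sets containing certain finite sets of simplices of `S` and `S'`. -/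
lemma SSet.exists_homology_lift_of_map_eq_zero {S S' : SSet.{u}} (f : S ⟶ S') {n : ℕ}
    (x : (S.homology R n : ModuleCat.{max u v} k)) (hx : SSet.homologyMap f R n x = 0) :
    ∃ (T : Set (S _⦋n⦌)) (T' : Set (S' _⦋n + 1⦌)), T.Finite ∧ T'.Finite ∧
      ∀ (Q Q' : SSet.{u}) (i : Q ⟶ S) (i' : Q' ⟶ S') (g : Q ⟶ Q'), g ≫ i' = i ≫ f →
      (∀ n, Function.Injective (i.app n)) → (∀ n, Function.Injective (i'.app n)) →
      (∀ x ∈ T, ∃ y, i.app _ y = x) → (∀ x ∈ T', ∃ y, i'.app _ y = x) →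
      ∃ x', SSet.homologyMap i R n x' = x ∧ SSet.homologyMap g R n x' = 0 := by
  obtain ⟨c, rfl⟩ := ChainComplex.homologyπ_surjective _ n x
  rw [SSet.homologyMap_homologyπ] at hx
  obtain ⟨w, hw⟩ := ChainComplex.exists_boundary_of_homologyπ_eq_zero _ _ hx
  obtain ⟨T, hT, h⟩ := SSet.exists_finite_support R S ((S.chainComplex R).iCycles n c)
  obtain ⟨T', hT', h'⟩ := SSet.exists_finite_support R S' w
  refine ⟨T, T', hT, hT', fun Q Q' i i' g hg hi hi' hx hx' => ?_⟩
  obtain ⟨z', hz'⟩ := h Q i hx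
  obtain ⟨w', hw'⟩ := h' Q' i' hx'
  obtain ⟨c', hc'z, hc'⟩ := SSet.exists_cycles_lift R i hi c z' hz'
  refine ⟨(Q.chainComplex R).homologyπ n c', by rw [SSet.homologyMap_homologyπ, hc'], ?_⟩
  rw [SSet.homologyMap_homologyπ]
  have e1 : ∀ (A : SSet.{u}) (a), (A.chainComplex R).iCycles n
      ((A.chainComplex R).toCycles (n + 1) n a) = (A.chainComplex R).d (n + 1) n a :=
    fun A a => ConcreteCategory.congr_hom ((A.chainComplex R).toCycles_i (n + 1) n) a
  have : HomologicalComplex.cyclesMap (SSet.chainComplexMap g R) n c' =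
      (Q'.chainComplex R).toCycles (n + 1) n w' := by
    apply ChainComplex.iCycles_injective
    apply SSet.chainComplexMap_injective R i' hi'
    have h1 := ConcreteCategory.congr_hom ((SSet.chainComplexMap i' R).comm (n + 1) n) w'
    have h5 : SSet.chainComplexMap g R ≫ SSet.chainComplexMap i' R =
        SSet.chainComplexMap i R ≫ SSet.chainComplexMap f R := by
      rw [← Functor.map_comp, ← Functor.map_comp, hg]
    have h6 := ConcreteCategory.congr_hom (congrArg (fun φ => φ.f n) h5) z'
    rw [e1, SSet.iCycles_cyclesMap, hc'z]
    refine h6.trans (Eq.trans ?_ h1)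
    change (SSet.chainComplexMap f R).f n ((SSet.chainComplexMap i R).f n z') =
      (S'.chainComplex R).d (n + 1) n ((SSet.chainComplexMap i' R).f (n + 1) w')
    rw [hz', hw', ← e1, hw]
    exact (SSet.iCycles_cyclesMap R f c).symm
  rw [this]
  exact ConcreteCategory.congr_hom ((Q'.chainComplex R).toCycles_comp_homologyπ (n + 1) n) w'

end ChainLifting

/-! ### Natural deformations of singular simplices -/

section Sweep

open Simplicial Opposite

/-- The map of topological simplices induced by a monotone map of their vertices. -/
def simplexMap {m n : ℕ} (θ : Fin (m + 1) →o Fin (n + 1)) :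
    C(stdSimplex ℝ (Fin (m + 1)), stdSimplex ℝ (Fin (n + 1))) :=
  ⟨stdSimplex.map θ, stdSimplex.continuous_map θ⟩

/-- A natural deformation of those singular simplices of `A` which satisfy the predicate `Good`:
each such simplex is the start of a homotopy `sweep`, and both goodness and the homotopy are
compatible with all simplicial operators. -/
structure SimplexSweep (A : Type u) [TopologicalSpace A] where
  /-- the simplices which are deformed -/
  Good : ∀ {n : ℕ}, C(stdSimplex ℝ (Fin (n + 1)), A) → Prop
  /-- the deformation of a good simplex -/
  sweep : ∀ {n : ℕ} (σ : C(stdSimplex ℝ (Fin (n + 1)), A)), Good σ →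
    C(stdSimplex ℝ (Fin (n + 1)) × unitInterval, A)
  good_comp : ∀ {m n : ℕ} (θ : Fin (m + 1) →o Fin (n + 1))
    (σ : C(stdSimplex ℝ (Fin (n + 1)), A)), Good σ → Good (σ.comp (simplexMap θ))
  sweep_comp : ∀ {m n : ℕ} (θ : Fin (m + 1) →o Fin (n + 1))
    (σ : C(stdSimplex ℝ (Fin (n + 1)), A)) (h : Good σ) (h' : Good (σ.comp (simplexMap θ)))
    (l : stdSimplex ℝ (Fin (m + 1))) (s : unitInterval),
    sweep (σ.comp (simplexMap θ)) h' (l, s) = sweep σ h (simplexMap θ l, s)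
  sweep_zero : ∀ {n : ℕ} (σ : C(stdSimplex ℝ (Fin (n + 1)), A)) (h : Good σ)
    (l : stdSimplex ℝ (Fin (n + 1))), sweep σ h (l, 0) = σ l

variable {A : Type u} [TopologicalSpace A]

/-- The singular simplex of `A` underlying a singular simplex of the sublevel set `{f ≤ b}`. -/
def ambientSimplex (f : A → ℝ) (b : ℝ) {n : SimplexCategoryᵒᵖ}
    (σ : (TopCat.toSSet.obj (TopCat.of {x : A // f x ≤ b})).obj n) :
    C(stdSimplex ℝ (Fin (n.unop.len + 1)), A) :=
  (ContinuousMap.mk Subtype.val continuous_subtype_val).comp (TopCat.toSSetObjEquiv _ n σ)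

namespace SimplexSweep

variable (D : SimplexSweep A) (f : A → ℝ)

/-- The simplices of the sublevel set `{f ≤ b}` which can be deformed within `{f ≤ t}`
into `{f ≤ a}`. -/
def controlled (b t a : ℝ) :
    (TopCat.toSSet.obj (TopCat.of {x : A // f x ≤ b})).Subcomplex where
  obj n := {σ | ∃ h : D.Good (ambientSimplex f b σ),
    (∀ l s, f (D.sweep _ h (l, s)) ≤ t) ∧ ∀ l, f (D.sweep _ h (l, 1)) ≤ a}
  map {n m} θ σ := by
    rintro ⟨h, h1, h2⟩
    refine ⟨D.good_comp _ _ h, fun l s => ?_, fun l => ?_⟩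
    · have := D.sweep_comp θ.unop.toOrderHom _ h (D.good_comp _ _ h) l s
      exact (congrArg f this).trans_le (h1 _ _)
    · have := D.sweep_comp θ.unop.toOrderHom _ h (D.good_comp _ _ h) l 1
      exact (congrArg f this).trans_le (h2 _)

/-- The deformation, as a simplicial map to the singular simplices of a path space. -/
def sweepMap (b t a : ℝ) : (D.controlled f b t a : SSet) ⟶
    TopCat.toSSet.obj (TopCat.of C(unitInterval, {x : A // f x ≤ t})) where
  app n := TypeCat.ofHom fun σ => (TopCat.toSSetObjEquiv _ n).symm
    (ContinuousMap.curry ⟨fun p => ⟨D.sweep _ σ.2.choose p, σ.2.choose_spec.1 p.1 p.2⟩,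
      by fun_prop⟩)
  naturality n m θ := by
    ext σ
    apply (TopCat.toSSetObjEquiv _ m).injective
    ext l s
    exact D.sweep_comp θ.unop.toOrderHom _ σ.2.choose _ l s

/-- The end of the deformation. -/
def endMap (b t a : ℝ) : (D.controlled f b t a : SSet) ⟶
    TopCat.toSSet.obj (TopCat.of {x : A // f x ≤ a}) where
  app n := TypeCat.ofHom fun σ => (TopCat.toSSetObjEquiv _ n).symm
    ⟨fun l => ⟨D.sweep _ σ.2.choose (l, 1), σ.2.choose_spec.2 l⟩, by fun_prop⟩
  naturality n m θ := by
    ext σ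
    apply (TopCat.toSSetObjEquiv _ m).injective
    ext l
    exact D.sweep_comp θ.unop.toOrderHom _ σ.2.choose _ l 1

end SimplexSweep

/-- Evaluation of paths at a fixed time. -/
def pathEval (Z : Type u) [TopologicalSpace Z] (s : unitInterval) :
    TopCat.of C(unitInterval, Z) ⟶ TopCat.of Z :=
  TopCat.ofHom ⟨fun γ => γ s, by fun_prop⟩

/-- The evaluations at the two ends of a path are homotopic. -/
def pathEvalHomotopy (Z : Type u) [TopologicalSpace Z] :
    TopCat.Homotopy (pathEval Z 0) (pathEval Z 1) where
  toFun p := p.2 p.1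
  continuous_toFun := by fun_prop
  map_zero_left _ := rfl
  map_one_left _ := rfl

/-- The inclusion of one sublevel set into another. -/
def sublevelInclusion (f : A → ℝ) {s t : ℝ} (h : s ≤ t) :
    TopCat.of {x : A // f x ≤ s} ⟶ TopCat.of {x : A // f x ≤ t} :=
  (sublevelFunctor f).map (homOfLE h)

namespace SimplexSweep

variable (D : SimplexSweep A) (f : A → ℝ)

lemma sweepMap_zero {b t a : ℝ} (h : b ≤ t) :
    D.sweepMap f b t a ≫ TopCat.toSSet.map (pathEval _ 0) =
      (D.controlled f b t a).ι ≫ TopCat.toSSet.map (sublevelInclusion f h) := by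
  ext n σ
  apply (TopCat.toSSetObjEquiv _ n).injective
  ext l
  exact D.sweep_zero _ σ.2.choose l

lemma sweepMap_one {b t a : ℝ} (h : a ≤ t) :
    D.sweepMap f b t a ≫ TopCat.toSSet.map (pathEval _ 1) =
      D.endMap f b t a ≫ TopCat.toSSet.map (sublevelInclusion f h) := rfl

/-- In the larger sublevel set, a class carried by controlled simplices equals the class at the end
of their deformation. -/
lemma homologyMap_controlled {k : Type v} [Field k] (R : ModuleCat.{max u v} k) {b t a : ℝ}
    (hb : b ≤ t) (ha : a ≤ t) (n : ℕ) :
    SSet.homologyMap ((D.controlled f b t a).ι ≫ TopCat.toSSet.map (sublevelInclusion f hb)) R n =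
      SSet.homologyMap (D.endMap f b t a ≫ TopCat.toSSet.map (sublevelInclusion f ha)) R n := by
  rw [← sweepMap_zero, ← sweepMap_one, SSet.homologyMap_comp, SSet.homologyMap_comp]
  congr 1
  exact (pathEvalHomotopy _).congr_homologyMap_singularChainComplexFunctor R n

end SimplexSweep

end Sweep

/-! ### Bars and compressing deformations -/

section Bars

open Simplicial Opposite Filter

variable {A : Type u} [TopologicalSpace A]

/-- In dimension `n`, all simplices are eventually good for the sequence `D` of deformations, and
deforming a simplex increases `f` by at most `c` and ends in `{f ≤ c}`. -/
structure SimplexSweep.Compresses (D : ℕ → SimplexSweep A) (f : A → ℝ) (n : ℕ) (c : ℝ) :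
    Prop where
  eventually_good : ∀ σ : C(stdSimplex ℝ (Fin (n + 1)), A), ∀ᶠ N in atTop, (D N).Good σ
  sweep_le : ∀ N (σ : C(stdSimplex ℝ (Fin (n + 1)), A)) (h : (D N).Good σ) l s,
    f ((D N).sweep σ h (l, s)) ≤ f (σ l) + c
  sweep_one_le : ∀ N (σ : C(stdSimplex ℝ (Fin (n + 1)), A)) (h : (D N).Good σ) l,
    f ((D N).sweep σ h (l, 1)) ≤ c

/-- Finitely many simplices are eventually controlled. -/
lemma SimplexSweep.Compresses.eventually_mem_controlled {D : ℕ → SimplexSweep A} {f : A → ℝ}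
    {n : ℕ} {c : ℝ} (hD : SimplexSweep.Compresses D f n c) {b t : ℝ} (ht : b + c ≤ t)
    {T : Set ((TopCat.toSSet.obj (TopCat.of {x : A // f x ≤ b})) _⦋n⦌)} (hT : T.Finite) :
    ∀ᶠ N in atTop, ∀ x ∈ T, ∃ y, ((D N).controlled f b t c).ι.app _ y = x := by
  rw [eventually_all_finite hT]
  intro σ _
  filter_upwards [hD.eventually_good (ambientSimplex f b σ)] with N hN
  refine ⟨⟨σ, hN, fun l s => ?_, fun l => ?_⟩, rfl⟩
  · exact (hD.sweep_le N _ hN l s).trans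
      ((add_le_add_left (TopCat.toSSetObjEquiv _ _ σ l).2 c).trans ht)
  · exact hD.sweep_one_le N _ hN l

lemma SSet.subcomplex_ι_injective {S : SSet.{u}} (Q : S.Subcomplex) (n : SimplexCategoryᵒᵖ) :
    Function.Injective (Q.ι.app n) := fun _ _ h => Subtype.ext h

/-- If a bar were born at `p > c`, a class at a level slightly above `p` would be deformed into
`{f ≤ c}`. -/
theorem SimplexSweep.Compresses.infiniteBar_le {D : ℕ → SimplexSweep A} {f : A → ℝ}
    {n : ℕ} {c : ℝ} (hD : SimplexSweep.Compresses D f n c) (hc : 0 ≤ c)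
    (k : Type v) [Field k] {p : ℝ} (hp : (persistentHomology k n f).HasInfiniteBar p) :
    p ≤ c := by
  by_contra! hlt
  obtain ⟨x, hx⟩ := hp c (p + 1) (by linarith) hlt (by linarith)
  let R : ModuleCat.{max u v} k := ModuleCat.of k (ULift.{max u v} k)
  obtain ⟨T, hT, h⟩ := SSet.exists_homology_lift R
    (TopCat.toSSet.obj (TopCat.of {x : A // f x ≤ p + 1})) (n := n) x
  obtain ⟨N, hN⟩ :=
    (hD.eventually_mem_controlled (le_refl (p + 1 + c)) hT).exists
  obtain ⟨x', hx'⟩ := h _ _ (SSet.subcomplex_ι_injective _) hN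
  refine hx (p + 1 + c) (by linarith) ⟨SSet.homologyMap ((D N).endMap f _ _ _) R n x', ?_⟩
  have key := ConcreteCategory.congr_hom ((D N).homologyMap_controlled f R
    (b := p + 1) (t := p + 1 + c) (a := c) (by linarith) (by linarith) n) x'
  rw [SSet.homologyMap_comp, SSet.homologyMap_comp] at key
  rw [← hx']
  exact key.symm

lemma persistentHomology_eq_zero (k : Type v) [Field k] (n : ℕ) {f : A → ℝ} (hf : ∀ x, 0 ≤ f x)
    {b : ℝ} (hb : b < 0) (x : (persistentHomology k n f).obj b) : x = 0 := by
  let R : ModuleCat.{max u v} k := ModuleCat.of k (ULift.{max u v} k)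
  have h0 : ∀ z : ((TopCat.toSSet.obj (TopCat.of {x : A // f x ≤ b})).chainComplex R).X n,
      z = 0 := by
    have : (𝟙 (((TopCat.toSSet.obj (TopCat.of {x : A // f x ≤ b})).chainComplex R).X n)) = 0 :=
      SSet.chainComplex_hom_ext fun σ => by
        have y := TopCat.toSSetObjEquiv _ _ σ (stdSimplex.vertex 0)
        exact absurd (hf y.1) (not_le.2 (lt_of_le_of_lt y.2 hb))
    exact fun z => ConcreteCategory.congr_hom this z
  obtain ⟨c, rfl⟩ := ChainComplex.homologyπ_surjective
    ((TopCat.toSSet.obj (TopCat.of {x : A // f x ≤ b})).chainComplex R) n x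
  rw [show c = 0 from ChainComplex.iCycles_injective _ _ ((h0 _).trans (h0 _).symm)]
  exact map_zero _

/-- A class at level `b` is deformed within `{f ≤ b + c}` to a class of `{f ≤ c}`. If it dies later,
so that it bounds a chain of dimension `n + 1`, the deformation of that chain ends in `{f ≤ c}` too,
so the deformed class is zero and the class is dead at level `b + c`. -/
theorem SimplexSweep.Compresses.finiteBar_le {D : ℕ → SimplexSweep A} {f : A → ℝ}
    {n : ℕ} {c : ℝ} (hD : SimplexSweep.Compresses D f n c)
    (hD' : SimplexSweep.Compresses D f (n + 1) c) (hf : ∀ x, 0 ≤ f x) (hc : 0 ≤ c)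
    (k : Type v) [Field k] {p q : ℝ} (hp : (persistentHomology k n f).HasFiniteBar p q) :
    q - p ≤ c := by
  by_contra! hlt
  obtain ⟨hpq, hp⟩ := hp
  rcases lt_or_ge p 0 with hp0 | hp0
  · obtain ⟨b, hb1, hb2⟩ := exists_between (lt_min hp0 hpq)
    obtain ⟨x, -, hx⟩ := hp (p - 1) b b (q + 1) (by linarith) le_rfl
      (by linarith [min_le_right 0 q]) (by linarith) hb1 (by linarith [min_le_right 0 q])
      (by linarith)
    rw [persistentHomology_eq_zero k n hf (by linarith [min_le_left 0 q]) x] at hx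
    exact hx (by simp)
  obtain ⟨e, he, hce⟩ : ∃ e, 0 < e ∧ p + e + c < q := ⟨(q - p - c) / 2, by linarith, by linarith⟩
  obtain ⟨x, hx0, hx⟩ := hp (p - 1) (p + e) (p + e + c) (q + 1) (by linarith) (by linarith)
    (by linarith) (by linarith) (by linarith) (by linarith) (by linarith)
  let R : ModuleCat.{max u v} k := ModuleCat.of k (ULift.{max u v} k)
  have hle : p + e ≤ q + 1 := by linarith
  obtain ⟨T, T', hT, hT', h⟩ := SSet.exists_homology_lift_of_map_eq_zero R
    (TopCat.toSSet.map (sublevelInclusion f hle)) (n := n) x hx0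
  obtain ⟨N, hN, hN'⟩ := ((hD.eventually_mem_controlled (le_refl (p + e + c)) hT).and
    (hD'.eventually_mem_controlled (le_refl (q + 1 + c)) hT')).exists
  have hsub : ∀ n (σ : ((D N).controlled f (p + e) (p + e + c) c : SSet).obj n),
      (TopCat.toSSet.map (sublevelInclusion f hle)).app n σ.1 ∈
        ((D N).controlled f (q + 1) (q + 1 + c) c).obj n :=
    fun n σ => ⟨σ.2.choose, fun l s => (σ.2.choose_spec.1 l s).trans (by linarith),
      σ.2.choose_spec.2⟩
  let g : ((D N).controlled f (p + e) (p + e + c) c : SSet) ⟶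
      ((D N).controlled f (q + 1) (q + 1 + c) c : SSet) :=
    { app := fun n => TypeCat.ofHom fun σ => ⟨_, hsub n σ⟩
      naturality := fun n m θ => by
        ext σ
        rfl }
  obtain ⟨x', hx', hgx'⟩ := h _ _ _ _ g rfl (SSet.subcomplex_ι_injective _)
    (SSet.subcomplex_ι_injective _) hN hN'
  refine hx ⟨0, ?_⟩
  rw [map_zero]
  have key := ConcreteCategory.congr_hom ((D N).homologyMap_controlled f R
    (b := p + e) (t := p + e + c) (a := c) (by linarith) (by linarith) n) x'
  have hg : (D N).endMap f (p + e) (p + e + c) c = g ≫ (D N).endMap f (q + 1) (q + 1 + c) c := rfl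
  rw [hg, SSet.homologyMap_comp, SSet.homologyMap_comp, SSet.homologyMap_comp] at key
  have hle' : p + e ≤ p + e + c := by linarith
  have key2 : SSet.homologyMap (TopCat.toSSet.map (sublevelInclusion f hle')) R n
      (SSet.homologyMap ((D N).controlled f (p + e) (p + e + c) c).ι R n x') = 0 := by
    refine key.trans ?_
    rw [ModuleCat.comp_apply, ModuleCat.comp_apply, hgx', map_zero, map_zero]
  rw [hx'] at key2
  exact key2.symm

end Bars

/-! ### Finite complexes in barycentric coordinates -/

section Realization

open Set Topology unitInterval
open scoped NNReal

variable {V : Type*} [Fintype V]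

/-- The geometric realization of the finite abstract complex generated by the simplices `F`,
in barycentric coordinates. -/
def realization (F : Set (Finset V)) : Set (V → ℝ) :=
  {x | x ∈ stdSimplex ℝ V ∧ ∃ A ∈ F, ∀ v ∉ A, x v = 0}

lemma mem_realization_of_carrier {F : Set (Finset V)} {x y : V → ℝ} (hx : x ∈ realization F)
    (hy : y ∈ stdSimplex ℝ V) (h : ∀ v, x v = 0 → y v = 0) : y ∈ realization F := by
  obtain ⟨-, A, hA, hxA⟩ := hx
  exact ⟨hy, A, hA, fun v hv => h v (hxA v hv)⟩

lemma isClosed_realization (F : Set (Finset V)) : IsClosed (realization F) := by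
  have : realization F = stdSimplex ℝ V ∩ ⋃ A ∈ F, ⋂ v ∈ {v | v ∉ A}, {x | x v = 0} := by
    ext x
    simp [realization]
  rw [this]
  refine (isClosed_stdSimplex ℝ V).inter (F.toFinite.isClosed_biUnion fun A _ => ?_)
  exact isClosed_biInter fun v _ => isClosed_eq (continuous_apply v) continuous_const

instance (F : Set (Finset V)) : CompactSpace (realization F) :=
  isCompact_iff_compactSpace.1
    ((isCompact_stdSimplex ℝ V).of_isClosed_subset (isClosed_realization F) fun _ hx => hx.1)

variable {F : Set (Finset V)}

lemma realization_nonneg (x : realization F) (v : V) : 0 ≤ x.1 v := x.2.1.1 v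

lemma realization_le_one (x : realization F) (v : V) : x.1 v ≤ 1 :=
  (mem_Icc_of_mem_stdSimplex x.2.1 v).2

lemma realization_sum (x : realization F) : ∑ v, x.1 v = 1 := x.2.1.2

lemma continuous_coord (v : V) : Continuous fun x : realization F => x.1 v :=
  (continuous_apply v).comp continuous_subtype_val

lemma nonempty_of_realization (x : realization F) : Nonempty V := by
  by_contra h
  rw [not_nonempty_iff] at h
  have := realization_sum x
  simp at this

lemma card_pos_of_realization (x : realization F) : (0 : ℝ) < Fintype.card V :=
  Nat.cast_pos.2 (Fintype.card_pos_iff.2 (nonempty_of_realization x))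

lemma exists_coord_ge (x : realization F) : ∃ v, (Fintype.card V : ℝ)⁻¹ ≤ x.1 v := by
  have hV := nonempty_of_realization x
  have hc := card_pos_of_realization x
  by_contra! h
  have h1 : ∑ v, x.1 v < ∑ _v : V, (Fintype.card V : ℝ)⁻¹ :=
    Finset.sum_lt_sum_of_nonempty Finset.univ_nonempty fun v _ => h v
  rw [realization_sum, Finset.sum_const, Finset.card_univ, nsmul_eq_mul,
    mul_inv_cancel₀ hc.ne'] at h1
  exact lt_irrefl _ h1

/-- A vertex whose barycentric coordinate is not small. -/
def nearVertex (x : realization F) : V := (exists_coord_ge x).choose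

lemma nearVertex_pos {x y : realization F} (h : dist x y < (Fintype.card V : ℝ)⁻¹) :
    0 < y.1 (nearVertex x) := by
  have h1 := (exists_coord_ge x).choose_spec
  have h2 : dist (x.1 (nearVertex x)) (y.1 (nearVertex x)) ≤ dist x y :=
    dist_le_pi_dist x.1 y.1 _
  rw [Real.dist_eq] at h2
  have h3 := (abs_le.1 h2).2
  unfold nearVertex at *
  linarith

lemma mem_stdSimplex_div_sum {y : V → ℝ} (h0 : ∀ v, 0 ≤ y v) (hs : 0 < ∑ v, y v) :
    (fun v => y v / ∑ w, y w) ∈ stdSimplex ℝ V :=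
  ⟨fun v => div_nonneg (h0 v) hs.le, by rw [← Finset.sum_div, div_self hs.ne']⟩

/-- Moving linearly from `x` to a point of its carrier stays in the realization. -/
lemma segment_mem_realization {x y : V → ℝ} (hx : x ∈ realization F) (hy : y ∈ stdSimplex ℝ V)
    (h : ∀ v, x v = 0 → y v = 0) {s : ℝ} (hs : s ∈ I) :
    (fun v => (1 - s) * x v + s * y v) ∈ realization F := by
  refine mem_realization_of_carrier hx ?_ (fun v hv => by rw [hv, h v hv]; ring)
  exact convex_stdSimplex ℝ V hx.1 hy (sub_nonneg.2 hs.2) hs.1 (by ring)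

/-- Maps are homotopic, by a straight homotopy, if one preserves the carriers of the other. -/
lemma homotopic_of_carrier {Z : Type*} [TopologicalSpace Z] (f g : C(Z, realization F))
    (h : ∀ z v, (f z).1 v = 0 → (g z).1 v = 0) : f.Homotopic g := by
  refine ⟨⟨⟨fun p => ⟨fun v => (1 - p.1.1) * (f p.2).1 v + p.1.1 * (g p.2).1 v,
    segment_mem_realization (f p.2).2 (g p.2).2.1 (h p.2) p.1.2⟩, ?_⟩, ?_, ?_⟩⟩
  · refine Continuous.subtype_mk (continuous_pi fun v => ?_) _
    have h1 : Continuous fun p : I × Z => (f p.2).1 v :=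
      (continuous_coord v).comp (f.continuous.comp continuous_snd)
    have h2 : Continuous fun p : I × Z => (g p.2).1 v :=
      (continuous_coord v).comp (g.continuous.comp continuous_snd)
    have h3 : Continuous fun p : I × Z => (p.1 : ℝ) := continuous_subtype_val.comp continuous_fst
    exact ((continuous_const.sub h3).mul h1).add (h3.mul h2)
  · intro z
    ext v
    simp
  · intro z
    ext v
    simp

/-- Half the least possible value of the largest barycentric coordinate. -/
def collarWidth (V : Type*) [Fintype V] : ℝ := (Fintype.card V : ℝ)⁻¹ / 2

lemma collarWidth_pos [Nonempty V] : 0 < collarWidth V := by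
  unfold collarWidth
  have : (0 : ℝ) < Fintype.card V := Nat.cast_pos.2 Fintype.card_pos
  positivity

lemma sum_truncate_pos (x : realization F) : 0 < ∑ v, max (x.1 v - collarWidth V) 0 := by
  have := nonempty_of_realization x
  obtain ⟨v, hv⟩ := exists_coord_ge x
  have hw := collarWidth_pos (V := V)
  refine Finset.sum_pos' (fun v _ => le_max_right _ _) ⟨v, Finset.mem_univ _, lt_max_of_lt_left ?_⟩
  unfold collarWidth at *
  linarith

/-- The self-map of the realization which sets small coordinates to zero. It retracts a
neighbourhood of each skeleton into that skeleton. -/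
def truncate (F : Set (Finset V)) : C(realization F, realization F) where
  toFun x := ⟨fun v => max (x.1 v - collarWidth V) 0 / ∑ w, max (x.1 w - collarWidth V) 0,
    mem_realization_of_carrier x.2
      (mem_stdSimplex_div_sum (fun _ => le_max_right _ _) (sum_truncate_pos x)) (by
        intro v hv
        have := nonempty_of_realization x
        rw [hv, max_eq_right (by linarith [collarWidth_pos (V := V)]), zero_div])⟩
  continuous_toFun := by
    refine Continuous.subtype_mk (continuous_pi fun v => ?_) _
    refine Continuous.div ?_ ?_ fun x => (sum_truncate_pos x).ne'
    · exact ((continuous_coord v).sub continuous_const).max continuous_const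
    · exact continuous_finsetSum _ fun w _ =>
        ((continuous_coord w).sub continuous_const).max continuous_const

lemma truncate_eq_zero {x : realization F} {v : V} (h : x.1 v ≤ collarWidth V) :
    (truncate F x).1 v = 0 := by
  change max (x.1 v - collarWidth V) 0 / _ = 0
  rw [max_eq_right (by linarith), zero_div]

lemma truncate_carrier (x : realization F) {v : V} (h : x.1 v = 0) : (truncate F x).1 v = 0 := by
  have := nonempty_of_realization x
  exact truncate_eq_zero (h.trans_le collarWidth_pos.le)

/-- Homotopy extension from a union of faces, up to precomposition with a map which preserves
carriers: homotopies `G i` of `f` on the faces `A i`, which agree where the faces meet, extend to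
a homotopy on the whole complex. -/
lemma exists_homotopy_extension [DecidableEq V] {ι : Type*} [Finite ι] (A : ι → Finset V)
    (f : C(realization F, realization F)) (G : ι → C(I × realization F, realization F))
    (h0 : ∀ i x, (∀ v ∉ A i, x.1 v = 0) → G i (0, x) = f x)
    (hG : ∀ i j x s, (∀ v ∉ A i, x.1 v = 0) → (∀ v ∉ A j, x.1 v = 0) → G i (s, x) = G j (s, x)) :
    ∃ r : C(realization F, realization F), f.Homotopic r ∧
      ∀ i x, (∀ v ∉ A i, x.1 v = 0) →
        ∃ y : realization F, r x = G i (1, y) := by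
  classical
  have := Fintype.ofFinite ι
  rcases isEmpty_or_nonempty (realization F) with he | ⟨⟨x0⟩⟩
  · exact ⟨f, ContinuousMap.Homotopic.refl f, fun i x => (he.false x).elim⟩
  have hVne := nonempty_of_realization x0
  let δ := collarWidth V
  have hδ : 0 < δ := collarWidth_pos
  let d : ι → realization F → ℝ := fun i x => ∑ v ∈ (A i)ᶜ, x.1 v
  have hd : ∀ i, Continuous (d i) := fun i => continuous_finsetSum _ fun v _ => continuous_coord v
  have hd0 : ∀ i x, 0 ≤ d i x := fun i x => Finset.sum_nonneg fun v _ => realization_nonneg x v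
  let u : realization F → I := fun x => ⟨1 - ∏ i, min 1 (d i x / δ), by
    have h1 : ∏ i, min 1 (d i x / δ) ≤ 1 := Finset.prod_le_one
      (fun i _ => le_min zero_le_one (div_nonneg (hd0 i x) hδ.le)) fun i _ => min_le_left _ _
    have h2 : 0 ≤ ∏ i, min 1 (d i x / δ) := Finset.prod_nonneg
      fun i _ => le_min zero_le_one (div_nonneg (hd0 i x) hδ.le)
    exact ⟨by linarith, by linarith⟩⟩
  have hu : Continuous u := by
    refine Continuous.subtype_mk (continuous_const.sub (continuous_finsetProd _ fun i _ => ?_)) _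
    exact continuous_const.min ((hd i).div_const _)
  have hu1 : ∀ i x, d i x = 0 → u x = 1 := by
    intro i x hx
    apply Subtype.ext
    change 1 - ∏ i, min 1 (d i x / δ) = 1
    rw [Finset.prod_eq_zero (Finset.mem_univ i) (by rw [hx]; simp)]
    simp
  have hu0 : ∀ x, (∀ i, δ ≤ d i x) → u x = 0 := by
    intro x hx
    apply Subtype.ext
    change 1 - ∏ i, min 1 (d i x / δ) = 0
    rw [Finset.prod_eq_one fun i _ => min_eq_left ((one_le_div hδ).2 (hx i))]
    simp
  have hc : ∀ i x, d i x ≤ δ → ∀ v ∉ A i, (truncate F x).1 v = 0 := by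
    intro i x hx v hv
    refine truncate_eq_zero (le_trans ?_ hx)
    exact Finset.single_le_sum (f := fun v => x.1 v) (fun v _ => realization_nonneg x v)
      (Finset.mem_compl.2 hv)
  -- near the faces run the homotopies on the truncated point, damped by the cutoff `u`
  let R : I × realization F → realization F := fun p =>
    if h : ∃ i, d i p.2 ≤ δ then G h.choose (p.1 * u p.2, truncate F p.2) else f (truncate F p.2)
  have hR1 : ∀ i p, d i p.2 ≤ δ → R p = G i (p.1 * u p.2, truncate F p.2) := by
    intro i p hp
    have h : ∃ i, d i p.2 ≤ δ := ⟨i, hp⟩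
    simp only [R, dif_pos h]
    exact hG _ _ _ _ (hc _ _ h.choose_spec) (hc _ _ hp)
  have hR2 : ∀ p : I × realization F, (∀ i, δ ≤ d i p.2) → R p = f (truncate F p.2) := by
    intro p hp
    by_cases h : ∃ i, d i p.2 ≤ δ
    · obtain ⟨i, hi⟩ := h
      rw [hR1 i p hi, hu0 _ hp, mul_zero]
      exact h0 i _ (hc i _ hi)
    · simp only [R, dif_neg h]
  have hRc : Continuous R := by
    let N : Option ι → Set (I × realization F) := fun o =>
      o.elim {p | ∀ i, δ ≤ d i p.2} fun i => {p | d i p.2 ≤ δ}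
    refine (locallyFinite_of_finite N).continuous ?_ ?_ ?_
    · ext p
      simp only [mem_iUnion, mem_univ, iff_true]
      by_cases h : ∃ i, d i p.2 ≤ δ
      · obtain ⟨i, hi⟩ := h
        exact ⟨some i, hi⟩
      · push Not at h
        exact ⟨none, fun i => (h i).le⟩
    · rintro (_ | i)
      · change IsClosed {p : I × realization F | ∀ i, δ ≤ d i p.2}
        rw [ofPred_forall]
        exact isClosed_iInter fun i => isClosed_le continuous_const ((hd i).comp continuous_snd)
      · exact isClosed_le ((hd i).comp continuous_snd) continuous_const
    · rintro (_ | i)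
      · refine ContinuousOn.congr (f := fun p => f (truncate F p.2)) ?_ fun p hp => hR2 p hp
        exact Continuous.continuousOn (by fun_prop)
      · refine ContinuousOn.congr (f := fun p => G i (p.1 * u p.2, truncate F p.2)) ?_
          fun p hp => hR1 i p hp
        exact Continuous.continuousOn (by fun_prop)
  let r : C(realization F, realization F) := ⟨fun x => R (1, x), by fun_prop⟩
  have hfr : f.Homotopic (f.comp (truncate F)) := by
    have h1 : (ContinuousMap.id _).Homotopic (truncate F) :=
      homotopic_of_carrier _ _ fun z v hv => truncate_carrier z hv
    have := (ContinuousMap.Homotopic.refl f).comp h1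
    rwa [ContinuousMap.comp_id] at this
  have hr : (f.comp (truncate F)).Homotopic r := by
    refine ⟨⟨⟨R, hRc⟩, fun x => ?_, fun x => rfl⟩⟩
    by_cases h : ∃ i, d i x ≤ δ
    · obtain ⟨i, hi⟩ := h
      refine (hR1 i (0, x) hi).trans ?_
      rw [zero_mul]
      exact h0 i _ (hc i _ hi)
    · push Not at h
      exact hR2 (0, x) fun i => (h i).le
  refine ⟨r, hfr.trans hr, fun i x hx => ⟨truncate F x, ?_⟩⟩
  have hdx : d i x = 0 := Finset.sum_eq_zero fun v hv => hx v (Finset.mem_compl.1 hv)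
  change R (1, x) = _
  rw [hR1 i (1, x) (hdx.le.trans hδ.le), hu1 i x hdx, mul_one]

end Realization

/-! ### Contracting the 1-skeleton of a simply connected complex -/

section SkeletonContraction

open Set Topology unitInterval
open scoped NNReal

variable {V : Type*} [Fintype V] {F : Set (Finset V)}

/-- The vertex `v` as a point of the realization. -/
def vertexPoint [DecidableEq V] (hF : ∀ v, ∃ A ∈ F, v ∈ A) (v : V) : realization F :=
  ⟨Pi.single v 1, single_mem_stdSimplex ℝ v, by
    obtain ⟨A, hA, hv⟩ := hF v
    exact ⟨A, hA, fun w hw => Pi.single_eq_of_ne (by rintro rfl; exact hw hv) _⟩⟩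

lemma eq_vertexPoint [DecidableEq V] (hF : ∀ v, ∃ A ∈ F, v ∈ A) {v : V} {x : realization F}
    (h : ∀ w, w ≠ v → x.1 w = 0) : x = vertexPoint hF v := by
  ext w
  by_cases hw : w = v
  · subst hw
    have := realization_sum x
    rw [Finset.sum_eq_single w (fun z _ hz => h z hz) (by simp)] at this
    rw [this]
    simp [vertexPoint]
  · rw [h w hw]
    simp [vertexPoint, hw]

/-- A simply connected complex has a self-map, homotopic to the identity, which maps the
1-skeleton to a point. -/
lemma exists_contraction_of_skeleton [LinearOrder V] [SimplyConnectedSpace (realization F)]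
    (hF : ∀ v, ∃ A ∈ F, v ∈ A) :
    ∃ (r : C(realization F, realization F)) (b : V), (ContinuousMap.id _).Homotopic r ∧
      ∀ (x : realization F) (v w : V), (∀ z, z ≠ v → z ≠ w → x.1 z = 0) →
        r x = vertexPoint hF b := by
  classical
  obtain ⟨b⟩ : Nonempty V := nonempty_of_realization (Classical.arbitrary (realization F))
  -- first contract the vertices, along paths to `b`
  let p : ∀ v, Path (vertexPoint hF v) (vertexPoint hF b) := fun v =>
    PathConnectedSpace.somePath _ _
  obtain ⟨r₁, hr₁, hr₁v⟩ := exists_homotopy_extension (fun v : V => {v})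
    (ContinuousMap.id (realization F))
    (fun v => (p v).toContinuousMap.comp ContinuousMap.fst) (by
      intro v x hx
      have : x = vertexPoint hF v := eq_vertexPoint hF fun w hw => hx w (by simpa using hw)
      subst this
      exact (p v).source) (by
      intro v w x s hv hw
      have h1 : x = vertexPoint hF v := eq_vertexPoint hF fun w hw => hv w (by simpa using hw)
      by_cases hvw : v = w
      · rw [hvw]
      · have h2 := hw v (by simpa using hvw)
        rw [h1] at h2
        simp [vertexPoint] at h2)
  have hvert : ∀ v, r₁ (vertexPoint hF v) = vertexPoint hF b := by
    intro v
    obtain ⟨y, hy⟩ := hr₁v v (vertexPoint hF v) fun w hw => by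
      simp [vertexPoint, show w ≠ v by simpa using hw]
    rw [hy]
    exact (p v).target
  -- the edges have become null-homotopic loops
  have hedge : ∀ e : V × V, ∃ (A : Finset V) (G : C(I × realization F, realization F)),
      (∀ v, e = (v, v) → A = {v}) ∧
      (e.1 < e.2 → (∃ B ∈ F, e.1 ∈ B ∧ e.2 ∈ B) → A = {e.1, e.2}) ∧
      ((∃ v, A = {v}) ∨ A = {e.1, e.2} ∧ e.1 < e.2) ∧
      (∀ s v, G (s, vertexPoint hF v) = vertexPoint hF b) ∧
      (∀ x, G (1, x) = vertexPoint hF b) ∧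
      ∀ x : realization F, (∀ v ∉ A, x.1 v = 0) → G (0, x) = r₁ x := by
    rintro ⟨v, w⟩
    by_cases he : v < w ∧ ∃ B ∈ F, v ∈ B ∧ w ∈ B
    · obtain ⟨hlt, B, hB, hvB, hwB⟩ := he
      have hmem : ∀ t : I, (fun z => (1 - t.1) * (Pi.single v 1 : V → ℝ) z +
          t.1 * (Pi.single w 1 : V → ℝ) z) ∈ realization F := fun t =>
        ⟨convex_stdSimplex ℝ V (single_mem_stdSimplex ℝ v) (single_mem_stdSimplex ℝ w)
          (sub_nonneg.2 t.2.2) t.2.1 (by ring), B, hB, fun z hz => by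
            beta_reduce
            rw [Pi.single_eq_of_ne (by rintro rfl; exact hz hvB),
              Pi.single_eq_of_ne (by rintro rfl; exact hz hwB)]
            ring⟩
      let e : C(I, realization F) := ⟨fun t => ⟨_, hmem t⟩, by
        refine Continuous.subtype_mk (continuous_pi fun z => ?_) _
        fun_prop⟩
      have he0 : e 0 = vertexPoint hF v := by
        ext z
        simp [e, vertexPoint]
      have he1 : e 1 = vertexPoint hF w := by
        ext z
        simp [e, vertexPoint]
      let α : Path (vertexPoint hF b) (vertexPoint hF b) :=
        { toContinuousMap := r₁.comp e
          source' := (congrArg r₁ he0).trans (hvert v)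
          target' := (congrArg r₁ he1).trans (hvert w) }
      obtain ⟨H⟩ := SimplyConnectedSpace.paths_homotopic α (Path.refl _)
      refine ⟨{v, w}, ⟨fun q => H (q.1, ⟨q.2.1 w, realization_nonneg _ _, realization_le_one _ _⟩),
        ?_⟩, ?_, fun _ _ => rfl, Or.inr ⟨rfl, hlt⟩, ?_, ?_, ?_⟩
      · have : Continuous fun q : I × realization F =>
            (⟨q.2.1 w, realization_nonneg _ _, realization_le_one _ _⟩ : I) :=
          Continuous.subtype_mk ((continuous_coord w).comp continuous_snd) _
        fun_prop
      · rintro z hz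
        simp only [Prod.mk.injEq] at hz
        exact absurd (hz.1.trans hz.2.symm) hlt.ne
      · intro s z
        by_cases hz : z = w
        · subst hz
          have : (⟨(vertexPoint hF z).1 z, realization_nonneg _ _, realization_le_one _ _⟩ : I)
              = 1 := by
            apply Subtype.ext; simp [vertexPoint]
          simp [this]
        · have : (⟨(vertexPoint hF z).1 w, realization_nonneg _ _, realization_le_one _ _⟩ : I)
              = 0 := by
            apply Subtype.ext; simp [vertexPoint, Ne.symm hz]
          simp [this]
      · intro x
        simp
      · intro x hx
        have hxe : x = e ⟨x.1 w, realization_nonneg _ _, realization_le_one _ _⟩ := by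
          have hs := realization_sum x
          rw [← Finset.sum_subset (Finset.subset_univ ({v, w} : Finset V))
            (fun z _ hz => hx z hz), Finset.sum_pair hlt.ne] at hs
          ext z
          change x.1 z = (1 - x.1 w) * (Pi.single v 1 : V → ℝ) z +
            x.1 w * (Pi.single w 1 : V → ℝ) z
          by_cases hzv : z = v
          · subst hzv
            simp [hlt.ne]
            linarith
          · by_cases hzw : z = w
            · subst hzw
              simp [hzv]
            · rw [hx z (by simp [hzv, hzw])]
              simp [hzv, hzw]
        have : H (0, ⟨x.1 w, realization_nonneg _ _, realization_le_one _ _⟩) =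
            r₁ (e ⟨x.1 w, realization_nonneg _ _, realization_le_one _ _⟩) := by
          rw [H.apply_zero]
          rfl
        exact this.trans (congrArg r₁ hxe.symm)
    · refine ⟨{v}, ContinuousMap.const _ (vertexPoint hF b), ?_, ?_, Or.inl ⟨v, rfl⟩, ?_, ?_, ?_⟩
      · rintro z hz
        simp only [Prod.mk.injEq] at hz
        rw [hz.1]
      · intro h1 h2
        exact absurd ⟨h1, h2⟩ he
      · intros; rfl
      · intros; rfl
      · intro x hx
        have h1 : x = vertexPoint hF v := eq_vertexPoint hF fun w hw => hx w (by simpa using hw)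
        rw [h1, hvert]
        rfl
  choose A G hAd hAe hA' hGv hG1 hG0 using hedge
  obtain ⟨r, hr, hrA⟩ := exists_homotopy_extension A r₁ G hG0 (by
    intro i j x s hi hj
    by_cases hij : i = j
    · rw [hij]
    -- two different faces of dimension at most one meet in a vertex at most
    have : ∃ v, x = vertexPoint hF v := by
      rcases hA' i with ⟨v, hv⟩ | ⟨hAi, hlti⟩
      · exact ⟨v, eq_vertexPoint hF fun w hw => hi w (by rw [hv]; simpa using hw)⟩
      rcases hA' j with ⟨v, hv⟩ | ⟨hAj, hltj⟩
      · exact ⟨v, eq_vertexPoint hF fun w hw => hj w (by rw [hv]; simpa using hw)⟩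
      have hcases : i.1 ∉ A j ∨ i.2 ∉ A j := by
        by_contra! hcon
        rw [hAj] at hcon
        simp only [Finset.mem_insert, Finset.mem_singleton] at hcon
        apply hij
        rcases hcon with ⟨h1 | h1, h2 | h2⟩
        · rw [h1, h2] at hlti; exact absurd hlti (lt_irrefl _)
        · exact Prod.ext h1 h2
        · rw [h1, h2] at hlti; exact absurd hlti hltj.asymm
        · rw [h1, h2] at hlti; exact absurd hlti (lt_irrefl _)
      rcases hcases with h | h
      · refine ⟨i.2, eq_vertexPoint hF fun w hw => ?_⟩
        by_cases hw' : w = i.1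
        · rw [hw']; exact hj _ h
        · exact hi w (by rw [hAi]; simp [hw, hw'])
      · refine ⟨i.1, eq_vertexPoint hF fun w hw => ?_⟩
        by_cases hw' : w = i.2
        · rw [hw']; exact hj _ h
        · exact hi w (by rw [hAi]; simp [hw, hw'])
    obtain ⟨v, rfl⟩ := this
    rw [hGv, hGv])
  refine ⟨r, b, hr₁.trans hr, fun x v w hx => ?_⟩
  suffices h : ∃ e, ∀ z ∉ A e, x.1 z = 0 by
    obtain ⟨e, he⟩ := h
    obtain ⟨y, hy⟩ := hrA e x he
    rw [hy, hG1]
  by_cases hvw : v = w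
  · exact ⟨(v, v), fun z hz => by
      rw [hAd (v, v) v rfl] at hz
      exact hx z (by simpa using hz) (by rw [← hvw]; simpa using hz)⟩
  by_cases hv0 : x.1 v = 0
  · exact ⟨(w, w), fun z hz => by
      rw [hAd (w, w) w rfl] at hz
      by_cases hzv : z = v
      · rw [hzv, hv0]
      · exact hx z hzv (by simpa using hz)⟩
  by_cases hw0 : x.1 w = 0
  · exact ⟨(v, v), fun z hz => by
      rw [hAd (v, v) v rfl] at hz
      by_cases hzw : z = w
      · rw [hzw, hw0]
      · exact hx z (by simpa using hz) hzw⟩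
  obtain ⟨-, B, hB, hxB⟩ := x.2
  have hvB : v ∈ B := by by_contra h; exact hv0 (hxB v h)
  have hwB : w ∈ B := by by_contra h; exact hw0 (hxB w h)
  rcases lt_or_gt_of_ne hvw with hlt | hlt
  · exact ⟨(v, w), fun z hz => by
      rw [hAe (v, w) hlt ⟨B, hB, hvB, hwB⟩] at hz
      simp only [Finset.mem_insert, Finset.mem_singleton, not_or] at hz
      exact hx z hz.1 hz.2⟩
  · exact ⟨(w, v), fun z hz => by
      rw [hAe (w, v) hlt ⟨B, hB, hwB, hvB⟩] at hz
      simp only [Finset.mem_insert, Finset.mem_singleton, not_or] at hz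
      exact hx z hz.2 hz.1⟩

end SkeletonContraction

/-! ### Lipschitz approximation -/

section LipschitzApproximation

open Set Topology unitInterval
open scoped NNReal

variable {V : Type*} [Fintype V] {F : Set (Finset V)}

lemma abs_div_sub_div_le {a a' s s' η : ℝ} (hη : 0 < η) (hs : η ≤ s) (hs' : η ≤ s')
    (ha' : 0 ≤ a') (has' : a' ≤ s') : |a / s - a' / s'| ≤ (|a - a'| + |s - s'|) / η := by
  have h0 : 0 < s := hη.trans_le hs
  have h0' : 0 < s' := hη.trans_le hs'
  have h1 : a / s - a' / s' = (a - a') / s + (a' / s') * ((s' - s) / s) := by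
    field_simp
    ring
  have h2 : |(a' / s') * ((s' - s) / s)| ≤ |s - s'| / s := by
    rw [abs_mul, abs_div (s' - s), abs_of_pos h0, abs_sub_comm s' s,
      abs_of_nonneg (div_nonneg ha' h0'.le)]
    exact mul_le_of_le_one_left (by positivity) ((div_le_one h0').2 has')
  calc |a / s - a' / s'| ≤ |(a - a') / s| + |(a' / s') * ((s' - s) / s)| := h1 ▸ abs_add_le _ _
    _ ≤ |a - a'| / s + |s - s'| / s := by
      rw [abs_div, abs_of_pos h0]
      linarith
    _ = (|a - a'| + |s - s'|) / s := by ring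
    _ ≤ (|a - a'| + |s - s'|) / η := by gcongr

/-- Continuous maps to a finite complex have Lipschitz approximations which move each point within
its carrier. -/
lemma exists_lipschitz_approximation {Z : Type*} [MetricSpace Z] [CompactSpace Z]
    (f : C(Z, realization F)) :
    ∃ (K : ℝ≥0) (g : Z → realization F), LipschitzWith K g ∧
      ∀ z v, (f z).1 v = 0 → (g z).1 v = 0 := by
  classical
  rcases isEmpty_or_nonempty Z with he | ⟨⟨z0⟩⟩
  · exact ⟨0, f, fun z => (he.false z).elim, fun _ _ h => h⟩
  have hV : (0 : ℝ) < (Fintype.card V : ℝ)⁻¹ := inv_pos.2 (card_pos_of_realization (f z0))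
  obtain ⟨η, hη, hf⟩ := Metric.uniformContinuous_iff.1
    (CompactSpace.uniformContinuous_of_continuous f.continuous) _ hV
  obtain ⟨t, -, ht, hcov⟩ := (isCompact_univ (X := Z)).finite_cover_balls (half_pos hη)
  let T := ht.toFinset
  let a : Z → Z → ℝ := fun j z => max (η - dist z j) 0
  have ha0 : ∀ j z, 0 ≤ a j z := fun j z => le_max_right _ _
  have ha : ∀ j z z', |a j z - a j z'| ≤ dist z z' := by
    intro j z z'
    refine (abs_max_sub_max_le_abs _ _ _).trans ?_
    rw [show η - dist z j - (η - dist z' j) = dist z' j - dist z j by ring, dist_comm z z']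
    exact abs_dist_sub_le _ _ _
  let y : Z → V → ℝ := fun z v => ∑ j ∈ T.filter (fun j => nearVertex (f j) = v), a j z
  have hy0 : ∀ z v, 0 ≤ y z v := fun z v => Finset.sum_nonneg fun j _ => ha0 j z
  have hys : ∀ z, ∑ v, y z v = ∑ j ∈ T, a j z := fun z => Finset.sum_fiberwise _ _ _
  have hη2 : ∀ z, η / 2 ≤ ∑ v, y z v := by
    intro z
    have hz : z ∈ ⋃ x ∈ t, Metric.ball x (η / 2) := hcov (mem_univ z)
    simp only [mem_iUnion, Metric.mem_ball] at hz
    obtain ⟨j, hj, hz⟩ := hz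
    rw [hys]
    refine le_trans ?_ (Finset.single_le_sum (fun j _ => ha0 j z) (ht.mem_toFinset.2 hj))
    exact le_max_of_le_left (by linarith)
  have hpos : ∀ z, 0 < ∑ v, y z v := fun z => (half_pos hη).trans_le (hη2 z)
  have hcar : ∀ z v, (f z).1 v = 0 → y z v = 0 := by
    intro z v hv
    refine Finset.sum_eq_zero fun j hj => ?_
    rw [Finset.mem_filter] at hj
    refine max_eq_right ?_
    by_contra! hcon
    have h2 := nearVertex_pos (hf (a := j) (b := z) (by rw [dist_comm]; linarith))
    rw [hj.2, hv] at h2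
    exact lt_irrefl _ h2
  let g : Z → realization F := fun z => ⟨fun v => y z v / ∑ w, y z w,
    mem_realization_of_carrier (f z).2 (mem_stdSimplex_div_sum (hy0 z) (hpos z))
      fun v hv => by rw [hcar z v hv, zero_div]⟩
  have hlip : ∀ (S : Finset Z) z z', |∑ j ∈ S, a j z - ∑ j ∈ S, a j z'| ≤ S.card * dist z z' := by
    intro S z z'
    rw [← Finset.sum_sub_distrib, ← nsmul_eq_mul, ← Finset.sum_const]
    exact (Finset.abs_sum_le_sum_abs _ _).trans (Finset.sum_le_sum fun j _ => ha j z z')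
  refine ⟨Real.toNNReal (4 * T.card / η), g, ?_, fun z v hv => ?_⟩
  · refine LipschitzWith.of_dist_le_mul fun z z' => ?_
    rw [Real.coe_toNNReal _ (by positivity), Subtype.dist_eq]
    refine (dist_pi_le_iff (by positivity)).2 fun v => ?_
    rw [Real.dist_eq]
    refine (abs_div_sub_div_le (half_pos hη) (hη2 z) (hη2 z') (hy0 z' v)
      (Finset.single_le_sum (fun v _ => hy0 z' v) (Finset.mem_univ v))).trans ?_
    rw [hys, hys]
    have h1 := hlip (T.filter (fun j => nearVertex (f j) = v)) z z'
    have h2 := hlip T z z'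
    have h3 : ((T.filter (fun j => nearVertex (f j) = v)).card : ℝ) ≤ T.card :=
      Nat.cast_le.2 (Finset.card_filter_le _ _)
    have h4 := mul_le_mul_of_nonneg_right h3 (dist_nonneg (x := z) (y := z'))
    rw [div_le_iff₀ (half_pos hη)]
    have h5 : 4 * (T.card : ℝ) / η * dist z z' * (η / 2) = 2 * (T.card * dist z z') := by
      field_simp
      ring
    rw [h5]
    change |y z v - y z' v| ≤ _ at h1
    linarith
  · change y z v / _ = 0
    rw [hcar z v hv, zero_div]

/-- The Lipschitz form of the contraction of the 1-skeleton: the homotopy starts with a map which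
preserves carriers instead of the identity. -/
lemma exists_lipschitz_contraction_of_skeleton [LinearOrder V]
    [SimplyConnectedSpace (realization F)] (hF : ∀ v, ∃ A ∈ F, v ∈ A) :
    ∃ (K : ℝ≥0) (S : I × realization F → realization F) (b : realization F), LipschitzWith K S ∧
      (∀ x v, x.1 v = 0 → (S (0, x)).1 v = 0) ∧
      ∀ (x : realization F) (v w : V), (∀ z, z ≠ v → z ≠ w → x.1 z = 0) → S (1, x) = b := by
  obtain ⟨r, b, ⟨H⟩, hr⟩ := exists_contraction_of_skeleton hF
  obtain ⟨K, S, hS, hcar⟩ := exists_lipschitz_approximation H.toContinuousMap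
  refine ⟨K, S, vertexPoint hF b, hS, fun x v hv => hcar (0, x) v ?_, fun x v w hx => ?_⟩
  · have : H (0, x) = x := H.apply_zero x
    exact (congrArg (fun y : realization F => y.1 v) this).trans hv
  · refine eq_vertexPoint hF fun z hz => hcar (1, x) z ?_
    have : H (1, x) = vertexPoint hF b := (H.apply_one x).trans (hr x v w hx)
    refine (congrArg (fun y : realization F => y.1 z) this).trans ?_
    simp [vertexPoint, hz]

end LipschitzApproximation

/-! ### Triangulated spaces with a metric bilipschitz to a linear one -/

section Triangulation

open Set Topology unitInterval
open scoped NNReal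

section LipschitzOnRealization

variable {V : Type*} [Fintype V] {F : Set (Finset V)}

/-- A map which is Lipschitz on each closed simplex is Lipschitz on the whole complex: two points
`x`, `y` are connected through the point with coordinates proportional to `min (x v) (y v)`, which
lies in a common face of their carriers, unless they are far apart. -/
lemma exists_lipschitzWith_of_carrier {Y : Type*} [MetricSpace Y] (Ψ : realization F → Y) {M : ℝ}
    (hM : 0 ≤ M) (hF : ∀ v, ∃ A ∈ F, v ∈ A)
    (h : ∀ x y : realization F, (∀ v, x.1 v = 0 → y.1 v = 0) → dist (Ψ x) (Ψ y) ≤ M * dist x y) :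
    ∃ L : ℝ≥0, LipschitzWith L Ψ := by
  classical
  let n : ℝ := Fintype.card V
  have hn : 0 ≤ n := Nat.cast_nonneg _
  let E : ℝ := ∑ v, ∑ w, dist (Ψ (vertexPoint hF v)) (Ψ (vertexPoint hF w))
  have hE : 0 ≤ E := Finset.sum_nonneg fun _ _ => Finset.sum_nonneg fun _ _ => dist_nonneg
  have hle1 : ∀ x y : realization F, dist x y ≤ 1 := by
    intro x y
    rw [Subtype.dist_eq]
    refine (dist_pi_le_iff zero_le_one).2 fun v => ?_
    rw [Real.dist_eq, abs_le]
    constructor <;> linarith [realization_nonneg x v, realization_nonneg y v,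
      realization_le_one x v, realization_le_one y v]
  have hnear : ∀ x : realization F,
      dist (Ψ x) (Ψ (vertexPoint hF (nearVertex x))) ≤ M := by
    intro x
    refine (h x _ fun v hv => ?_).trans (mul_le_of_le_one_right hM (hle1 _ _))
    have hne : v ≠ nearVertex x := by
      rintro rfl
      have := nearVertex_pos (x := x) (y := x)
        (by rw [dist_self]; exact inv_pos.2 (card_pos_of_realization x))
      exact this.ne' hv
    simp [vertexPoint, hne]
  have hD : ∀ x y : realization F, dist (Ψ x) (Ψ y) ≤ 2 * M + E := by
    intro x y
    have h1 := dist_triangle4 (Ψ x) (Ψ (vertexPoint hF (nearVertex x)))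
      (Ψ (vertexPoint hF (nearVertex y))) (Ψ y)
    have h2 := hnear x
    have h3 := hnear y
    rw [dist_comm] at h3
    have h4 : dist (Ψ (vertexPoint hF (nearVertex x))) (Ψ (vertexPoint hF (nearVertex y))) ≤ E :=
      (Finset.single_le_sum (f := fun w => dist (Ψ (vertexPoint hF (nearVertex x)))
        (Ψ (vertexPoint hF w))) (fun _ _ => dist_nonneg) (Finset.mem_univ _)).trans
        (Finset.single_le_sum (f := fun v => ∑ w, dist (Ψ (vertexPoint hF v))
        (Ψ (vertexPoint hF w))) (fun _ _ => Finset.sum_nonneg fun _ _ => dist_nonneg)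
        (Finset.mem_univ _))
    linarith
  have key : ∀ x y : realization F, dist (Ψ x) (Ψ y) ≤
      (2 * M * (1 + n) + n * (2 * M + E)) * dist x y := by
    intro x y
    have hd : ∀ v, |x.1 v - y.1 v| ≤ dist x y := fun v => by
      rw [← Real.dist_eq]; exact dist_le_pi_dist x.1 y.1 v
    let m : V → ℝ := fun v => min (x.1 v) (y.1 v)
    have hm0 : ∀ v, 0 ≤ m v := fun v => le_min (realization_nonneg x v) (realization_nonneg y v)
    have hmx : ∀ v, m v ≤ x.1 v := fun v => min_le_left _ _
    have hmy : ∀ v, m v ≤ y.1 v := fun v => min_le_right _ _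
    have hxm : ∀ v, x.1 v - m v ≤ dist x y := fun v => by
      have h1 := abs_le.1 (hd v)
      rcases min_choice (x.1 v) (y.1 v) with h2 | h2 <;> simp only [m, h2] <;>
        linarith [dist_nonneg (x := x) (y := y)]
    have hym : ∀ v, y.1 v - m v ≤ dist x y := fun v => by
      have h1 := abs_le.1 (hd v)
      rcases min_choice (x.1 v) (y.1 v) with h2 | h2 <;> simp only [m, h2] <;>
        linarith [dist_nonneg (x := x) (y := y)]
    have hs : 1 - ∑ v, m v ≤ n * dist x y := by
      rw [← realization_sum x, ← Finset.sum_sub_distrib]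
      refine (Finset.sum_le_sum fun v _ => hxm v).trans ?_
      rw [Finset.sum_const, Finset.card_univ, nsmul_eq_mul]
    rcases (Finset.sum_nonneg fun v _ => hm0 v : 0 ≤ ∑ v, m v).eq_or_lt with h0 | h0
    · rw [← h0, sub_zero] at hs
      have h1 : (2 * M + E) * 1 ≤ (2 * M + E) * (n * dist x y) :=
        mul_le_mul_of_nonneg_left hs (by linarith)
      have h2 : 0 ≤ 2 * M * (1 + n) * dist x y := by positivity
      calc dist (Ψ x) (Ψ y) ≤ 2 * M + E := hD x y
        _ ≤ _ := by linarith
    · let z : realization F := ⟨fun v => m v / ∑ w, m w, mem_realization_of_carrier x.2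
        (mem_stdSimplex_div_sum hm0 h0) fun v hv => by
          rw [le_antisymm ((hmx v).trans hv.le) (hm0 v), zero_div]⟩
      have hzv : ∀ v, z.1 v - m v ≤ n * dist x y ∧ 0 ≤ z.1 v - m v := by
        intro v
        have h1 : z.1 v - m v = z.1 v * (1 - ∑ w, m w) := by
          change m v / _ - m v = m v / _ * _
          field_simp
        have h2 : 0 ≤ 1 - ∑ w, m w := by
          rw [← realization_sum x]
          exact sub_nonneg.2 (Finset.sum_le_sum fun v _ => hmx v)
        rw [h1]
        exact ⟨(mul_le_of_le_one_left h2 (realization_le_one z v)).trans hs,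
          mul_nonneg (realization_nonneg z v) h2⟩
      have hxz : dist x z ≤ (1 + n) * dist x y := by
        rw [Subtype.dist_eq x z]
        refine (dist_pi_le_iff (by positivity)).2 fun v => ?_
        rw [Real.dist_eq, abs_le]
        have := mul_nonneg hn (dist_nonneg (x := x) (y := y))
        constructor <;> linarith [hxm v, hmx v, (hzv v).1, (hzv v).2]
      have hyz : dist y z ≤ (1 + n) * dist x y := by
        rw [Subtype.dist_eq y z]
        refine (dist_pi_le_iff (by positivity)).2 fun v => ?_
        rw [Real.dist_eq, abs_le]
        have := mul_nonneg hn (dist_nonneg (x := x) (y := y))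
        constructor <;> linarith [hym v, hmy v, (hzv v).1, (hzv v).2]
      have h1 := h x z fun v hv => by
        change m v / _ = 0
        rw [le_antisymm ((hmx v).trans hv.le) (hm0 v), zero_div]
      have h2 := h y z fun v hv => by
        change m v / _ = 0
        rw [le_antisymm ((hmy v).trans hv.le) (hm0 v), zero_div]
      have h3 := mul_le_mul_of_nonneg_left hxz hM
      have h4 := mul_le_mul_of_nonneg_left hyz hM
      have h5 : 0 ≤ n * (2 * M + E) * dist x y := by positivity
      calc dist (Ψ x) (Ψ y) ≤ dist (Ψ x) (Ψ z) + dist (Ψ y) (Ψ z) := dist_triangle_right _ _ _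
        _ ≤ _ := by linarith
  refine ⟨Real.toNNReal (2 * M * (1 + n) + n * (2 * M + E)), LipschitzWith.of_dist_le_mul ?_⟩
  rw [Real.coe_toNNReal _ (by positivity)]
  exact key

end LipschitzOnRealization

lemma LinearStructure.PolyPath.nonneg {N : ℕ}
    {K : Geometry.SimplicialComplex ℝ (EuclideanSpace ℝ (Fin N))} {g : LinearStructure K}
    {x y : EuclideanSpace ℝ (Fin N)} {l : ℝ} (h : g.PolyPath x y l) : 0 ≤ l := by
  induction h with
  | refl => exact le_rfl
  | step => positivity

lemma LinearStructure.pathDist_le_of_mem_face {N : ℕ}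
    {K : Geometry.SimplicialComplex ℝ (EuclideanSpace ℝ (Fin N))} (g : LinearStructure K)
    {s : Finset (EuclideanSpace ℝ (Fin N))} (hs : s ∈ K.faces) {x y : EuclideanSpace ℝ (Fin N)}
    (hx : x ∈ convexHull ℝ (s : Set (EuclideanSpace ℝ (Fin N))))
    (hy : y ∈ convexHull ℝ (s : Set (EuclideanSpace ℝ (Fin N)))) :
    g.pathDist x y ≤ ‖g.lin s (y - x)‖ := by
  refine csInf_le ⟨0, fun l hl => hl.nonneg⟩ ?_
  have := PolyPath.step (g := g) x x y 0 s
    (PolyPath.refl x (K.mem_space_iff.2 ⟨s, hs, hx⟩)) hs hx hy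
  rwa [zero_add] at this

/-- A finite complex with a metric bilipschitz to a linear one is a Lipschitz image of its
realization in barycentric coordinates, by a homeomorphism. -/
lemma IsFiniteComplexBilipschitzToLinear.exists_realization {Y : Type u} [MetricSpace Y]
    (hY : IsFiniteComplexBilipschitzToLinear Y) :
    ∃ (n : ℕ) (F : Set (Finset (Fin n))) (Ψ : realization F ≃ₜ Y) (L : ℝ≥0),
      (∀ v, ∃ A ∈ F, v ∈ A) ∧ LipschitzWith L Ψ := by
  classical
  obtain ⟨N, K, g, h, κ, hfin, hκ, hdist⟩ := hY
  have hvf : K.vertices.Finite := by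
    refine Set.Finite.of_finite_image (f := fun x => ({x} : Finset _)) (hfin.subset ?_)
      (Finset.singleton_injective.injOn)
    rintro _ ⟨x, hx, rfl⟩
    exact hx
  obtain ⟨n, e, he⟩ : ∃ (n : ℕ) (e : Fin n ↪ EuclideanSpace ℝ (Fin N)),
      Set.range e = K.vertices := by
    have := hvf.fintype
    refine ⟨_, (Fintype.equivFin K.vertices).symm.toEmbedding.trans
      (Function.Embedding.subtype _), ?_⟩
    ext x
    refine ⟨?_, fun hx => ⟨Fintype.equivFin K.vertices ⟨x, hx⟩, ?_⟩⟩
    · rintro ⟨i, rfl⟩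
      exact ((Fintype.equivFin K.vertices).symm i).2
    · exact congrArg Subtype.val ((Fintype.equivFin K.vertices).symm_apply_apply ⟨x, hx⟩)
  let F : Set (Finset (Fin n)) := {A | A.map e ∈ K.faces}
  let bary : (Fin n → ℝ) →ₗ[ℝ] EuclideanSpace ℝ (Fin N) :=
    { toFun := fun x => ∑ v, x v • e v
      map_add' := fun x y => by simp [add_smul, Finset.sum_add_distrib]
      map_smul' := fun c x => by simp [mul_smul, Finset.smul_sum] }
  have hbary : ∀ x, bary x = ∑ v, x v • e v := fun _ => rfl
  have hmem : ∀ (A : Finset (Fin n)) (x : Fin n → ℝ), x ∈ stdSimplex ℝ (Fin n) →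
      (∀ v ∉ A, x v = 0) →
      bary x ∈ convexHull ℝ ((A.map e : Finset _) : Set (EuclideanSpace ℝ (Fin N))) := by
    intro A x hx hxA
    rw [hbary, ← Finset.sum_subset (Finset.subset_univ A)
      (fun v _ hv => by rw [hxA v hv, zero_smul])]
    refine (convex_convexHull ℝ _).sum_mem (fun v _ => hx.1 v) ?_ fun v hv => ?_
    · rw [Finset.sum_subset (Finset.subset_univ A) (fun v _ hv => hxA v hv)]
      exact hx.2
    · exact subset_convexHull ℝ _ (by simpa using hv)
  have hsurj : ∀ (A : Finset (Fin n)) (p : EuclideanSpace ℝ (Fin N)),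
      p ∈ convexHull ℝ ((A.map e : Finset _) : Set (EuclideanSpace ℝ (Fin N))) →
      ∃ x ∈ stdSimplex ℝ (Fin n), (∀ v ∉ A, x v = 0) ∧ bary x = p := by
    intro A p hp
    obtain ⟨w, hw0, hw1, hwp⟩ := Finset.mem_convexHull'.1 hp
    rw [Finset.sum_map] at hw1 hwp
    refine ⟨fun v => if v ∈ A then w (e v) else 0, ⟨fun v => ?_, ?_⟩, fun v hv => if_neg hv, ?_⟩
    · beta_reduce
      split_ifs with hv
      · exact hw0 _ (by simpa using hv)
      · exact le_rfl
    · rw [Finset.sum_ite_mem, Finset.univ_inter, hw1]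
    · rw [hbary]
      simp only [ite_smul, zero_smul]
      rw [Finset.sum_ite_mem, Finset.univ_inter, hwp]
  have huniq : ∀ (A : Finset (Fin n)), A ∈ F → ∀ x y : Fin n → ℝ, x ∈ stdSimplex ℝ (Fin n) →
      y ∈ stdSimplex ℝ (Fin n) → (∀ v ∉ A, x v = 0) → (∀ v ∉ A, y v = 0) → bary x = bary y →
      x = y := by
    intro A hA x y hx hy hxA hyA hxy
    have hind : AffineIndependent ℝ (fun a : A => e a) :=
      (K.indep hA).comp_embedding (⟨fun a : A => ⟨e a, Finset.mem_map_of_mem e a.2⟩,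
        fun a b hab => Subtype.ext (e.injective (congrArg Subtype.val hab))⟩ :
          A ↪ (A.map e : Finset _))
    ext v
    by_cases hv : v ∈ A
    · have h1 : ∑ a : A, (x a - y a) = 0 := by
        rw [Finset.sum_coe_sort A (fun v => x v - y v),
          Finset.sum_subset (Finset.subset_univ A)
            (fun v _ hv => by rw [hxA v hv, hyA v hv, sub_zero]),
          Finset.sum_sub_distrib, hx.2, hy.2, sub_self]
      have h2 : ∑ a : A, (x a - y a) • e a = 0 := by
        rw [Finset.sum_coe_sort A (fun v => (x v - y v) • e v),
          Finset.sum_subset (Finset.subset_univ A)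
            (fun v _ hv => by rw [hxA v hv, hyA v hv, sub_zero, zero_smul])]
        simp only [sub_smul]
        rw [Finset.sum_sub_distrib, ← hbary, ← hbary, hxy, sub_self]
      exact sub_eq_zero.1 (affineIndependent_iff.1 hind Finset.univ (fun a => x a - y a) h1 h2
        ⟨v, hv⟩ (Finset.mem_univ _))
    · rw [hxA v hv, hyA v hv]
  have hface : ∀ s ∈ K.faces, ∃ A : Finset (Fin n), A.map e = s := by
    intro s hs
    refine ⟨Finset.univ.filter fun v => e v ∈ s, ?_⟩
    ext p
    simp only [Finset.mem_map, Finset.mem_filter, Finset.mem_univ, true_and]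
    refine ⟨?_, fun hp => ?_⟩
    · rintro ⟨v, hv, rfl⟩
      exact hv
    · have : p ∈ Set.range e := by
        rw [he]
        exact K.down_closed hs (Finset.singleton_subset_iff.2 hp) (Finset.singleton_nonempty _)
      obtain ⟨v, rfl⟩ := this
      exact ⟨v, hp, rfl⟩
  have hspace : ∀ x : realization F, bary x.1 ∈ K.space := by
    rintro ⟨x, hx, A, hA, hxA⟩
    exact K.mem_space_iff.2 ⟨_, hA, hmem A x hx hxA⟩
  have hinj : ∀ x y : realization F, bary x.1 = bary y.1 → x = y := by
    rintro ⟨x, hx, A, hA, hxA⟩ ⟨y, hy, B, hB, hyB⟩ hxy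
    have h1 : bary x ∈ convexHull ℝ ((A.map e : Finset _) : Set (EuclideanSpace ℝ (Fin N))) :=
      hmem A x hx hxA
    have h2 : bary x ∈ convexHull ℝ ((B.map e : Finset _) : Set (EuclideanSpace ℝ (Fin N))) := by
      have := hmem B y hy hyB
      rwa [← hxy] at this
    have h3 := K.inter_subset_convexHull hA hB ⟨h1, h2⟩
    rw [← Finset.coe_inter, ← Finset.map_inter] at h3
    obtain ⟨z, hz, hzAB, hzp⟩ := hsurj _ _ h3
    simp only [Finset.mem_inter, not_and_or] at hzAB
    apply Subtype.ext
    change x = y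
    rw [← huniq A hA z x hz hx (fun v hv => hzAB v (Or.inl hv)) hxA hzp,
      huniq B hB z y hz hy (fun v hv => hzAB v (Or.inr hv)) hyB (hzp.trans hxy)]
  let Ψ : realization F → Y := fun x => h.symm ⟨bary x.1, hspace x⟩
  have hbij : Function.Bijective Ψ := by
    refine ⟨fun x y hxy => hinj x y ?_, fun y => ?_⟩
    · exact congrArg Subtype.val (h.symm.injective hxy)
    · obtain ⟨s, hs, hys⟩ := K.mem_space_iff.1 (h y).2
      obtain ⟨A, rfl⟩ := hface s hs
      obtain ⟨x, hx, hxA, hxy⟩ := hsurj A _ hys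
      refine ⟨⟨x, hx, A, hs, hxA⟩, ?_⟩
      rw [Equiv.symm_apply_eq]
      exact Subtype.ext hxy
  have hF : ∀ v, ∃ A ∈ F, v ∈ A := fun v => ⟨{v}, by
    change ({v} : Finset (Fin n)).map e ∈ K.faces
    rw [Finset.map_singleton]
    exact he.subset ⟨v, rfl⟩, by simp⟩
  let B : Finset (EuclideanSpace ℝ (Fin N)) → ((Fin n → ℝ) →L[ℝ] EuclideanSpace ℝ (Fin N)) :=
    fun s => ((g.lin s).toLinearMap ∘ₗ bary).toContinuousLinearMap
  let M : ℝ := ∑ s ∈ hfin.toFinset, ‖B s‖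
  have hM : 0 ≤ M := Finset.sum_nonneg fun _ _ => norm_nonneg _
  obtain ⟨L, hL⟩ := exists_lipschitzWith_of_carrier Ψ (mul_nonneg hκ.le hM) hF (by
    rintro ⟨x, hx, A, hA, hxA⟩ ⟨y, hy, hyF⟩ hxy
    have hyA : ∀ v ∉ A, y v = 0 := fun v hv => hxy v (hxA v hv)
    refine (hdist _ _).2.trans ?_
    rw [mul_assoc]
    refine mul_le_mul_of_nonneg_left ?_ hκ.le
    have h1 : g.pathDist (h (Ψ ⟨x, hx, A, hA, hxA⟩)) (h (Ψ ⟨y, hy, hyF⟩)) =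
        g.pathDist (bary x) (bary y) := by
      simp only [Ψ, Equiv.apply_symm_apply]
    rw [h1]
    refine (g.pathDist_le_of_mem_face hA (hmem A x hx hxA) (hmem A y hy hyA)).trans ?_
    have h2 : g.lin (A.map e) (bary y - bary x) = B (A.map e) (y - x) := by
      rw [← map_sub]
      rfl
    rw [h2]
    refine ((B (A.map e)).le_opNorm _).trans ?_
    rw [Subtype.dist_eq, dist_comm, dist_eq_norm]
    refine mul_le_mul_of_nonneg_right ?_ (norm_nonneg _)
    exact Finset.single_le_sum (f := fun s => ‖B s‖) (fun _ _ => norm_nonneg _)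
      (hfin.mem_toFinset.2 hA))
  exact ⟨n, F, hL.continuous.homeoOfEquivCompactToT2 (f := Equiv.ofBijective Ψ hbij), L, hF, hL⟩

end Triangulation

/-! ### Grid points in a simplex -/

section Reparametrization

open Set Topology

variable {n : ℕ}

/-- The sum telescopes: tail sums of the transformed coordinates are the transforms of the
tail sums. -/
lemma sum_upperSet_sub {f : ℝ → ℝ} (h0 : f 0 = 0) (l : Fin (n + 1) → ℝ)
    (U : Finset (Fin (n + 1))) (hU : IsUpperSet (U : Set (Fin (n + 1)))) :
    ∑ j ∈ U, (f (∑ i ∈ Finset.Ici j, l i) - f (∑ i ∈ Finset.Ioi j, l i)) = f (∑ j ∈ U, l j) := by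
  induction U using Finset.induction_on_min with
  | empty => simp [h0]
  | insert a s has ih =>
    have has' : a ∉ s := fun h => lt_irrefl _ (has a h)
    have hs : IsUpperSet (s : Set (Fin (n + 1))) := fun x y hxy hx => by
      have hy := hU hxy (Finset.mem_coe.2 (Finset.mem_insert_of_mem hx))
      rcases Finset.mem_insert.1 (Finset.mem_coe.1 hy) with h | h
      · exact absurd (has x hx) (not_lt.2 (h ▸ hxy))
      · exact h
    have h1 : Finset.Ici a = insert a s := by
      ext x
      rw [Finset.mem_Ici, Finset.mem_insert]
      refine ⟨fun hx => ?_, ?_⟩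
      · exact Finset.mem_insert.1 (Finset.mem_coe.1
          (hU hx (Finset.mem_coe.2 (Finset.mem_insert_self a s))))
      · rintro (rfl | hx)
        exacts [le_rfl, (has x hx).le]
    have h2 : Finset.Ioi a = s := by
      ext x
      rw [Finset.mem_Ioi]
      refine ⟨fun hx => ?_, fun hx => has x hx⟩
      have : x ∈ insert a s := h1 ▸ Finset.mem_Ici.2 hx.le
      exact (Finset.mem_insert.1 this).resolve_left hx.ne'
    rw [Finset.sum_insert has', ih hs, h1, h2]
    ring

/-- The self-map of a simplex which applies a monotone map `f` of the interval to the tail sums of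
the barycentric coordinates. -/
def simplexReparam (f : ℝ → ℝ) (hf : Monotone f) (h0 : f 0 = 0) (h1 : f 1 = 1)
    (l : stdSimplex ℝ (Fin (n + 1))) : stdSimplex ℝ (Fin (n + 1)) :=
  ⟨fun j => f (∑ i ∈ Finset.Ici j, l i) - f (∑ i ∈ Finset.Ioi j, l i),
    fun j => sub_nonneg.2 (hf (Finset.sum_le_sum_of_subset_of_nonneg
      Finset.Ioi_subset_Ici_self fun _ _ _ => l.2.1 _)), by
    rw [sum_upperSet_sub h0 _ _ (by simpa using isUpperSet_univ), ← h1]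
    exact congrArg f l.2.2⟩

lemma simplexReparam_apply (f : ℝ → ℝ) (hf : Monotone f) (h0 : f 0 = 0) (h1 : f 1 = 1)
    (l : stdSimplex ℝ (Fin (n + 1))) (j : Fin (n + 1)) :
    simplexReparam f hf h0 h1 l j =
      f (∑ i ∈ Finset.Ici j, l i) - f (∑ i ∈ Finset.Ioi j, l i) := rfl

lemma simplexMap_apply {m : ℕ} (θ : Fin (m + 1) →o Fin (n + 1))
    (l : stdSimplex ℝ (Fin (m + 1))) (j : Fin (n + 1)) :
    simplexMap θ l j = ∑ i with θ i = j, l i := by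
  change (FunOnFinite.linearMap ℝ ℝ θ l) j = _
  rw [FunOnFinite.linearMap_apply_apply]

lemma sum_simplexMap {m : ℕ} (θ : Fin (m + 1) →o Fin (n + 1))
    (l : stdSimplex ℝ (Fin (m + 1))) (U : Finset (Fin (n + 1))) :
    ∑ j ∈ U, simplexMap θ l j = ∑ i with θ i ∈ U, l i := by
  simp only [simplexMap_apply]
  rw [← Finset.sum_fiberwise_of_maps_to (s := Finset.univ.filter fun i => θ i ∈ U) (t := U) (g := θ)
    (fun i hi => (Finset.mem_filter.1 hi).2)]
  refine Finset.sum_congr rfl fun j hj => Finset.sum_congr ?_ fun _ _ => rfl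
  ext i
  simp only [Finset.mem_filter, Finset.mem_univ, true_and]
  exact ⟨fun h => ⟨h ▸ hj, h⟩, fun h => h.2⟩

/-- The reparametrization acts on tail sums, and monotone maps of the vertices turn tail sums into
tail sums, so the two commute. -/
lemma simplexMap_simplexReparam {m : ℕ} (θ : Fin (m + 1) →o Fin (n + 1)) (f : ℝ → ℝ)
    (hf : Monotone f) (h0 : f 0 = 0) (h1 : f 1 = 1) (l : stdSimplex ℝ (Fin (m + 1))) :
    simplexMap θ (simplexReparam f hf h0 h1 l) = simplexReparam f hf h0 h1 (simplexMap θ l) := by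
  have hup : ∀ U : Finset (Fin (n + 1)), IsUpperSet (U : Set (Fin (n + 1))) →
      ∑ i with θ i ∈ U, simplexReparam f hf h0 h1 l i = f (∑ i ∈ U, simplexMap θ l i) := by
    intro U hU
    rw [sum_simplexMap]
    refine sum_upperSet_sub h0 _ _ fun x y hxy hx => ?_
    simp only [Finset.coe_filter, Finset.mem_univ, true_and, mem_ofPred_eq] at hx ⊢
    exact hU (θ.monotone hxy) hx
  refine stdSimplex.ext (funext fun j => ?_)
  rw [simplexReparam_apply, ← hup _ (by simpa using isUpperSet_Ici j),
    ← hup _ (by simpa using isUpperSet_Ioi j), simplexMap_apply, eq_sub_iff_add_eq,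
    ← Finset.sum_union]
  · refine Finset.sum_congr ?_ fun _ _ => rfl
    ext i
    simp only [Finset.mem_union, Finset.mem_filter, Finset.mem_univ, true_and, Finset.mem_Ioi,
      Finset.mem_Ici]
    rw [le_iff_eq_or_lt, eq_comm]
  · rw [Finset.disjoint_filter]
    rintro i - h1 h2
    rw [Finset.mem_Ioi] at h2
    exact h2.ne' h1

/-- A staircase on the interval with values in the multiples of `1 / M`. Its jumps are spaced by
`1 / M`; their position depends on the phase `u`. -/
def stair (M : ℕ) (u s : ℝ) : ℝ := (⌈M * s - Int.fract u⌉ : ℤ) / M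

lemma stair_monotone (M : ℕ) (u : ℝ) : Monotone (stair M u) := by
  intro s t hst
  have h : (⌈M * s - Int.fract u⌉ : ℝ) ≤ ⌈M * t - Int.fract u⌉ := by
    refine Int.cast_le.2 (Int.ceil_mono ?_)
    have := mul_le_mul_of_nonneg_left hst (Nat.cast_nonneg (α := ℝ) M)
    linarith
  exact div_le_div_of_nonneg_right h (Nat.cast_nonneg _)

lemma stair_zero (M : ℕ) (u : ℝ) : stair M u 0 = 0 := by
  have : ⌈(M : ℝ) * 0 - Int.fract u⌉ = 0 := by
    rw [Int.ceil_eq_iff]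
    constructor
    · have := Int.fract_lt_one u
      push_cast
      linarith
    · have := Int.fract_nonneg u
      push_cast
      linarith
  rw [stair, this]
  simp

lemma stair_one (M : ℕ) [NeZero M] (u : ℝ) : stair M u 1 = 1 := by
  have hM : (M : ℝ) ≠ 0 := Nat.cast_ne_zero.2 (NeZero.ne M)
  have : ⌈(M : ℝ) * 1 - Int.fract u⌉ = M := by
    rw [Int.ceil_eq_iff]
    have := Int.fract_lt_one u
    have := Int.fract_nonneg u
    push_cast
    constructor <;> linarith
  rw [stair, this]
  push_cast
  exact div_self hM

lemma abs_stair_sub_le (M : ℕ) [NeZero M] (u s : ℝ) : |stair M u s - s| ≤ 1 / M := by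
  have hM : (0 : ℝ) < M := Nat.cast_pos.2 (NeZero.pos M)
  have h : stair M u s - s = (⌈M * s - Int.fract u⌉ - M * s) / M := by
    rw [stair]
    field_simp
  rw [h, abs_div, abs_of_pos hM]
  refine div_le_div_of_nonneg_right ?_ hM.le
  have h1 := Int.ceil_lt_add_one (M * s - Int.fract u)
  have h2 := Int.le_ceil (M * s - Int.fract u)
  have h3 := Int.fract_lt_one u
  have h4 := Int.fract_nonneg u
  rw [abs_le]
  constructor <;> linarith

/-- The point of the grid of mesh `1 / M` in a simplex which is near `l`, for the phase `u`. Over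
one period of `u` it visits the vertices of the cell of `l`, and it jumps at most once for each
tail sum of `l`. -/
def gridPoint (M : ℕ) [NeZero M] (u : ℝ) (l : stdSimplex ℝ (Fin (n + 1))) :
    stdSimplex ℝ (Fin (n + 1)) :=
  simplexReparam (stair M u) (stair_monotone M u) (stair_zero M u) (stair_one M u) l

lemma dist_gridPoint_le (M : ℕ) [NeZero M] (u : ℝ) (l : stdSimplex ℝ (Fin (n + 1))) :
    dist l (gridPoint M u l) ≤ 2 / M := by
  rw [Subtype.dist_eq]
  refine (dist_pi_le_iff (by positivity)).2 fun j => ?_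
  change dist (l j) (stair M u (∑ i ∈ Finset.Ici j, l i) - stair M u (∑ i ∈ Finset.Ioi j, l i)) ≤ _
  have h1 := abs_le.1 (abs_stair_sub_le M u (∑ i ∈ Finset.Ici j, l i))
  have h2 := abs_le.1 (abs_stair_sub_le M u (∑ i ∈ Finset.Ioi j, l i))
  have h3 : ∑ i ∈ Finset.Ici j, l i = l j + ∑ i ∈ Finset.Ioi j, l i := by
    rw [← Finset.sum_insert (by simp), Finset.Ioi_insert]
  have h4 : (2 : ℝ) / M = 1 / M + 1 / M := by ring
  rw [Real.dist_eq, abs_le, h4]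
  constructor <;> linarith

lemma simplexMap_gridPoint {m : ℕ} (θ : Fin (m + 1) →o Fin (n + 1)) (M : ℕ) [NeZero M] (u : ℝ)
    (l : stdSimplex ℝ (Fin (m + 1))) :
    simplexMap θ (gridPoint M u l) = gridPoint M u (simplexMap θ l) :=
  simplexMap_simplexReparam θ _ _ _ _ l

/-- The tail sums of `l`, with and without the first term. -/
def tailSum (l : stdSimplex ℝ (Fin (n + 1))) (j : Fin (n + 1) ⊕ Fin (n + 1)) : ℝ :=
  j.elim (fun j => ∑ i ∈ Finset.Ici j, l i) fun j => ∑ i ∈ Finset.Ioi j, l i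

lemma continuous_tailSum (j : Fin (n + 1) ⊕ Fin (n + 1)) :
    Continuous fun l : stdSimplex ℝ (Fin (n + 1)) => tailSum l j := by
  have h : ∀ i, Continuous fun l : stdSimplex ℝ (Fin (n + 1)) => l i := fun i =>
    (continuous_apply i).comp continuous_subtype_val
  rcases j with j | j
  · exact continuous_finsetSum (Finset.Ici j) fun i _ => h i
  · exact continuous_finsetSum (Finset.Ioi j) fun i _ => h i

/-- The integers which determine `gridPoint M u l`. -/
def gridIndex (M : ℕ) (u : ℝ) (l : stdSimplex ℝ (Fin (n + 1)))
    (j : Fin (n + 1) ⊕ Fin (n + 1)) : ℤ :=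
  ⌈M * tailSum l j - Int.fract u⌉

lemma gridPoint_congr {M : ℕ} [NeZero M] {u u' : ℝ} {l l' : stdSimplex ℝ (Fin (n + 1))}
    (h : gridIndex M u l = gridIndex M u' l') : gridPoint M u l = gridPoint M u' l' := by
  refine stdSimplex.ext (funext fun j => ?_)
  have h1 : stair M u (∑ i ∈ Finset.Ici j, l i) = stair M u' (∑ i ∈ Finset.Ici j, l' i) :=
    congrArg (fun c : ℤ => (c : ℝ) / M) (congrFun h (Sum.inl j))
  have h2 : stair M u (∑ i ∈ Finset.Ioi j, l i) = stair M u' (∑ i ∈ Finset.Ioi j, l' i) :=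
    congrArg (fun c : ℤ => (c : ℝ) / M) (congrFun h (Sum.inr j))
  change stair M u _ - stair M u _ = stair M u' _ - stair M u' _
  rw [h1, h2]

end Reparametrization

/-! ### Sampling a family of loops -/

section Smoothing

open Set Topology MeasureTheory Filter unitInterval
open scoped Interval NNReal

lemma eventually_ceil_eq {y₀ : ℝ} (h : y₀ ∉ range ((↑) : ℤ → ℝ)) :
    ∀ᶠ y in 𝓝 y₀, ⌈y⌉ = ⌈y₀⌉ := by
  have h1 : y₀ < ⌈y₀⌉ := lt_of_le_of_ne (Int.le_ceil y₀) fun he => h ⟨_, he.symm⟩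
  have h2 : (⌈y₀⌉ : ℝ) - 1 < y₀ := by linarith [Int.ceil_lt_add_one y₀]
  filter_upwards [Ioo_mem_nhds h2 h1] with y hy
  exact Int.ceil_eq_iff.2 ⟨hy.1, hy.2.le⟩

lemma eventually_floor_eq {y₀ : ℝ} (h : y₀ ∉ range ((↑) : ℤ → ℝ)) :
    ∀ᶠ y in 𝓝 y₀, ⌊y⌋ = ⌊y₀⌋ := by
  have h1 : (⌊y₀⌋ : ℝ) < y₀ := lt_of_le_of_ne (Int.floor_le y₀) fun he => h ⟨_, he⟩
  filter_upwards [Ioo_mem_nhds h1 (Int.lt_floor_add_one y₀)] with y hy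
  exact Int.floor_eq_iff.2 ⟨hy.1.le, hy.2⟩

variable {V : Type*} [Fintype V] {F : Set (Finset V)} {n : ℕ}

/-- The vertex near the loop `q (l, ·)` at time `u`, with the parameter `l` moved to the grid in
phase with `u` and the time rounded down to a multiple of `1 / M`. -/
def sampleVertex (M : ℕ) [NeZero M]
    (q : C(stdSimplex ℝ (Fin (n + 1)) × UnitAddCircle, realization F))
    (l : stdSimplex ℝ (Fin (n + 1))) (u : ℝ) : V :=
  nearVertex (q (gridPoint M u l, ((⌊M * u⌋ / M : ℝ) : UnitAddCircle)))

/-- For `s ∈ [0, 1]` these are the points of a window of width `1 / M` near `t`, inside `[0, 1]`. -/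
def windowPoint (M : ℕ) (t s : ℝ) : ℝ := ((M - 1) * t + s) / M

lemma mul_windowPoint (M : ℕ) [NeZero M] (t s : ℝ) :
    M * windowPoint M t s = (M - 1) * t + s := by
  have hM : (M : ℝ) ≠ 0 := Nat.cast_ne_zero.2 (NeZero.ne M)
  rw [windowPoint]
  field_simp

lemma abs_sub_windowPoint_le (M : ℕ) [NeZero M] {t s : ℝ} (ht : t ∈ I) (hs : s ∈ I) :
    |t - windowPoint M t s| ≤ 1 / M := by
  have hM : (0 : ℝ) < M := Nat.cast_pos.2 (NeZero.pos M)
  have : t - windowPoint M t s = (t - s) / M := by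
    rw [windowPoint]
    field_simp
    ring
  rw [this, abs_div, abs_of_pos hM]
  refine div_le_div_of_nonneg_right ?_ hM.le
  rw [abs_le]
  constructor <;> linarith [ht.1, ht.2, hs.1, hs.2]

lemma sampleVertex_congr {M : ℕ} [NeZero M]
    (q : C(stdSimplex ℝ (Fin (n + 1)) × UnitAddCircle, realization F))
    {l l' : stdSimplex ℝ (Fin (n + 1))} {u u' : ℝ} (h : gridIndex M u l = gridIndex M u' l')
    (h' : ⌊M * u⌋ = ⌊M * u'⌋) : sampleVertex M q l u = sampleVertex M q l' u' := by
  rw [sampleVertex, sampleVertex, gridPoint_congr h, h']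

lemma eventually_sampleVertex_eq (M : ℕ) [NeZero M]
    (q : C(stdSimplex ℝ (Fin (n + 1)) × UnitAddCircle, realization F))
    (l : stdSimplex ℝ (Fin (n + 1))) {u₀ : ℝ} (h : M * u₀ ∉ range ((↑) : ℤ → ℝ))
    (h' : ∀ j, M * tailSum l j - u₀ ∉ range ((↑) : ℤ → ℝ)) :
    ∀ᶠ p : stdSimplex ℝ (Fin (n + 1)) × ℝ in 𝓝 (l, u₀),
      sampleVertex M q p.1 p.2 = sampleVertex M q l u₀ := by
  have hu : u₀ ≠ ⌊u₀⌋ := by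
    intro he
    refine h ⟨M * ⌊u₀⌋, ?_⟩
    push_cast
    rw [← he]
  have h1 : ∀ᶠ p : stdSimplex ℝ (Fin (n + 1)) × ℝ in 𝓝 (l, u₀), ⌊M * p.2⌋ = ⌊M * u₀⌋ := by
    have hc : ContinuousAt (fun p : stdSimplex ℝ (Fin (n + 1)) × ℝ => M * p.2) (l, u₀) := by
      fun_prop
    exact hc.eventually (eventually_floor_eq h)
  have h2 : ∀ᶠ p : stdSimplex ℝ (Fin (n + 1)) × ℝ in 𝓝 (l, u₀),
      ∀ j, gridIndex M p.2 p.1 j = gridIndex M u₀ l j := by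
    refine eventually_all.2 fun j => ?_
    have hc : ContinuousAt
        (fun p : stdSimplex ℝ (Fin (n + 1)) × ℝ => M * tailSum p.1 j - Int.fract p.2) (l, u₀) := by
      have hf : ContinuousAt (fun p : stdSimplex ℝ (Fin (n + 1)) × ℝ => Int.fract p.2) (l, u₀) :=
        ContinuousAt.comp (g := Int.fract) (continuousAt_fract hu) continuousAt_snd
      exact (continuousAt_const.mul ((continuous_tailSum j).continuousAt.comp
        continuousAt_fst)).sub hf
    refine hc.eventually (eventually_ceil_eq ?_)
    rintro ⟨c, hc⟩
    refine h' j ⟨c - ⌊u₀⌋, ?_⟩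
    have := Int.self_sub_floor u₀
    push_cast
    rw [hc]
    change M * tailSum l j - Int.fract u₀ - _ = _
    rw [← this]
    ring
  filter_upwards [h1, h2] with p hp1 hp2
  exact sampleVertex_congr q (funext hp2) hp1

variable [DecidableEq V]

/-- The moving average of the sampled vertices, over a window of width `1 / M`. -/
def smoothLoop (M : ℕ) [NeZero M]
    (q : C(stdSimplex ℝ (Fin (n + 1)) × UnitAddCircle, realization F))
    (l : stdSimplex ℝ (Fin (n + 1))) (t : ℝ) (v : V) : ℝ :=
  ∫ s in (0 : ℝ)..1, if sampleVertex M q l (windowPoint M t s) = v then 1 else 0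

section

variable (M : ℕ) [NeZero M] (q : C(stdSimplex ℝ (Fin (n + 1)) × UnitAddCircle, realization F))
  (l : stdSimplex ℝ (Fin (n + 1)))

lemma measurable_sampleVertex (v : V) :
    Measurable fun u => if sampleVertex M q l u = v then (1 : ℝ) else 0 := by
  let κ : ℝ → ((Fin (n + 1) ⊕ Fin (n + 1) → ℤ) × ℤ) := fun u => (gridIndex M u l, ⌊M * u⌋)
  let φ : ℝ → ℝ := fun u => if sampleVertex M q l u = v then (1 : ℝ) else 0
  have hφ : φ.FactorsThrough κ := by
    intro u u' h
    have h1 := sampleVertex_congr (M := M) q (l := l) (l' := l) (u := u) (u' := u')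
      (congrArg Prod.fst h) (congrArg Prod.snd h)
    simp only [φ, h1]
  have hκ : Measurable κ := by
    refine Measurable.prodMk (measurable_pi_lambda _ fun j => ?_) ?_
    · exact Int.measurable_ceil.comp (measurable_const.sub measurable_fract)
    · exact Int.measurable_floor.comp (measurable_const.mul measurable_id)
  have : φ = (Function.extend κ φ fun _ => 0) ∘ κ := funext fun u => (hφ.extend_apply _ u).symm
  change Measurable φ
  rw [this]
  exact (measurable_of_countable _).comp hκ

lemma measurable_sampleVertex_windowPoint (t : ℝ) (v : V) :
    Measurable fun s => if sampleVertex M q l (windowPoint M t s) = v then (1 : ℝ) else 0 :=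
  (measurable_sampleVertex M q l v).comp (by unfold windowPoint; fun_prop)

lemma indicator_mem_unitInterval (p : Prop) [Decidable p] : (if p then (1 : ℝ) else 0) ∈ I := by
  split_ifs <;> simp

lemma intervalIntegrable_of_unitInterval {φ : ℝ → ℝ} (hφ : Measurable φ) (h : ∀ s, φ s ∈ I)
    (a b : ℝ) : IntervalIntegrable φ volume a b := by
  refine (intervalIntegrable_const (c := (1 : ℝ))).mono_fun hφ.aestronglyMeasurable
    (Eventually.of_forall fun s => ?_)
  beta_reduce
  rw [Real.norm_eq_abs, abs_of_nonneg (h s).1, norm_one]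
  exact (h s).2

lemma smoothLoop_mem_stdSimplex (t : ℝ) : smoothLoop M q l t ∈ stdSimplex ℝ V := by
  refine ⟨fun v => intervalIntegral.integral_nonneg zero_le_one
    fun s _ => (indicator_mem_unitInterval _).1, ?_⟩
  unfold smoothLoop
  rw [← intervalIntegral.integral_finsetSum fun v _ => intervalIntegrable_of_unitInterval
    (measurable_sampleVertex_windowPoint M q l t v) (fun _ => indicator_mem_unitInterval _) 0 1]
  simp

lemma smoothLoop_eq_zero {t : ℝ} {v : V}
    (h : ∀ s, 0 ≤ s → s < 1 → sampleVertex M q l (windowPoint M t s) ≠ v) :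
    smoothLoop M q l t v = 0 := by
  refine intervalIntegral.integral_zero_ae ?_
  filter_upwards [(countable_singleton (1 : ℝ)).ae_notMem volume] with s hs1 hs
  rw [uIoc_of_le zero_le_one] at hs
  exact if_neg (h s hs.1.le (lt_of_le_of_ne hs.2 hs1))

lemma smoothLoop_eq_integral (t : ℝ) (v : V) : smoothLoop M q l t v =
    M * ∫ u in ((M - 1) * t / M)..((M - 1) * t / M + 1 / M),
      if sampleVertex M q l u = v then (1 : ℝ) else 0 := by
  have hM : (M : ℝ) ≠ 0 := Nat.cast_ne_zero.2 (NeZero.ne M)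
  have h := intervalIntegral.integral_comp_add_div (a := 0) (b := 1)
    (fun u => if sampleVertex M q l u = v then (1 : ℝ) else 0) hM ((M - 1) * t / M)
  rw [zero_div, add_zero, smul_eq_mul] at h
  rw [← h]
  unfold smoothLoop windowPoint
  simp only [add_div]

lemma abs_smoothLoop_sub_le (t t' : ℝ) (v : V) :
    |smoothLoop M q l t v - smoothLoop M q l t' v| ≤ 2 * M * |t - t'| := by
  have hM : (1 : ℝ) ≤ M := Nat.one_le_cast.2 (NeZero.pos M)
  have hM0 : (0 : ℝ) < M := by linarith
  let φ : ℝ → ℝ := fun u => if sampleVertex M q l u = v then (1 : ℝ) else 0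
  have hφ : ∀ a b, IntervalIntegrable φ volume a b := fun a b =>
    intervalIntegrable_of_unitInterval (measurable_sampleVertex M q l v)
      (fun _ => indicator_mem_unitInterval _) a b
  have hb : ∀ a b, |∫ u in a..b, φ u| ≤ |b - a| := fun a b => by
    have := intervalIntegral.norm_integral_le_of_norm_le_const (a := a) (b := b) (C := 1) (f := φ)
      fun s _ => by
        have h : φ s ∈ I := indicator_mem_unitInterval _
        rw [Real.norm_eq_abs, abs_of_nonneg h.1]
        exact h.2
    rwa [one_mul, Real.norm_eq_abs] at this
  rw [smoothLoop_eq_integral, smoothLoop_eq_integral, ← mul_sub,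
    intervalIntegral.integral_interval_sub_interval_comm (hφ _ _) (hφ _ _) (hφ _ _), abs_mul,
    abs_of_pos hM0]
  have e1 := hb ((M - 1) * t / M) ((M - 1) * t' / M)
  have e2 := hb ((M - 1) * t / M + 1 / M) ((M - 1) * t' / M + 1 / M)
  have e3 : |(M - 1) * t' / M - (M - 1) * t / M| ≤ |t - t'| := by
    have : (M - 1) * t' / M - (M - 1) * t / M = ((M - 1) / M) * (t' - t) := by ring
    rw [this, abs_mul, abs_sub_comm t', abs_of_nonneg (div_nonneg (by linarith) hM0.le)]
    exact mul_le_of_le_one_left (abs_nonneg _) ((div_le_one hM0).2 (by linarith))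
  have e4 : (M - 1) * t' / M + 1 / M - ((M - 1) * t / M + 1 / M) =
      (M - 1) * t' / M - (M - 1) * t / M := by ring
  rw [e4] at e2
  have e5 := abs_sub (∫ u in ((M - 1) * t / M)..((M - 1) * t' / M), φ u)
    (∫ u in ((M - 1) * t / M + 1 / M)..((M - 1) * t' / M + 1 / M), φ u)
  calc _ ≤ (M : ℝ) * (2 * |t - t'|) := mul_le_mul_of_nonneg_left (by linarith) hM0.le
    _ = 2 * M * |t - t'| := by ring

end

/-- The average is continuous although the sampled vertex jumps: for fixed `(l, t)`, almost every
sample in the window is locally constant in `(l, t)`. -/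
lemma continuous_smoothLoop (M : ℕ) [NeZero M]
    (q : C(stdSimplex ℝ (Fin (n + 1)) × UnitAddCircle, realization F)) (v : V) :
    Continuous fun p : stdSimplex ℝ (Fin (n + 1)) × ℝ => smoothLoop M q p.1 p.2 v := by
  have hM : (M : ℝ) ≠ 0 := Nat.cast_ne_zero.2 (NeZero.ne M)
  rw [continuous_iff_continuousAt]
  rintro ⟨l, t⟩
  refine intervalIntegral.continuousAt_of_dominated_interval (bound := fun _ => 1)
    (Eventually.of_forall fun p =>
      (measurable_sampleVertex_windowPoint M q p.1 p.2 v).aestronglyMeasurable)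
    (Eventually.of_forall fun p => Eventually.of_forall fun s _ => ?_)
    intervalIntegrable_const ?_
  · rw [Real.norm_eq_abs, abs_of_nonneg (indicator_mem_unitInterval _).1]
    exact (indicator_mem_unitInterval _).2
  have hinj : Function.Injective (windowPoint M t) := by
    intro s s' h
    have h1 := congrArg (fun u => (M : ℝ) * u) h
    simp only [mul_windowPoint] at h1
    linarith
  -- the sampled vertex is locally constant except at countably many points of the window
  have hc1 : {s | M * windowPoint M t s ∈ range ((↑) : ℤ → ℝ)}.Countable :=
    (countable_range _).preimage ((mul_right_injective₀ hM).comp hinj)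
  have hc2 : ∀ j, {s | M * tailSum l j - windowPoint M t s ∈ range ((↑) : ℤ → ℝ)}.Countable :=
    fun j => (countable_range _).preimage
      ((sub_right_injective (b := M * tailSum l j)).comp hinj)
  filter_upwards [hc1.ae_notMem volume, (countable_iUnion hc2).ae_notMem volume] with s hs1 hs2 _
  simp only [mem_iUnion, not_exists] at hs2
  have h := eventually_sampleVertex_eq M q l (u₀ := windowPoint M t s) hs1 hs2
  have hc : ContinuousAt (fun p : stdSimplex ℝ (Fin (n + 1)) × ℝ =>
      (p.1, windowPoint M p.2 s)) (l, t) := by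
    unfold windowPoint
    fun_prop
  refine ContinuousAt.congr (f := fun _ =>
    if sampleVertex M q l (windowPoint M t s) = v then (1 : ℝ) else 0) continuousAt_const ?_
  filter_upwards [hc.eventually h] with p hp
  rw [hp]

end Smoothing

section SmoothingNaturality

variable {V : Type*} [Fintype V] {F : Set (Finset V)} {m n : ℕ}
  (θ : Fin (m + 1) →o Fin (n + 1)) (M : ℕ) [NeZero M]
  (q : C(stdSimplex ℝ (Fin (n + 1)) × UnitAddCircle, realization F))
  (q' : C(stdSimplex ℝ (Fin (m + 1)) × UnitAddCircle, realization F))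

lemma sampleVertex_comp (h : ∀ l t, q' (l, t) = q (simplexMap θ l, t))
    (l : stdSimplex ℝ (Fin (m + 1))) (u : ℝ) :
    sampleVertex M q' l u = sampleVertex M q (simplexMap θ l) u := by
  rw [sampleVertex, sampleVertex, h, simplexMap_gridPoint]

/-- The moving average is natural for simplicial operators. -/
lemma smoothLoop_comp [DecidableEq V] (h : ∀ l t, q' (l, t) = q (simplexMap θ l, t))
    (l : stdSimplex ℝ (Fin (m + 1))) (t : ℝ) :
    smoothLoop M q' l t = smoothLoop M q (simplexMap θ l) t := by
  unfold smoothLoop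
  simp only [sampleVertex_comp θ M q q' h]

end SmoothingNaturality

/-! ### The length of the sampled loops -/

section WindowCount

open Set Topology MeasureTheory Filter unitInterval
open scoped NNReal ENNReal

variable {V : Type*} [Fintype V] {F : Set (Finset V)} {n : ℕ}

/-- The moving average takes values in the 1-skeleton as long as the window contains no jump of the
grid point. -/
lemma smoothLoop_mem_oneSkeleton [DecidableEq V] (M : ℕ) [NeZero M]
    (q : C(stdSimplex ℝ (Fin (n + 1)) × UnitAddCircle, realization F))
    (l : stdSimplex ℝ (Fin (n + 1))) {i : ℕ} (hi : i + 2 ≤ M)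
    (hj : ∀ j, ¬ (i ≤ M * Int.fract (M * tailSum l j) ∧ M * Int.fract (M * tailSum l j) ≤ i + 2)) :
    ∃ v w : V, ∀ t : ℝ, i ≤ (M - 1) * t → (M - 1) * t ≤ i + 1 →
      ∀ z, z ≠ v → z ≠ w → smoothLoop M q l t z = 0 := by
  have hM : (0 : ℝ) < M := Nat.cast_pos.2 (NeZero.pos M)
  have hiM : (i : ℝ) + 2 ≤ M := by exact_mod_cast hi
  have hi0 : (0 : ℝ) ≤ i := Nat.cast_nonneg i
  have hgrid : ∀ u u' : ℝ, i ≤ M * u → M * u < i + 2 → i ≤ M * u' → M * u' < i + 2 →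
      gridIndex M u l = gridIndex M u' l := by
    have hfr : ∀ u : ℝ, i ≤ M * u → M * u < i + 2 → Int.fract u = u := by
      intro u h1 h2
      refine Int.fract_eq_self.2 ⟨?_, ?_⟩
      · exact nonneg_of_mul_nonneg_right (hi0.trans h1) hM
      · by_contra! h
        have := mul_le_mul_of_nonneg_left h hM.le
        linarith
    have hcase : ∀ j, ∃ c : ℤ, ∀ u : ℝ, i ≤ M * u → M * u < i + 2 → gridIndex M u l j = c := by
      intro j
      set y := M * tailSum l j with hy
      have hf := Int.self_sub_floor y
      have hf0 := Int.fract_nonneg y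
      have hf1 := Int.fract_lt_one y
      rcases not_and_or.1 (hj j) with h | h
      · refine ⟨⌊y⌋, fun u h1 h2 => ?_⟩
        have hlt : Int.fract y < u := lt_of_mul_lt_mul_left ((not_le.1 h).trans_le h1) hM.le
        have hu1 : u < 1 := by rw [← hfr u h1 h2]; exact Int.fract_lt_one u
        rw [gridIndex, hfr u h1 h2, Int.ceil_eq_iff, ← hy]
        constructor <;> linarith
      · refine ⟨⌊y⌋ + 1, fun u h1 h2 => ?_⟩
        have hlt : u < Int.fract y := lt_of_mul_lt_mul_left (h2.trans (not_le.1 h)) hM.le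
        have hu0 : 0 ≤ u := by rw [← hfr u h1 h2]; exact Int.fract_nonneg u
        rw [gridIndex, hfr u h1 h2, Int.ceil_eq_iff, ← hy]
        push_cast
        constructor <;> linarith
    intro u u' h1 h2 h3 h4
    funext j
    obtain ⟨c, hc⟩ := hcase j
    rw [hc u h1 h2, hc u' h3 h4]
  refine ⟨sampleVertex M q l (i / M), sampleVertex M q l ((i + 1) / M), ?_⟩
  intro t ht1 ht2 z hz1 hz2
  refine smoothLoop_eq_zero M q l fun s hs0 hs1 hz => ?_
  have hw := mul_windowPoint M t s
  have e1 : (M : ℝ) * (i / M) = i := by field_simp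
  have e2 : (M : ℝ) * ((i + 1) / M) = i + 1 := by field_simp
  rcases lt_or_ge ((M - 1) * t + s) (i + 1) with h | h
  · refine hz1 (hz.symm.trans (sampleVertex_congr q (hgrid _ _ ?_ ?_ ?_ ?_) ?_))
    · rw [hw]; linarith
    · rw [hw]; linarith
    · rw [e1]
    · rw [e1]; linarith
    · rw [hw, e1, Int.floor_natCast, Int.floor_eq_iff]
      push_cast
      constructor <;> linarith
  · refine hz2 (hz.symm.trans (sampleVertex_congr q (hgrid _ _ ?_ ?_ ?_ ?_) ?_))
    · rw [hw]; linarith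
    · rw [hw]; linarith
    · rw [e2]; linarith
    · rw [e2]; linarith
    · rw [hw, e2]
      have : ⌊(i : ℝ) + 1⌋ = (i : ℤ) + 1 := by
        rw [Int.floor_add_one, Int.floor_natCast]
      rw [this, Int.floor_eq_iff]
      push_cast
      constructor <;> linarith

/-- A point lies in three windows at most. -/
lemma card_filter_window_le (N : ℕ) (y : ℝ) :
    ((Finset.range N).filter fun i : ℕ => (i : ℝ) ≤ y ∧ y ≤ i + 2).card ≤ 3 := by
  have hsub : ((Finset.range N).filter fun i : ℕ => (i : ℝ) ≤ y ∧ y ≤ i + 2) ⊆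
      Finset.Icc (⌊y⌋₊ - 2) ⌊y⌋₊ := by
    intro i hi
    rw [Finset.mem_filter] at hi
    have h1 : i ≤ ⌊y⌋₊ := Nat.le_floor hi.2.1
    have h2 : ⌊y⌋₊ ≤ i + 2 := Nat.floor_le_of_le (by push_cast; exact hi.2.2)
    rw [Finset.mem_Icc]
    omega
  refine (Finset.card_le_card hsub).trans ?_
  rw [Nat.card_Icc]
  omega

lemma eVariationOn_le_of_lipschitzOnWith {Y : Type*} [PseudoMetricSpace Y] {f : ℝ → Y} {K : ℝ≥0}
    {a b : ℝ} (hf : LipschitzOnWith K f (Icc a b)) :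
    eVariationOn f (Icc a b) ≤ ENNReal.ofReal (K * (b - a)) := by
  rcases lt_or_ge b a with h | h
  · rw [Icc_eq_empty (not_le.2 h), eVariationOn.subsingleton _ subsingleton_empty]
    exact zero_le
  · have h1 := hf.comp_eVariationOn_le (f := f) (g := id) (s := Icc a b) fun x hx => hx
    have h2 := ((monotone_id.monotoneOn (Icc a b)).eVariationOn_eq (left_mem_Icc.2 h)
      (right_mem_Icc.2 h)).le
    rw [inter_self] at h2
    refine h1.trans ((mul_le_mul_right h2 _).trans ?_)
    rw [ENNReal.ofReal_mul K.coe_nonneg, ENNReal.ofReal_coe_nnreal]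
    rfl

/-- A Lipschitz map which is constant on the 1-skeleton makes the length of the moving average
bounded linearly in the dimension of the simplex, independently of the fineness `M`. -/
lemma eVariationOn_comp_smoothLoop_le [DecidableEq V] {Y : Type*} [PseudoMetricSpace Y] {M : ℕ}
    [NeZero M] (hM2 : 2 ≤ M)
    (q : C(stdSimplex ℝ (Fin (n + 1)) × UnitAddCircle, realization F))
    (l : stdSimplex ℝ (Fin (n + 1))) {Φ : realization F → Y} {L : ℝ≥0} (hΦ : LipschitzWith L Φ)
    {b : Y} (hb : ∀ (x : realization F) (v w : V), (∀ z, z ≠ v → z ≠ w → x.1 z = 0) → Φ x = b)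
    (x : ℝ → realization F) (hx : ∀ t ∈ Icc (0 : ℝ) 1, (x t).1 = smoothLoop M q l t) :
    eVariationOn (fun t => Φ (x t)) (Icc 0 1) ≤ ENNReal.ofReal (24 * (n + 1) * L) := by
  classical
  have hM : (2 : ℝ) ≤ M := by exact_mod_cast hM2
  -- for `t` in `[i / (M - 1), (i + 1) / (M - 1)]`, the window lies in `[i / M, (i + 2) / M]`
  let E : ℕ → ℝ := fun i => i / (M - 1)
  have hE : Monotone E := fun i j hij =>
    div_le_div_of_nonneg_right (Nat.cast_le.2 hij) (by linarith)
  have hE0 : E 0 = 0 := by simp [E]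
  have hE1 : E (M - 1) = 1 := by
    simp only [E]
    rw [Nat.cast_sub (by omega)]
    push_cast
    exact div_self (by linarith)
  have hsum := eVariationOn.sum' (fun t => Φ (x t)) hE (n := M - 1)
  rw [hE0, hE1] at hsum
  rw [← hsum]
  have hsub : ∀ i ∈ Finset.range (M - 1), Icc (E i) (E (i + 1)) ⊆ Icc 0 1 := by
    intro i hi
    rw [Finset.mem_range] at hi
    refine Icc_subset_Icc ?_ ?_
    · rw [← hE0]; exact hE (Nat.zero_le i)
    · rw [← hE1]; exact hE hi
  let J : Fin (n + 1) ⊕ Fin (n + 1) → Finset ℕ := fun j =>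
    (Finset.range (M - 1)).filter fun i : ℕ =>
      (i : ℝ) ≤ M * Int.fract (M * tailSum l j) ∧ M * Int.fract (M * tailSum l j) ≤ i + 2
  -- the intervals whose windows may meet a jump of the grid point
  let B : Finset ℕ := Finset.univ.biUnion J
  have hBcard : B.card ≤ 6 * (n + 1) := by
    refine Finset.card_biUnion_le.trans ((Finset.sum_le_card_nsmul _ _ 3 fun j _ =>
      card_filter_window_le _ _).trans ?_)
    simp only [Finset.card_univ, Fintype.card_sum, Fintype.card_fin, smul_eq_mul]
    omega
  have hgood : ∀ i ∈ Finset.range (M - 1), i ∉ B →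
      eVariationOn (fun t => Φ (x t)) (Icc (E i) (E (i + 1))) = 0 := by
    intro i hi hiB
    have hi' := Finset.mem_range.1 hi
    obtain ⟨v, w, hvw⟩ := smoothLoop_mem_oneSkeleton M q l (i := i) (by omega) fun j hj =>
      hiB (Finset.mem_biUnion.2 ⟨j, Finset.mem_univ _, Finset.mem_filter.2 ⟨hi, hj⟩⟩)
    refine eVariationOn.constant_on ?_
    have hcon : ∀ t ∈ Icc (E i) (E (i + 1)), Φ (x t) = b := by
      intro t ht
      refine hb _ v w fun z hz1 hz2 => ?_
      rw [hx t (hsub i hi ht)]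
      refine hvw t ?_ ?_ z hz1 hz2
      · have := (div_le_iff₀ (by linarith : (0 : ℝ) < M - 1)).1 ht.1
        linarith
      · have := (le_div_iff₀ (by linarith : (0 : ℝ) < M - 1)).1 ht.2
        push_cast at this
        linarith
    rintro _ ⟨t, ht, rfl⟩ _ ⟨t', ht', rfl⟩
    exact (hcon t ht).trans (hcon t' ht').symm
  have hbad : ∀ i ∈ Finset.range (M - 1),
      eVariationOn (fun t => Φ (x t)) (Icc (E i) (E (i + 1))) ≤ ENNReal.ofReal (4 * L) := by
    intro i hi
    have hlip : LipschitzOnWith (L * (2 * M)) (fun t => Φ (x t)) (Icc (E i) (E (i + 1))) := by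
      refine LipschitzOnWith.of_dist_le_mul fun t ht t' ht' => ?_
      refine (hΦ.dist_le_mul _ _).trans ?_
      push_cast
      rw [mul_assoc]
      refine mul_le_mul_of_nonneg_left ?_ L.2
      rw [Subtype.dist_eq]
      refine (dist_pi_le_iff (by positivity)).2 fun v => ?_
      rw [hx t (hsub i hi ht), hx t' (hsub i hi ht'), Real.dist_eq, Real.dist_eq]
      exact abs_smoothLoop_sub_le M q l t t' v
    refine (eVariationOn_le_of_lipschitzOnWith hlip).trans (ENNReal.ofReal_le_ofReal ?_)
    have e1 : E (i + 1) - E i = 1 / (M - 1) := by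
      simp only [E]
      push_cast
      ring
    rw [e1]
    push_cast
    have e2 : 2 * (M : ℝ) * (1 / (M - 1)) ≤ 4 := by
      rw [mul_one_div, div_le_iff₀ (by linarith)]
      linarith
    calc (L : ℝ) * (2 * M) * (1 / (M - 1)) = L * (2 * M * (1 / (M - 1))) := by ring
      _ ≤ L * 4 := mul_le_mul_of_nonneg_left e2 L.2
      _ = 4 * L := mul_comm _ _
  calc ∑ i ∈ Finset.range (M - 1), eVariationOn (fun t => Φ (x t)) (Icc (E i) (E (i + 1)))
      ≤ ∑ i ∈ Finset.range (M - 1), if i ∈ B then ENNReal.ofReal (4 * L) else 0 := by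
        refine Finset.sum_le_sum fun i hi => ?_
        split_ifs with h
        · exact hbad i hi
        · exact (hgood i hi h).le
    _ ≤ ∑ i ∈ B, ENNReal.ofReal (4 * L) := by
        rw [← Finset.sum_filter]
        exact Finset.sum_le_sum_of_subset fun i hi => (Finset.mem_filter.1 hi).2
    _ = B.card * ENNReal.ofReal (4 * L) := by rw [Finset.sum_const, nsmul_eq_mul]
    _ ≤ (6 * (n + 1) : ℕ) * ENNReal.ofReal (4 * L) := by gcongr
    _ = ENNReal.ofReal (24 * (n + 1) * L) := by
        rw [← ENNReal.ofReal_natCast, ← ENNReal.ofReal_mul (by positivity)]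
        congr 1
        push_cast
        ring

end WindowCount

/-! ### Detours, and closed paths as loops -/

section Detour

open Set Topology unitInterval
open scoped NNReal ENNReal

/-- The projection of the real line to the unit interval. -/
def clampUnit (x : ℝ) : ℝ := projIcc (0 : ℝ) 1 zero_le_one x

lemma clampUnit_mem (x : ℝ) : clampUnit x ∈ I := (projIcc (0 : ℝ) 1 zero_le_one x).2

lemma clampUnit_of_nonpos {x : ℝ} (h : x ≤ 0) : clampUnit x = 0 := by
  rw [clampUnit, projIcc_of_le_left _ h]

lemma clampUnit_of_one_le {x : ℝ} (h : 1 ≤ x) : clampUnit x = 1 := by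
  rw [clampUnit, projIcc_of_right_le _ h]

lemma clampUnit_of_mem {x : ℝ} (h : x ∈ I) : clampUnit x = x := by
  rw [clampUnit, projIcc_of_mem _ h]

lemma clampUnit_monotone : Monotone clampUnit := fun _ _ h => monotone_projIcc zero_le_one h

lemma continuous_clampUnit : Continuous clampUnit :=
  continuous_subtype_val.comp continuous_projIcc

lemma abs_clampUnit_sub_le (x y : ℝ) : |clampUnit x - clampUnit y| ≤ |x - y| := by
  have := (LipschitzWith.projIcc (zero_le_one (α := ℝ))).dist_le_mul x y
  rwa [NNReal.coe_one, one_mul, Subtype.dist_eq, Real.dist_eq, Real.dist_eq] at this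

/-- The time coordinate of a rectilinear path in the square `[0, 1] × [0, 1]`, which goes up from
`(0, 0)`, then along the top to time `τ`, down, and along the bottom to `(1, 0)`. The parameter `s`
interpolates between the linear parametrization of the bottom side and this path. -/
def detourTime (s τ x : ℝ) : ℝ :=
  (1 - s) * x + s * (τ * clampUnit (4 * x - 1) + (1 - τ) * clampUnit (4 * x - 3))

/-- The height coordinate of the rectilinear path, whose maximal height is `κ`. -/
def detourHeight (κ x : ℝ) : ℝ := κ * min (clampUnit (4 * x)) (clampUnit (3 - 4 * x))

lemma LipschitzOnWith.Icc_concat {Y : Type*} [PseudoMetricSpace Y] {f : ℝ → Y} {K : ℝ≥0}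
    {a b c : ℝ} (h : LipschitzOnWith K f (Icc a b)) (h' : LipschitzOnWith K f (Icc b c)) :
    LipschitzOnWith K f (Icc a c) := by
  have key : ∀ x ∈ Icc a c, ∀ y ∈ Icc a c, x ≤ y → dist (f x) (f y) ≤ K * dist x y := by
    intro x hx y hy hxy
    rcases le_total y b with hyb | hyb
    · exact h.dist_le_mul x ⟨hx.1, hxy.trans hyb⟩ y ⟨hy.1, hyb⟩
    rcases le_total b x with hxb | hxb
    · exact h'.dist_le_mul x ⟨hxb, hx.2⟩ y ⟨hyb, hy.2⟩
    have h1 := h.dist_le_mul x ⟨hx.1, hxb⟩ b ⟨hx.1.trans hxb, le_rfl⟩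
    have h2 := h'.dist_le_mul b ⟨le_rfl, hyb.trans hy.2⟩ y ⟨hyb, hy.2⟩
    rw [Real.dist_eq, abs_sub_comm, abs_of_nonneg (by linarith)] at h1 h2 ⊢
    calc dist (f x) (f y) ≤ _ := dist_triangle _ (f b) _
      _ ≤ K * (b - x) + K * (y - b) := add_le_add h1 h2
      _ = K * (y - x) := by ring
  refine LipschitzOnWith.of_dist_le_mul fun x hx y hy => ?_
  rcases le_total x y with hxy | hxy
  · exact key x hx y hy hxy
  · rw [dist_comm, dist_comm x]
    exact key y hy x hx hxy

variable {Y : Type*} [PseudoMetricSpace Y] {E : ℝ → ℝ → Y} {D : ℝ≥0} {s κ τ : ℝ}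

lemma detourTime_mem (hs : s ∈ I) (hτ : τ ∈ I) {x : ℝ} (hx : x ∈ I) : detourTime s τ x ∈ I := by
  have h1 := clampUnit_mem (4 * x - 1)
  have h2 := clampUnit_mem (4 * x - 3)
  have key : ∀ {a y z : ℝ}, a ∈ I → y ∈ I → z ∈ I → (1 - a) * y + a * z ∈ I := by
    intro a y z ha hy hz
    constructor <;> nlinarith [ha.1, ha.2, hy.1, hy.2, hz.1, hz.2,
      mul_nonneg (sub_nonneg.2 ha.2) hy.1, mul_nonneg ha.1 hz.1,
      mul_nonneg (sub_nonneg.2 ha.2) (sub_nonneg.2 hy.2), mul_nonneg ha.1 (sub_nonneg.2 hz.2)]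
  refine key hs hx ?_
  have := key hτ h2 h1
  rwa [add_comm] at this

lemma detourTime_monotone (hs : s ∈ I) (hτ : τ ∈ I) : Monotone (detourTime s τ) := by
  intro x y h
  have h1 := clampUnit_monotone (by linarith : 4 * x - 1 ≤ 4 * y - 1)
  have h2 := clampUnit_monotone (by linarith : 4 * x - 3 ≤ 4 * y - 3)
  have e1 : 0 ≤ 1 - s := sub_nonneg.2 hs.2
  have e2 : 0 ≤ 1 - τ := sub_nonneg.2 hτ.2
  have e3 := hs.1
  have e4 := hτ.1
  unfold detourTime
  gcongr

lemma abs_detourTime_sub_le (hs : s ∈ I) (hτ : τ ∈ I) (x y : ℝ) :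
    |detourTime s τ x - detourTime s τ y| ≤ 4 * |x - y| := by
  have h1 := abs_clampUnit_sub_le (4 * x - 1) (4 * y - 1)
  have h2 := abs_clampUnit_sub_le (4 * x - 3) (4 * y - 3)
  have e1 : |4 * x - 1 - (4 * y - 1)| = 4 * |x - y| := by
    rw [← abs_of_pos (four_pos (α := ℝ)), ← abs_mul, abs_of_pos (four_pos (α := ℝ))]
    ring_nf
  have e2 : |4 * x - 3 - (4 * y - 3)| = 4 * |x - y| := by
    rw [← e1]
    ring_nf
  rw [e1, abs_le] at h1
  rw [e2, abs_le] at h2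
  have h0 := abs_le.1 (le_refl |x - y|)
  have key : ∀ {a b y z : ℝ}, a ∈ I → |y| ≤ b → |z| ≤ b → |(1 - a) * y + a * z| ≤ b := by
    intro a b y z ha hy hz
    rw [abs_le] at *
    have := ha.1
    have := sub_nonneg.2 ha.2
    constructor <;> nlinarith
  have h3 : detourTime s τ x - detourTime s τ y = (1 - s) * (x - y) +
      s * ((1 - τ) * (clampUnit (4 * x - 3) - clampUnit (4 * y - 3)) +
        τ * (clampUnit (4 * x - 1) - clampUnit (4 * y - 1))) := by
    unfold detourTime
    ring
  rw [h3]
  refine key hs ?_ (key hτ (abs_le.2 h2) (abs_le.2 h1))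
  linarith [abs_nonneg (x - y)]

lemma detourTime_zero (s τ : ℝ) : detourTime s τ 0 = 0 := by
  rw [detourTime, clampUnit_of_nonpos (by norm_num), clampUnit_of_nonpos (by norm_num)]
  ring

lemma detourTime_one (s τ : ℝ) : detourTime s τ 1 = 1 := by
  rw [detourTime, clampUnit_of_one_le (by norm_num), clampUnit_of_one_le (by norm_num)]
  ring

lemma detourHeight_zero (κ : ℝ) : detourHeight κ 0 = 0 := by
  rw [detourHeight, clampUnit_of_nonpos (by norm_num), min_eq_left (clampUnit_mem _).1, mul_zero]

lemma detourHeight_one (κ : ℝ) : detourHeight κ 1 = 0 := by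
  rw [detourHeight, clampUnit_of_nonpos (x := 3 - 4 * 1) (by norm_num),
    min_eq_right (clampUnit_mem _).1, mul_zero]

/-- The length of a path with a detour is bounded by the lengths of the bottom and the top side of
the square and of two vertical segments; the bottom side does not contribute if the detour comes
down at time `1` only. The parameters are switched on one after the other: first `s`, then `κ`, then
`τ`. -/
lemma eVariationOn_detour (hs : s ∈ I) (hκ : κ ∈ I) (hτ : τ ∈ I) (hsκ : s ≠ 1 → κ = 0)
    (hκτ : κ ≠ 1 → τ = 0) {A B : ℝ≥0}
    (hD : ∀ t ∈ I, LipschitzOnWith D (E t) I)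
    (hA : LipschitzOnWith A (fun t => E t 0) I) (hB : LipschitzOnWith B (fun t => E t 1) I) :
    (∃ L : ℝ≥0, LipschitzOnWith L (fun x => E (detourTime s τ x) (detourHeight κ x)) I) ∧
    eVariationOn (fun x => E (detourTime s τ x) (detourHeight κ x)) I ≤
      ENNReal.ofReal (2 * D) + eVariationOn (fun t => E t 1) I + eVariationOn (fun t => E t 0) I ∧
    (τ = 1 → eVariationOn (fun x => E (detourTime s τ x) (detourHeight κ x)) I ≤
      ENNReal.ofReal (2 * D) + eVariationOn (fun t => E t 1) I) := by
  by_cases hs1 : s = 1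
  swap
  · have hκ0 := hsκ hs1
    have hτ0 := hκτ (by rw [hκ0]; exact zero_ne_one)
    have e : (fun x => E (detourTime s τ x) (detourHeight κ x)) =
        (fun t => E t 0) ∘ detourTime s τ := by
      funext x
      simp only [Function.comp, detourHeight, hκ0, zero_mul]
    rw [e]
    refine ⟨⟨A * 4, LipschitzOnWith.comp hA (LipschitzOnWith.of_dist_le_mul fun x _ y _ => ?_)
      fun x hx => detourTime_mem hs hτ hx⟩, ?_, fun h => ?_⟩
    · exact abs_detourTime_sub_le hs hτ x y
    · exact (eVariationOn.comp_le_of_monotoneOn _ _ ((detourTime_monotone hs hτ).monotoneOn _)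
        fun x hx => detourTime_mem hs hτ hx).trans le_add_self
    · rw [hτ0] at h
      exact absurd h zero_ne_one
  subst hs1
  -- the four sides: up, along the top, down, along the bottom
  set γ : ℝ → Y := fun x => E (detourTime 1 τ x) (detourHeight κ x)
  have p1 : EqOn γ (fun x => E 0 (κ * (4 * x))) (Icc 0 (1 / 4)) := by
    intro x hx
    simp only [γ, detourTime, detourHeight]
    rw [clampUnit_of_nonpos (by linarith [hx.2]), clampUnit_of_nonpos (by linarith [hx.2]),
      clampUnit_of_mem ⟨by linarith [hx.1], by linarith [hx.2]⟩,
      clampUnit_of_one_le (x := 3 - 4 * x) (by linarith [hx.2]),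
      min_eq_left (by linarith [hx.2])]
    ring_nf
  have p2 : EqOn γ (fun x => E (τ * (4 * x - 1)) κ) (Icc (1 / 4) (1 / 2)) := by
    intro x hx
    simp only [γ, detourTime, detourHeight]
    rw [clampUnit_of_mem ⟨by linarith [hx.1], by linarith [hx.2]⟩,
      clampUnit_of_nonpos (by linarith [hx.2]), clampUnit_of_one_le (by linarith [hx.1]),
      clampUnit_of_one_le (x := 3 - 4 * x) (by linarith [hx.2]), min_self]
    ring_nf
  have p3 : EqOn γ (fun x => E τ (κ * (3 - 4 * x))) (Icc (1 / 2) (3 / 4)) := by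
    intro x hx
    simp only [γ, detourTime, detourHeight]
    rw [clampUnit_of_one_le (by linarith [hx.1]), clampUnit_of_nonpos (by linarith [hx.2]),
      clampUnit_of_one_le (x := 4 * x) (by linarith [hx.1]),
      clampUnit_of_mem ⟨by linarith [hx.2], by linarith [hx.1]⟩,
      min_eq_right (by linarith [hx.1])]
    ring_nf
  have p4 : EqOn γ (fun x => E (τ + (1 - τ) * (4 * x - 3)) 0) (Icc (3 / 4) 1) := by
    intro x hx
    simp only [γ, detourTime, detourHeight]
    rw [clampUnit_of_one_le (by linarith [hx.1]),
      clampUnit_of_mem ⟨by linarith [hx.1], by linarith [hx.2]⟩,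
      clampUnit_of_one_le (x := 4 * x) (by linarith [hx.1]),
      clampUnit_of_nonpos (by linarith [hx.1]), min_eq_right zero_le_one]
    ring_nf
  have hκ0 := hκ.1
  have hκ1 := hκ.2
  have hτ0 := hτ.1
  have hτ1 := sub_nonneg.2 hτ.2
  have l1 : LipschitzOnWith (D * 4) γ (Icc 0 (1 / 4)) := by
    refine LipschitzOnWith.of_dist_le_mul fun x hx y hy => ?_
    rw [p1 hx, p1 hy]
    refine ((hD 0 ⟨le_rfl, zero_le_one⟩).dist_le_mul _ ?_ _ ?_).trans ?_
    · constructor <;> nlinarith [hx.1, hx.2]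
    · constructor <;> nlinarith [hy.1, hy.2]
    · rw [Real.dist_eq, ← mul_sub, ← mul_sub, abs_mul, abs_mul, abs_of_nonneg hκ0,
        abs_of_pos (four_pos (α := ℝ)), ← Real.dist_eq]
      push_cast
      rw [mul_assoc]
      exact mul_le_mul_of_nonneg_left (mul_le_of_le_one_left (by positivity) hκ1) D.coe_nonneg
  have l3 : LipschitzOnWith (D * 4) γ (Icc (1 / 2) (3 / 4)) := by
    refine LipschitzOnWith.of_dist_le_mul fun x hx y hy => ?_
    rw [p3 hx, p3 hy]
    refine ((hD τ hτ).dist_le_mul _ ?_ _ ?_).trans ?_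
    · constructor <;> nlinarith [hx.1, hx.2]
    · constructor <;> nlinarith [hy.1, hy.2]
    · rw [Real.dist_eq, ← mul_sub, sub_sub_sub_cancel_left, ← mul_sub, abs_mul, abs_mul,
        abs_of_nonneg hκ0, abs_of_pos (four_pos (α := ℝ)), ← Real.dist_eq, dist_comm]
      push_cast
      rw [mul_assoc]
      exact mul_le_mul_of_nonneg_left (mul_le_of_le_one_left (by positivity) hκ1) D.coe_nonneg
  have hlin : ∀ {c : ℝ}, c ∈ I → ∀ x y d : ℝ,
      dist (c * (4 * x - d)) (c * (4 * y - d)) ≤ 4 * dist x y := by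
    intro c hc x y d
    rw [Real.dist_eq, ← mul_sub, sub_sub_sub_cancel_right, ← mul_sub, abs_mul, abs_mul,
      abs_of_nonneg hc.1, abs_of_pos (four_pos (α := ℝ)), ← Real.dist_eq]
    exact mul_le_of_le_one_left (by positivity) hc.2
  have m2 : MapsTo (fun x => τ * (4 * x - 1)) (Icc (1 / 4) (1 / 2)) I := fun x hx => by
    constructor <;> nlinarith [hx.1, hx.2]
  have m4 : MapsTo (fun x => τ + (1 - τ) * (4 * x - 3)) (Icc (3 / 4) 1) I := fun x hx => by
    constructor <;> nlinarith [hx.1, hx.2]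
  have l2 : LipschitzOnWith (B * 4) γ (Icc (1 / 4) (1 / 2)) := by
    refine LipschitzOnWith.of_dist_le_mul fun x hx y hy => ?_
    rw [p2 hx, p2 hy]
    by_cases hκ' : κ = 1
    · rw [hκ']
      refine (hB.dist_le_mul _ (m2 hx) _ (m2 hy)).trans ?_
      push_cast
      rw [mul_assoc]
      exact mul_le_mul_of_nonneg_left (hlin hτ x y 1) B.coe_nonneg
    · simp only [hκτ hκ', zero_mul, dist_self]
      positivity
  have l4 : LipschitzOnWith (A * 4) γ (Icc (3 / 4) 1) := by
    refine LipschitzOnWith.of_dist_le_mul fun x hx y hy => ?_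
    rw [p4 hx, p4 hy]
    refine (hA.dist_le_mul _ (m4 hx) _ (m4 hy)).trans ?_
    push_cast
    rw [mul_assoc, dist_add_left]
    exact mul_le_mul_of_nonneg_left
      (hlin (c := 1 - τ) ⟨hτ1, by linarith⟩ x y 3) A.coe_nonneg
  have v1 : eVariationOn γ (Icc 0 (1 / 4)) ≤ ENNReal.ofReal D := by
    refine (eVariationOn_le_of_lipschitzOnWith l1).trans_eq ?_
    push_cast
    congr 1
    ring
  have v3 : eVariationOn γ (Icc (1 / 2) (3 / 4)) ≤ ENNReal.ofReal D := by
    refine (eVariationOn_le_of_lipschitzOnWith l3).trans_eq ?_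
    push_cast
    congr 1
    ring
  have v2 : eVariationOn γ (Icc (1 / 4) (1 / 2)) ≤ eVariationOn (fun t => E t 1) I := by
    rw [eVariationOn.eq_of_eqOn p2]
    by_cases hκ' : κ = 1
    · rw [hκ']
      refine eVariationOn.comp_le_of_monotoneOn (fun t => E t 1) _ (fun x _ y _ h => ?_) m2
      gcongr
    · rw [hκτ hκ', eVariationOn.constant_on]
      · exact zero_le
      · rintro _ ⟨x, -, rfl⟩ _ ⟨y, -, rfl⟩
        simp only [zero_mul]
  have v4 : eVariationOn γ (Icc (3 / 4) 1) ≤ eVariationOn (fun t => E t 0) I := by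
    rw [eVariationOn.eq_of_eqOn p4]
    refine eVariationOn.comp_le_of_monotoneOn (fun t => E t 0) _ (fun x _ y _ h => ?_) m4
    gcongr
  have v4' : τ = 1 → eVariationOn γ (Icc (3 / 4) 1) = 0 := by
    intro h
    rw [eVariationOn.eq_of_eqOn p4, eVariationOn.constant_on]
    rintro _ ⟨x, -, rfl⟩ _ ⟨y, -, rfl⟩
    simp only [h, sub_self, zero_mul]
  have hsplit : ∀ {a b c : ℝ}, a ≤ b → b ≤ c →
      eVariationOn γ (Icc a c) = eVariationOn γ (Icc a b) + eVariationOn γ (Icc b c) := by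
    intro a b c hab hbc
    have := eVariationOn.Icc_add_Icc γ (s := univ) hab hbc (mem_univ b)
    simpa only [univ_inter] using this.symm
  have vsum : eVariationOn γ I = eVariationOn γ (Icc 0 (1 / 4)) +
      eVariationOn γ (Icc (1 / 4) (1 / 2)) + eVariationOn γ (Icc (1 / 2) (3 / 4)) +
      eVariationOn γ (Icc (3 / 4) 1) := by
    rw [← hsplit (by norm_num) (by norm_num), ← hsplit (by norm_num) (by norm_num),
      ← hsplit (by norm_num) (by norm_num)]
  have v5 : eVariationOn γ (Icc 0 (1 / 4)) + eVariationOn γ (Icc (1 / 4) (1 / 2)) +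
      eVariationOn γ (Icc (1 / 2) (3 / 4)) ≤
        ENNReal.ofReal (2 * D) + eVariationOn (fun t => E t 1) I := by
    rw [two_mul, ENNReal.ofReal_add D.coe_nonneg D.coe_nonneg]
    refine (add_le_add (add_le_add v1 v2) v3).trans_eq ?_
    ring
  refine ⟨⟨D * 4 + B * 4 + A * 4, ?_⟩, ?_, fun h => ?_⟩
  · refine ((((l1.weaken ?_).Icc_concat (l2.weaken ?_)).Icc_concat (l3.weaken ?_)).Icc_concat
      (l4.weaken ?_))
    · rw [add_assoc]; exact le_self_add
    · rw [add_right_comm]; exact le_add_self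
    · rw [add_assoc]; exact le_self_add
    · exact le_add_self
  · rw [vsum]
    exact add_le_add v5 v4
  · rw [vsum, v4' h, add_zero]
    exact v5

end Detour

section CircleMaps

open Set Topology unitInterval
open scoped NNReal

/-- A closed path which is Lipschitz on the unit interval is Lipschitz on the circle, with the same
constant, since the shorter arc between two points may be taken through the base point. -/
lemma lipschitzWith_of_comp_coe {Y : Type*} [PseudoMetricSpace Y] {f : UnitAddCircle → Y} {K : ℝ≥0}
    (h : LipschitzOnWith K (fun t : ℝ => f t) I) : LipschitzWith K f := by
  have key : ∀ x ∈ Ico (0 : ℝ) 1, ∀ y ∈ Ico (0 : ℝ) 1, x ≤ y →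
      dist (f x) (f y) ≤ K * dist (x : UnitAddCircle) y := by
    intro x hx y hy hxy
    have h0 : f ((0 : ℝ) : UnitAddCircle) = f ((1 : ℝ) : UnitAddCircle) := by
      rw [AddCircle.coe_period, QuotientAddGroup.mk_zero]
    have h1 := h.dist_le_mul x ⟨hx.1, hx.2.le⟩ y ⟨hy.1, hy.2.le⟩
    have h2 := h.dist_le_mul x ⟨hx.1, hx.2.le⟩ 0 ⟨le_rfl, zero_le_one⟩
    have h3 := h.dist_le_mul 1 ⟨zero_le_one, le_rfl⟩ y ⟨hy.1, hy.2.le⟩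
    beta_reduce at h2 h3
    rw [h0] at h2
    rw [Real.dist_eq, abs_of_nonneg (by linarith [hx.1])] at h2
    rw [Real.dist_eq, abs_of_nonneg (by linarith [hy.2])] at h3
    rw [Real.dist_eq, abs_sub_comm, abs_of_nonneg (by linarith)] at h1
    have hK := K.coe_nonneg
    have hd : dist (x : UnitAddCircle) y = |(y - x) - round (y - x)| := by
      rw [dist_comm, dist_eq_norm, ← AddCircle.coe_sub, UnitAddCircle.norm_eq]
    rw [hd]
    rcases le_or_gt (round (y - x)) 0 with hr | hr
    · refine h1.trans (mul_le_mul_of_nonneg_left ?_ hK)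
      have : ((round (y - x) : ℤ) : ℝ) ≤ 0 := by exact_mod_cast hr
      exact le_trans (by linarith) (le_abs_self _)
    · have : (1 : ℝ) ≤ (round (y - x) : ℤ) := by exact_mod_cast hr
      refine (dist_triangle _ (f ((1 : ℝ) : UnitAddCircle)) _).trans ((add_le_add h2 h3).trans ?_)
      rw [← mul_add]
      refine mul_le_mul_of_nonneg_left ?_ hK
      exact le_trans (by linarith) (neg_le_abs _)
  refine LipschitzWith.of_dist_le_mul fun x y => ?_
  obtain ⟨a, ha, rfl⟩ : ∃ a ∈ Ico (0 : ℝ) 1, (a : UnitAddCircle) = x := by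
    have := AddCircle.coe_image_Ico_eq (1 : ℝ) 0
    rw [zero_add] at this
    exact (this.symm ▸ mem_univ x : x ∈ _)
  obtain ⟨b, hb, rfl⟩ : ∃ a ∈ Ico (0 : ℝ) 1, (a : UnitAddCircle) = y := by
    have := AddCircle.coe_image_Ico_eq (1 : ℝ) 0
    rw [zero_add] at this
    exact (this.symm ▸ mem_univ y : y ∈ _)
  rcases le_total a b with hab | hab
  · exact key a ha b hb hab
  · rw [dist_comm, dist_comm (a : UnitAddCircle)]
    exact key b hb a ha hab

/-- A continuous family of closed paths is a continuous family of loops. -/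
lemma exists_continuous_loops {Z Y : Type*} [TopologicalSpace Z] [TopologicalSpace Y]
    (G : Z → ℝ → Y) (hG : Continuous fun p : Z × ℝ => G p.1 p.2) (h : ∀ z, G z 0 = G z 1) :
    ∃ Γ : C(Z, C(UnitAddCircle, Y)), ∀ z, ∀ t ∈ I, Γ z (t : UnitAddCircle) = G z t := by
  let f : Z × UnitAddCircle → Y := fun p => AddCircle.liftIco (1 : ℝ) 0 (G p.1) p.2
  have hf : ∀ z, ∀ t ∈ I, f (z, ((t : ℝ) : UnitAddCircle)) = G z t := by
    intro z t ht
    rcases ht.2.lt_or_eq with h1 | rfl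
    · exact AddCircle.liftIco_zero_coe_apply ⟨ht.1, h1⟩
    · rw [AddCircle.coe_period, ← h z, ← QuotientAddGroup.mk_zero]
      exact AddCircle.liftIco_zero_coe_apply ⟨le_rfl, zero_lt_one⟩
  -- `Z × I → Z × UnitAddCircle` is a quotient map because it is proper
  let c : I → UnitAddCircle := fun t => ((t : ℝ) : UnitAddCircle)
  have hc : Continuous c := (AddCircle.continuous_mk' 1).comp continuous_subtype_val
  have hcs : Function.Surjective c := by
    intro x
    have := AddCircle.coe_image_Icc_eq (1 : ℝ) 0
    rw [zero_add] at this
    obtain ⟨a, ha, rfl⟩ : x ∈ _ := this.symm ▸ mem_univ x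
    exact ⟨⟨a, ha⟩, rfl⟩
  have hp : IsProperMap (Prod.map (id : Z → Z) c) :=
    IsProperMap.prodMap isProperMap_id hc.isProperMap
  have hq := hp.isClosedMap.isQuotientMap hp.continuous (Function.surjective_id.prodMap hcs)
  have hfc : Continuous f := by
    rw [hq.continuous_iff]
    have : f ∘ Prod.map (id : Z → Z) c = fun p : Z × I => G p.1 p.2 :=
      funext fun p => hf p.1 p.2 p.2.2
    rw [this]
    exact hG.comp (continuous_fst.prodMk (continuous_subtype_val.comp continuous_snd))
  exact ⟨ContinuousMap.curry ⟨f, hfc⟩, fun z t ht => hf z t ht⟩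

end CircleMaps

/-! ### Fine families of loops -/

section FineSimplices

open Set Topology Filter unitInterval
open scoped NNReal ENNReal

variable {V : Type*} [Fintype V] {F : Set (Finset V)} {n : ℕ}

/-- The grid is fine enough for the family of loops `q`: every vertex sampled in the window of
time `t` belongs to the carrier of `q (l, t)`. -/
def IsFine (M : ℕ) [NeZero M]
    (q : C(stdSimplex ℝ (Fin (n + 1)) × UnitAddCircle, realization F)) : Prop :=
  ∀ l, ∀ t ∈ I, ∀ s ∈ I,
    0 < (q (l, ((t : ℝ) : UnitAddCircle))).1 (sampleVertex M q l (windowPoint M t s))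

lemma IsFine.comp {m : ℕ} (θ : Fin (m + 1) →o Fin (n + 1)) {M : ℕ} [NeZero M]
    {q : C(stdSimplex ℝ (Fin (n + 1)) × UnitAddCircle, realization F)}
    {q' : C(stdSimplex ℝ (Fin (m + 1)) × UnitAddCircle, realization F)} (hq : IsFine M q)
    (h : ∀ l t, q' (l, t) = q (simplexMap θ l, t)) : IsFine M q' := by
  intro l t ht s hs
  rw [sampleVertex_comp θ M q q' h, h]
  exact hq _ t ht s hs

/-- Every family of loops is fine for large `M`, by uniform continuity. -/
lemma exists_isFine (q : C(stdSimplex ℝ (Fin (n + 1)) × UnitAddCircle, realization F)) :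
    ∃ N : ℕ, ∀ (M : ℕ) [NeZero M], N ≤ M → IsFine M q := by
  have : Nonempty (stdSimplex ℝ (Fin (n + 1))) := inferInstance
  have hV := card_pos_of_realization (q (Classical.arbitrary _, 0))
  obtain ⟨δ, hδ, hq⟩ := Metric.uniformContinuous_iff.1
    (CompactSpace.uniformContinuous_of_continuous q.continuous) _ (inv_pos.2 hV)
  obtain ⟨N, hN⟩ := exists_nat_gt (2 / δ)
  refine ⟨N, fun M _ hM l t ht s hs => nearVertex_pos (hq ?_)⟩
  have hM0 : (0 : ℝ) < M := Nat.cast_pos.2 (NeZero.pos M)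
  have hMδ : 2 / (M : ℝ) < δ := by
    rw [div_lt_comm₀ hM0 hδ]
    exact hN.trans_le (Nat.cast_le.2 hM)
  refine lt_of_le_of_lt ?_ hMδ
  rw [dist_comm, Prod.dist_eq]
  refine max_le (dist_gridPoint_le M _ l) ?_
  set u := windowPoint M t s with hu
  have h1 : |t - u| ≤ 1 / M := abs_sub_windowPoint_le M ht hs
  have h2 : |u - ⌊M * u⌋ / M| ≤ 1 / M := by
    have : u - ⌊M * u⌋ / M = Int.fract (M * u) / M := by
      rw [← Int.self_sub_floor]
      field_simp
    rw [this, abs_of_nonneg (div_nonneg (Int.fract_nonneg _) hM0.le)]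
    exact div_le_div_of_nonneg_right (Int.fract_lt_one _).le hM0.le
  have h3 : dist (t : UnitAddCircle) ((⌊M * u⌋ / M : ℝ) : UnitAddCircle) ≤ |t - ⌊M * u⌋ / M| := by
    rw [dist_eq_norm, ← AddCircle.coe_sub, UnitAddCircle.norm_eq]
    simpa using round_le (t - ⌊M * u⌋ / M) 0
  refine h3.trans ((abs_sub_le t u _).trans ((add_le_add h1 h2).trans_eq ?_))
  ring

variable [DecidableEq V]

lemma IsFine.smoothLoop_eq_zero {M : ℕ} [NeZero M]
    {q : C(stdSimplex ℝ (Fin (n + 1)) × UnitAddCircle, realization F)} (hq : IsFine M q)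
    (l : stdSimplex ℝ (Fin (n + 1))) {t : ℝ} (ht : t ∈ I) (v : V)
    (hv : (q (l, (t : UnitAddCircle))).1 v = 0) : smoothLoop M q l t v = 0 := by
  refine _root_.smoothLoop_eq_zero M q l fun s hs0 hs1 h => ?_
  have := hq l t ht s ⟨hs0, hs1.le⟩
  rw [h, hv] at this
  exact lt_irrefl 0 this

/-- The moving average of a fine family of loops, as a family of points of the complex. -/
def smoothPoint (M : ℕ) [NeZero M]
    (q : C(stdSimplex ℝ (Fin (n + 1)) × UnitAddCircle, realization F)) (hq : IsFine M q)
    (l : stdSimplex ℝ (Fin (n + 1))) (t : ℝ) : realization F :=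
  ⟨smoothLoop M q l (clampUnit t), mem_realization_of_carrier
    (q (l, ((clampUnit t : ℝ) : UnitAddCircle))).2 (smoothLoop_mem_stdSimplex M q l _)
    fun v hv => hq.smoothLoop_eq_zero l (clampUnit_mem t) v hv⟩

lemma continuous_smoothPoint (M : ℕ) [NeZero M]
    (q : C(stdSimplex ℝ (Fin (n + 1)) × UnitAddCircle, realization F)) (hq : IsFine M q) :
    Continuous fun p : stdSimplex ℝ (Fin (n + 1)) × ℝ => smoothPoint M q hq p.1 p.2 := by
  refine continuous_induced_rng.2 (continuous_pi fun v => ?_)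
  change Continuous fun p : stdSimplex ℝ (Fin (n + 1)) × ℝ => smoothLoop M q p.1 (clampUnit p.2) v
  have h : Continuous fun p : stdSimplex ℝ (Fin (n + 1)) × ℝ => (p.1, clampUnit p.2) :=
    continuous_fst.prodMk (continuous_clampUnit.comp continuous_snd)
  have h' := (continuous_smoothLoop M q v).comp h
  exact h'

lemma lipschitzWith_smoothPoint (M : ℕ) [NeZero M]
    (q : C(stdSimplex ℝ (Fin (n + 1)) × UnitAddCircle, realization F)) (hq : IsFine M q)
    (l : stdSimplex ℝ (Fin (n + 1))) : LipschitzWith (2 * M) (smoothPoint M q hq l) := by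
  refine LipschitzWith.of_dist_le_mul fun t t' => ?_
  rw [Subtype.dist_eq]
  refine (dist_pi_le_iff (by positivity)).2 fun v => ?_
  rw [Real.dist_eq, Real.dist_eq]
  push_cast
  exact (abs_smoothLoop_sub_le M q l _ _ v).trans
    (mul_le_mul_of_nonneg_left (abs_clampUnit_sub_le t t') (by positivity))

variable {K : ℝ≥0} {S : I × realization F → realization F}

/-- The homotopy, with parameter `κ`, from `q (l, t)` to the image of the moving average under
`S (1, ·)`: while `κ ≤ 1 / 2` the point moves straight to the image under `S (0, ·)`, and then it
follows the homotopy `S`. -/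
def pushPoint (hS : ∀ x v, x.1 v = 0 → (S (0, x)).1 v = 0) (M : ℕ) [NeZero M]
    (q : C(stdSimplex ℝ (Fin (n + 1)) × UnitAddCircle, realization F)) (hq : IsFine M q)
    (l : stdSimplex ℝ (Fin (n + 1))) (t κ : ℝ) : realization F :=
  ⟨fun v => (1 - clampUnit (2 * κ)) * (q (l, ((clampUnit t : ℝ) : UnitAddCircle))).1 v +
    clampUnit (2 * κ) * (S (projIcc 0 1 zero_le_one (2 * κ - 1), smoothPoint M q hq l t)).1 v, by
    rcases le_total κ (1 / 2) with h | h
    · refine segment_mem_realization (q (l, ((clampUnit t : ℝ) : UnitAddCircle))).2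
        (S (_, smoothPoint M q hq l t)).2.1 (fun v hv => ?_) (clampUnit_mem _)
      rw [projIcc_of_le_left _ (by linarith)]
      exact hS _ _ (hq.smoothLoop_eq_zero l (clampUnit_mem t) v hv)
    · rw [clampUnit_of_one_le (by linarith)]
      simp only [sub_self, zero_mul, zero_add, one_mul]
      exact (S (_, smoothPoint M q hq l t)).2⟩

variable (hS : ∀ x v, x.1 v = 0 → (S (0, x)).1 v = 0) (M : ℕ) [NeZero M]
  (q : C(stdSimplex ℝ (Fin (n + 1)) × UnitAddCircle, realization F)) (hq : IsFine M q)

lemma continuous_pushPoint (hSc : Continuous S) :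
    Continuous fun p : stdSimplex ℝ (Fin (n + 1)) × ℝ × ℝ =>
      pushPoint hS M q hq p.1 p.2.1 p.2.2 := by
  have h1 : Continuous fun p : stdSimplex ℝ (Fin (n + 1)) × ℝ × ℝ =>
      q (p.1, ((clampUnit p.2.1 : ℝ) : UnitAddCircle)) := by
    have h := continuous_clampUnit.comp (continuous_fst.comp
      (continuous_snd (X := stdSimplex ℝ (Fin (n + 1))) (Y := ℝ × ℝ)))
    exact q.continuous.comp (continuous_fst.prodMk ((AddCircle.continuous_mk' 1).comp h))
  have h2 : Continuous fun p : stdSimplex ℝ (Fin (n + 1)) × ℝ × ℝ =>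
      S (projIcc 0 1 zero_le_one (2 * p.2.2 - 1), smoothPoint M q hq p.1 p.2.1) := by
    have h : Continuous fun p : stdSimplex ℝ (Fin (n + 1)) × ℝ × ℝ => (p.1, p.2.1) := by fun_prop
    have h' := (continuous_smoothPoint M q hq).comp h
    have h'' : Continuous fun p : stdSimplex ℝ (Fin (n + 1)) × ℝ × ℝ => 2 * p.2.2 - 1 := by
      fun_prop
    exact hSc.comp ((continuous_projIcc.comp h'').prodMk h')
  have h3 : Continuous fun p : stdSimplex ℝ (Fin (n + 1)) × ℝ × ℝ => clampUnit (2 * p.2.2) :=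
    continuous_clampUnit.comp (by fun_prop)
  refine continuous_induced_rng.2 (continuous_pi fun v => ?_)
  change Continuous fun p : stdSimplex ℝ (Fin (n + 1)) × ℝ × ℝ =>
    (1 - clampUnit (2 * p.2.2)) * (q (p.1, ((clampUnit p.2.1 : ℝ) : UnitAddCircle))).1 v +
      clampUnit (2 * p.2.2) *
        (S (projIcc 0 1 zero_le_one (2 * p.2.2 - 1), smoothPoint M q hq p.1 p.2.1)).1 v
  exact ((continuous_const.sub h3).mul ((continuous_coord v).comp h1)).add
    (h3.mul ((continuous_coord v).comp h2))

lemma pushPoint_zero (l : stdSimplex ℝ (Fin (n + 1))) {t : ℝ} (ht : t ∈ I) :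
    pushPoint hS M q hq l t 0 = q (l, (t : UnitAddCircle)) := by
  ext v
  simp only [pushPoint]
  rw [mul_zero, clampUnit_of_nonpos le_rfl, clampUnit_of_mem ht]
  ring

lemma pushPoint_one (l : stdSimplex ℝ (Fin (n + 1))) (t : ℝ) :
    pushPoint hS M q hq l t 1 = S (1, smoothPoint M q hq l t) := by
  ext v
  simp only [pushPoint]
  rw [clampUnit_of_one_le (by norm_num), projIcc_of_right_le _ (by norm_num)]
  simp

lemma lipschitzWith_pushPoint (hSL : LipschitzWith K S) (l : stdSimplex ℝ (Fin (n + 1))) (t : ℝ) :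
    LipschitzWith (2 + 2 * K) (pushPoint hS M q hq l t) := by
  refine LipschitzWith.of_dist_le_mul fun κ κ' => ?_
  rw [Subtype.dist_eq]
  refine (dist_pi_le_iff (by positivity)).2 fun v => ?_
  have ha := abs_clampUnit_sub_le (2 * κ) (2 * κ')
  have ha' := clampUnit_mem (2 * κ')
  have hb : ∀ v, |(S (projIcc 0 1 zero_le_one (2 * κ - 1), smoothPoint M q hq l t)).1 v -
      (S (projIcc 0 1 zero_le_one (2 * κ' - 1), smoothPoint M q hq l t)).1 v| ≤
        K * |2 * κ - 2 * κ'| := by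
    intro v
    rw [← Real.dist_eq]
    refine (dist_le_pi_dist _ _ v).trans ((hSL.dist_le_mul _ _).trans ?_)
    refine mul_le_mul_of_nonneg_left ?_ K.coe_nonneg
    rw [Prod.dist_eq, dist_self, max_eq_left dist_nonneg, Subtype.dist_eq]
    have := abs_clampUnit_sub_le (2 * κ - 1) (2 * κ' - 1)
    rwa [sub_sub_sub_cancel_right] at this
  have hb := hb v
  rw [Real.dist_eq, Real.dist_eq]
  simp only [pushPoint]
  generalize S (projIcc 0 1 zero_le_one (2 * κ - 1), smoothPoint M q hq l t) = y at hb ⊢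
  generalize S (projIcc 0 1 zero_le_one (2 * κ' - 1), smoothPoint M q hq l t) = y' at hb ⊢
  generalize q (l, ((clampUnit t : ℝ) : UnitAddCircle)) = x
  generalize clampUnit (2 * κ) = a at ha ⊢
  generalize clampUnit (2 * κ') = a' at ha ha' ⊢
  have e : (1 - a) * x.1 v + a * y.1 v - ((1 - a') * x.1 v + a' * y'.1 v) =
      (a - a') * (y.1 v - x.1 v) + a' * (y.1 v - y'.1 v) := by ring
  have h1 : |y.1 v - x.1 v| ≤ 1 := by
    rw [abs_le]
    constructor <;> linarith [realization_nonneg x v, realization_nonneg y v,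
      realization_le_one x v, realization_le_one y v]
  have h2 : |2 * κ - 2 * κ'| = 2 * |κ - κ'| := by
    rw [← mul_sub, abs_mul, abs_of_pos (two_pos (α := ℝ))]
  rw [h2] at ha hb
  rw [e]
  refine (abs_add_le _ _).trans ?_
  rw [abs_mul, abs_mul, abs_of_nonneg ha'.1]
  have h3 := mul_le_mul ha h1 (abs_nonneg _) (by positivity)
  have h4 := mul_le_mul ha'.2 hb (abs_nonneg _) zero_le_one
  push_cast
  linarith

lemma pushPoint_comp {m : ℕ} (θ : Fin (m + 1) →o Fin (n + 1))
    (q' : C(stdSimplex ℝ (Fin (m + 1)) × UnitAddCircle, realization F)) (hq' : IsFine M q')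
    (h : ∀ l t, q' (l, t) = q (simplexMap θ l, t)) (l : stdSimplex ℝ (Fin (m + 1))) (t κ : ℝ) :
    pushPoint hS M q' hq' l t κ = pushPoint hS M q hq (simplexMap θ l) t κ := by
  have e : smoothPoint M q' hq' l t = smoothPoint M q hq (simplexMap θ l) t :=
    Subtype.ext (smoothLoop_comp θ M q q' h l _)
  ext v
  simp only [pushPoint]
  rw [h, e]

end FineSimplices

/-! ### The deformations of loop spaces -/

section LoopSweep

open Set Topology Filter unitInterval
open scoped NNReal ENNReal

variable {V : Type*} [Fintype V] [DecidableEq V] {F : Set (Finset V)} {Y : Type u} [MetricSpace Y]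
  {P : C(UnitAddCircle, Y) → Prop} (Ψ : realization F ≃ₜ Y) {K L : ℝ≥0}
  {S : I × realization F → realization F} {n : ℕ}

/-- The family of loops in the complex which corresponds to a singular simplex of a loop space. -/
def loopFamily (ρ : C(stdSimplex ℝ (Fin (n + 1)), {f : C(UnitAddCircle, Y) // P f})) :
    C(stdSimplex ℝ (Fin (n + 1)) × UnitAddCircle, realization F) where
  toFun p := Ψ.symm ((ρ p.1).1 p.2)
  continuous_toFun := by
    have h : Continuous fun p : stdSimplex ℝ (Fin (n + 1)) × UnitAddCircle => (ρ p.1).1 :=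
      continuous_subtype_val.comp (ρ.continuous.comp continuous_fst)
    exact Ψ.symm.continuous.comp (h.eval continuous_snd)

/-- The deformation of a family of loops. While the parameter `η` grows from `0` to `1`, the loop is
first slowed down to leave time for a detour, then the detour grows to its full height, and finally
it sweeps over the whole loop. -/
def detourLoop (hS : ∀ x v, x.1 v = 0 → (S (0, x)).1 v = 0) (M : ℕ) [NeZero M]
    (q : C(stdSimplex ℝ (Fin (n + 1)) × UnitAddCircle, realization F)) (hq : IsFine M q)
    (z : stdSimplex ℝ (Fin (n + 1)) × I) (x : ℝ) : Y :=
  Ψ (pushPoint hS M q hq z.1 (detourTime (clampUnit (3 * z.2)) (clampUnit (3 * z.2 - 2)) x)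
    (detourHeight (clampUnit (3 * z.2 - 1)) x))

section

variable (hS : ∀ x v, x.1 v = 0 → (S (0, x)).1 v = 0) (M : ℕ) [NeZero M]
  (q : C(stdSimplex ℝ (Fin (n + 1)) × UnitAddCircle, realization F)) (hq : IsFine M q)

lemma continuous_detourLoop (hSc : Continuous S) :
    Continuous fun p : (stdSimplex ℝ (Fin (n + 1)) × I) × ℝ =>
      detourLoop Ψ hS M q hq p.1 p.2 := by
  have hc := continuous_clampUnit
  have h1 : Continuous fun p : (stdSimplex ℝ (Fin (n + 1)) × I) × ℝ =>
      detourTime (clampUnit (3 * p.1.2)) (clampUnit (3 * p.1.2 - 2)) p.2 := by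
    unfold detourTime
    fun_prop
  have h2 : Continuous fun p : (stdSimplex ℝ (Fin (n + 1)) × I) × ℝ =>
      detourHeight (clampUnit (3 * p.1.2 - 1)) p.2 := by
    unfold detourHeight
    fun_prop
  have h3 := (continuous_pushPoint hS M q hq hSc).comp
    ((continuous_fst.comp continuous_fst).prodMk (h1.prodMk h2))
  exact Ψ.continuous.comp h3

lemma detourLoop_at_zero (z : stdSimplex ℝ (Fin (n + 1)) × I) :
    detourLoop Ψ hS M q hq z 0 = Ψ (q (z.1, 0)) := by
  rw [detourLoop, detourTime_zero, detourHeight_zero,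
    pushPoint_zero _ _ _ _ _ ⟨le_rfl, zero_le_one⟩, QuotientAddGroup.mk_zero]

lemma detourLoop_at_one (z : stdSimplex ℝ (Fin (n + 1)) × I) :
    detourLoop Ψ hS M q hq z 1 = Ψ (q (z.1, 0)) := by
  rw [detourLoop, detourTime_one, detourHeight_one,
    pushPoint_zero _ _ _ _ _ ⟨zero_le_one, le_rfl⟩, AddCircle.coe_period]

lemma detourLoop_start (l : stdSimplex ℝ (Fin (n + 1))) {t : ℝ} (ht : t ∈ I) :
    detourLoop Ψ hS M q hq (l, 0) t = Ψ (q (l, (t : UnitAddCircle))) := by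
  have h : ∀ x : ℝ, x ≤ 0 → clampUnit x = 0 := fun x hx => clampUnit_of_nonpos hx
  simp only [detourLoop, detourTime, detourHeight, Icc.coe_zero]
  rw [h (3 * 0 - 1) (by norm_num), h (3 * 0) (by norm_num)]
  simp only [zero_mul, sub_zero, one_mul, add_zero]
  rw [pushPoint_zero _ _ _ _ _ ht]

end

lemma lipschitzOnWith_comp_coe {f : UnitAddCircle → Y} {A : ℝ≥0} (hf : LipschitzWith A f) :
    LipschitzOnWith A (fun t : ℝ => f t) I := by
  refine LipschitzOnWith.of_dist_le_mul fun x _ y _ => (hf.dist_le_mul _ _).trans ?_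
  refine mul_le_mul_of_nonneg_left ?_ A.coe_nonneg
  rw [dist_eq_norm, ← AddCircle.coe_sub, UnitAddCircle.norm_eq, Real.dist_eq]
  simpa using round_le (x - y) 0

/-- The deformed loops are Lipschitz, they are longer than the original ones by a bounded amount,
and in the end their length is bounded. -/
lemma detourLoop_spec (hΨ : LipschitzWith L Ψ) (hSL : LipschitzWith K S)
    (hS : ∀ x v, x.1 v = 0 → (S (0, x)).1 v = 0) {b : realization F}
    (hSb : ∀ (x : realization F) (v w : V), (∀ z, z ≠ v → z ≠ w → x.1 z = 0) → S (1, x) = b)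
    {M : ℕ} [NeZero M] (hM : 2 ≤ M)
    (q : C(stdSimplex ℝ (Fin (n + 1)) × UnitAddCircle, realization F)) (hq : IsFine M q)
    (l : stdSimplex ℝ (Fin (n + 1))) (η : I) (f : C(UnitAddCircle, Y))
    (hf : ∃ A : ℝ≥0, LipschitzWith A f) (hqf : ∀ t, q (l, t) = Ψ.symm (f t)) :
    (∃ B : ℝ≥0, LipschitzOnWith B (detourLoop Ψ hS M q hq (l, η)) I) ∧
    (eVariationOn (detourLoop Ψ hS M q hq (l, η)) I).toReal ≤
      2 * (L * (2 + 2 * K)) + 24 * (n + 1) * (L * K) + loopLength f ∧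
    (η = 1 → (eVariationOn (detourLoop Ψ hS M q hq (l, η)) I).toReal ≤
      2 * (L * (2 + 2 * K)) + 24 * (n + 1) * (L * K)) := by
  obtain ⟨A, hA⟩ := hf
  have hbase : EqOn (fun t => Ψ (pushPoint hS M q hq l t 0))
      (fun t : ℝ => f (t : UnitAddCircle)) I := by
    intro t ht
    beta_reduce
    rw [pushPoint_zero _ _ _ _ _ ht, hqf, Ψ.apply_symm_apply]
  have hSone : LipschitzWith K fun x => S (1, x) := by
    refine LipschitzWith.of_dist_le_mul fun x y => (hSL.dist_le_mul _ _).trans_eq ?_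
    rw [Prod.dist_eq, dist_self, max_eq_right dist_nonneg]
  have htop := eVariationOn_comp_smoothLoop_le hM q l (hΨ.comp hSone) (b := Ψ b)
    (fun x v w h => congrArg Ψ (hSb x v w h)) (smoothPoint M q hq l) fun t ht =>
      congrArg (smoothLoop M q l) (clampUnit_of_mem ht)
  have htop' : (fun t => Ψ (pushPoint hS M q hq l t 1)) =
      fun t => (Ψ ∘ fun x => S (1, x)) (smoothPoint M q hq l t) :=
    funext fun t => congrArg Ψ (pushPoint_one hS M q hq l t)
  obtain ⟨h1, h2, h3⟩ := eVariationOn_detour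
    (E := fun t κ => Ψ (pushPoint hS M q hq l t κ)) (D := L * (2 + 2 * K)) (A := A)
    (B := L * K * (2 * M))
    (clampUnit_mem (3 * η)) (clampUnit_mem (3 * η - 1)) (clampUnit_mem (3 * η - 2))
    (fun h => clampUnit_of_nonpos (by
      by_contra! h'
      exact h (clampUnit_of_one_le (by linarith))))
    (fun h => clampUnit_of_nonpos (by
      by_contra! h'
      exact h (clampUnit_of_one_le (by linarith))))
    (fun t _ => (hΨ.comp (lipschitzWith_pushPoint hS M q hq hSL l t)).lipschitzOnWith)
    (fun x hx y hy => by
      have := lipschitzOnWith_comp_coe hA hx hy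
      rwa [← hbase hx, ← hbase hy] at this)
    (by
      rw [htop']
      exact ((hΨ.comp hSone).comp (lipschitzWith_smoothPoint M q hq l)).lipschitzOnWith)
  rw [htop'] at h2 h3
  rw [eVariationOn.eq_of_eqOn hbase] at h2
  have hfin : eVariationOn (fun t : ℝ => f (t : UnitAddCircle)) I ≠ ∞ :=
    ne_top_of_le_ne_top ENNReal.ofReal_ne_top
      (eVariationOn_le_of_lipschitzOnWith (lipschitzOnWith_comp_coe hA))
  have e : ENNReal.ofReal (2 * ↑(L * (2 + 2 * K))) + ENNReal.ofReal (24 * (n + 1) * ↑(L * K)) =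
      ENNReal.ofReal (2 * (L * (2 + 2 * K)) + 24 * (n + 1) * (L * K)) := by
    rw [← ENNReal.ofReal_add (by positivity) (by positivity)]
    push_cast
    rfl
  have hnn : (0 : ℝ) ≤ 2 * (L * (2 + 2 * K)) + 24 * (n + 1) * (L * K) := by positivity
  refine ⟨h1, ?_, fun hη => ?_⟩
  · have h4 := h2.trans (add_le_add_left (add_le_add_right htop _) _)
    rw [e] at h4
    have h5 := ENNReal.toReal_mono (ENNReal.add_ne_top.2 ⟨ENNReal.ofReal_ne_top, hfin⟩) h4
    rw [ENNReal.toReal_add ENNReal.ofReal_ne_top hfin, ENNReal.toReal_ofReal hnn] at h5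
    exact h5
  · have h4 := (h3 (by rw [hη]; exact clampUnit_of_one_le (by norm_num))).trans
      (add_le_add_right htop _)
    rw [e] at h4
    have h5 := ENNReal.toReal_mono ENNReal.ofReal_ne_top h4
    rwa [ENNReal.toReal_ofReal hnn] at h5

/-- On a space of Lipschitz loops which is defined by a condition on the base point only, there are
deformations which apply to finer and finer singular simplices, lengthen loops by a bounded amount
and end with loops of bounded length. The bound is linear in the dimension of the simplices. -/
lemma exists_compressing_sweeps (hΨ : LipschitzWith L Ψ) (hSL : LipschitzWith K S)
    (hS : ∀ x v, x.1 v = 0 → (S (0, x)).1 v = 0) {b : realization F}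
    (hSb : ∀ (x : realization F) (v w : V), (∀ z, z ≠ v → z ≠ w → x.1 z = 0) → S (1, x) = b)
    (hP1 : ∀ f, P f → ∃ A : ℝ≥0, LipschitzWith A f)
    (hP2 : ∀ f g : C(UnitAddCircle, Y), P f → (∃ A : ℝ≥0, LipschitzWith A g) → g 0 = f 0 → P g) :
    ∃ D : ℕ → SimplexSweep {f : C(UnitAddCircle, Y) // P f}, ∀ n : ℕ,
      SimplexSweep.Compresses D (fun f => loopLength f.1) n
        (2 * (L * (2 + 2 * K)) + 24 * (n + 1) * (L * K)) := by
  have hex : ∀ (N : ℕ) {n : ℕ}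
      (ρ : C(stdSimplex ℝ (Fin (n + 1)), {f : C(UnitAddCircle, Y) // P f}))
      (h : IsFine (N + 2) (loopFamily Ψ ρ)),
      ∃ Γ : C(stdSimplex ℝ (Fin (n + 1)) × I, {f : C(UnitAddCircle, Y) // P f}),
        ∀ z, ∀ t ∈ I, (Γ z).1 (t : UnitAddCircle) =
          detourLoop Ψ hS (N + 2) (loopFamily Ψ ρ) h z t := by
    intro N n ρ h
    obtain ⟨Γ, hΓ⟩ := exists_continuous_loops _
      (continuous_detourLoop Ψ hS (N + 2) (loopFamily Ψ ρ) h hSL.continuous) fun z =>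
        (detourLoop_at_zero Ψ hS _ _ h z).trans (detourLoop_at_one Ψ hS _ _ h z).symm
    refine ⟨⟨fun z => ⟨Γ z, hP2 (ρ z.1).1 _ (ρ z.1).2 ?_ ?_⟩, by fun_prop⟩, fun z t ht => hΓ z t ht⟩
    · obtain ⟨⟨B, hB⟩, -⟩ := detourLoop_spec Ψ hΨ hSL hS hSb (by omega : 2 ≤ N + 2)
        (loopFamily Ψ ρ) h z.1 z.2 (ρ z.1).1 (hP1 _ (ρ z.1).2) fun t => rfl
      refine ⟨B, lipschitzWith_of_comp_coe fun x hx y hy => ?_⟩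
      beta_reduce
      rw [hΓ z x hx, hΓ z y hy]
      exact hB hx hy
    · have := hΓ z 0 ⟨le_rfl, zero_le_one⟩
      rw [QuotientAddGroup.mk_zero, detourLoop_at_zero] at this
      exact this.trans (Ψ.apply_symm_apply _)
  have hcircle : ∀ {g g' : C(UnitAddCircle, Y)},
      (∀ t ∈ I, g ((t : ℝ) : UnitAddCircle) = g' ((t : ℝ) : UnitAddCircle)) → g = g' := by
    intro g g' h
    ext x
    have := AddCircle.coe_image_Icc_eq (1 : ℝ) 0
    rw [zero_add] at this
    obtain ⟨a, ha, rfl⟩ : x ∈ _ := this.symm ▸ mem_univ x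
    exact h a ha
  let D : ℕ → SimplexSweep {f : C(UnitAddCircle, Y) // P f} := fun N =>
    { Good := fun ρ => IsFine (N + 2) (loopFamily Ψ ρ)
      sweep := fun ρ h => (hex N ρ h).choose
      good_comp := fun θ ρ h => h.comp θ fun l t => rfl
      sweep_comp := by
        intro m n θ ρ h h' l s
        refine Subtype.ext (hcircle fun t ht => ?_)
        rw [(hex N _ h').choose_spec _ t ht, (hex N _ h).choose_spec _ t ht]
        exact congrArg Ψ (pushPoint_comp hS (N + 2) _ h θ _ h' (fun l t => rfl) l _ _)
      sweep_zero := by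
        intro n ρ h l
        refine Subtype.ext (hcircle fun t ht => ?_)
        rw [(hex N _ h).choose_spec _ t ht, detourLoop_start _ _ _ _ _ _ ht]
        exact Ψ.apply_symm_apply _ }
  have hlen : ∀ (N : ℕ) {n : ℕ}
      (ρ : C(stdSimplex ℝ (Fin (n + 1)), {f : C(UnitAddCircle, Y) // P f}))
      (h : IsFine (N + 2) (loopFamily Ψ ρ)) (z : stdSimplex ℝ (Fin (n + 1)) × I),
      loopLength ((hex N ρ h).choose z).1 =
        (eVariationOn (detourLoop Ψ hS (N + 2) (loopFamily Ψ ρ) h z) I).toReal := fun N n ρ h z =>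
    congrArg ENNReal.toReal (eVariationOn.eq_of_eqOn fun t ht => (hex N ρ h).choose_spec z t ht)
  refine ⟨D, fun n => ⟨fun ρ => ?_, fun N ρ h l s => ?_, fun N ρ h l => ?_⟩⟩
  · obtain ⟨N₀, hN₀⟩ := exists_isFine (loopFamily Ψ ρ)
    filter_upwards [eventually_ge_atTop N₀] with N hN
    exact hN₀ (N + 2) (by omega)
  · have h1 := (detourLoop_spec Ψ hΨ hSL hS hSb (by omega : 2 ≤ N + 2)
      (loopFamily Ψ ρ) h l s (ρ l).1 (hP1 _ (ρ l).2) fun t => rfl).2.1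
    rw [← hlen N ρ h] at h1
    refine h1.trans_eq (add_comm _ _)
  · have h1 := (detourLoop_spec Ψ hΨ hSL hS hSb (by omega : 2 ≤ N + 2)
      (loopFamily Ψ ρ) h l 1 (ρ l).1 (hP1 _ (ρ l).2) fun t => rfl).2.2 rfl
    rw [← hlen N ρ h] at h1
    exact h1

lemma SimplexSweep.Compresses.mono {A : Type u} [TopologicalSpace A] {D : ℕ → SimplexSweep A}
    {f : A → ℝ} {c c' : ℝ} (h : SimplexSweep.Compresses D f n c) (hc : c ≤ c') :
    SimplexSweep.Compresses D f n c' where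
  eventually_good := h.eventually_good
  sweep_le N ρ hρ l s := (h.sweep_le N ρ hρ l s).trans (by linarith)
  sweep_one_le N ρ hρ l := (h.sweep_one_le N ρ hρ l).trans hc

end LoopSweep

end

theorem theoremB {Y : Type u} [MetricSpace Y] [SimplyConnectedSpace Y]
    (hY : IsFiniteComplexBilipschitzToLinear Y) :
    ∃ C : ℝ, ∀ (k : Type v) [Field k] (m : ℕ), 1 ≤ m →
      ((∀ (y₀ : Y) (p : ℝ),
          (persistentHomology k m (BasedLoops.len (y₀ := y₀))).HasInfiniteBar p →
            p ≤ C * m + C) ∧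
        (∀ p : ℝ,
          (persistentHomology k m (FreeLoops.len (Y := Y))).HasInfiniteBar p →
            p ≤ C * m + C)) ∧
      ((∀ (y₀ : Y) (p q : ℝ),
          (persistentHomology k (m - 1) (BasedLoops.len (y₀ := y₀))).HasFiniteBar p q →
            q - p ≤ C * m + C) ∧
        (∀ p q : ℝ,
          (persistentHomology k (m - 1) (FreeLoops.len (Y := Y))).HasFiniteBar p q →
            q - p ≤ C * m + C)) := by
  obtain ⟨n, F, Ψ, L, hF, hΨ⟩ := hY.exists_realization
  have : SimplyConnectedSpace (realization F) := Ψ.toHomotopyEquiv.simplyConnectedSpace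
  obtain ⟨K, S, b, hSL, hS, hSb⟩ := exists_lipschitz_contraction_of_skeleton hF
  have hle : ∀ n m : ℕ, n ≤ m → 2 * (L * (2 + 2 * K)) + 24 * (n + 1) * (L * K) ≤
      (4 * L + 28 * (L * K) : ℝ) * m + (4 * L + 28 * (L * K)) := by
    intro n m h
    have h1 : (n : ℝ) ≤ m := Nat.cast_le.2 h
    have h2 : (0 : ℝ) ≤ L * K := by positivity
    have h3 : (0 : ℝ) ≤ L * m := by positivity
    have h4 : (0 : ℝ) ≤ L * K * m := by positivity
    nlinarith [mul_le_mul_of_nonneg_left h1 h2]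
  have h0 : ∀ m : ℕ, 0 ≤ (4 * L + 28 * (L * K) : ℝ) * m + (4 * L + 28 * (L * K)) := fun m => by
    positivity
  obtain ⟨DΛ, hDΛ⟩ := exists_compressing_sweeps (P := fun f => ∃ A : NNReal, LipschitzWith A f)
    Ψ hΨ hSL hS hSb (fun f hf => hf) fun f g _ hg _ => hg
  have hΛ : ∀ n m : ℕ, n ≤ m → SimplexSweep.Compresses (A := FreeLoops Y) DΛ FreeLoops.len n _ :=
    fun n m h => (hDΛ n).mono (hle n m h)
  have hΩ : ∀ y₀ : Y, ∃ D : ℕ → SimplexSweep (BasedLoops Y y₀), ∀ n m : ℕ, n ≤ m →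
      SimplexSweep.Compresses D BasedLoops.len n
        ((4 * L + 28 * (L * K) : ℝ) * m + (4 * L + 28 * (L * K))) := by
    intro y₀
    obtain ⟨D, hD⟩ := exists_compressing_sweeps
      (P := fun f => (∃ A : NNReal, LipschitzWith A f) ∧ f 0 = y₀) Ψ hΨ hSL hS hSb
      (fun f hf => hf.1) fun f g hf hg h => ⟨hg, h.trans hf.2⟩
    exact ⟨D, fun n m h => (hD n).mono (hle n m h)⟩
  refine ⟨4 * L + 28 * (L * K), fun k _ m hm => ⟨⟨fun y₀ p hp => ?_, fun p hp => ?_⟩,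
    fun y₀ p q hp => ?_, fun p q hp => ?_⟩⟩
  · obtain ⟨D, hD⟩ := hΩ y₀
    exact (hD m m le_rfl).infiniteBar_le (h0 m) k hp
  · exact (hΛ m m le_rfl).infiniteBar_le (h0 m) k hp
  · obtain ⟨D, hD⟩ := hΩ y₀
    exact (hD (m - 1) m (Nat.sub_le m 1)).finiteBar_le (hD (m - 1 + 1) m (by omega))
      (fun f => ENNReal.toReal_nonneg) (h0 m) k hp
  · exact (hΛ (m - 1) m (Nat.sub_le m 1)).finiteBar_le (hΛ (m - 1 + 1) m (by omega))
      (fun f => ENNReal.toReal_nonneg) (h0 m) k hp
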